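/- **Setting.** For complex numbers $\beta,\alpha_1,\alpha_2,\alpha_3$ let $\mathrm{dGh}^1_2$ be the dilute one-boundary ghost algebra on two strands. Its basis consists of the diagrams drawn in a rectangle with left nodes $L_1,L_2$ and right nodes $R_1,R_2$ (numbered downwards) and with a boundary line along the top. Each node is empty or is the end of one string; strings do not cross and join two nodes or a node and the boundary; ghosts sit on the boundary, counted modulo $2$ in each domain of the boundary; the number of ghosts plus the number of string ends on the boundary is even. The product of two diagrams is zero if a string meets an empty node. Otherwise it is the concatenation, where each closed loop is replaced by a factor $\beta$ and each string joining the boundary to itself is replaced by a factor, leaving a ghost at both of its ends; two ghosts in the same domain cancel. Numbering all ghosts and string ends on the boundary of the concatenation (before any removal) from left to right by $1,2,\dots$, this factor is $\alpha_1$ if the left end of the string is odd and its right end even, $\alpha_2$ if the left end is even and the right end odd, and $\alpha_3$ if both have the same parity. Below, $(p\,q)$ denotes a string joining the nodes $p$ and $q$; a word in square brackets lists what is on the boundary from left to right, where $g$ is a ghost and $p$ is the end of the string from node $p$; nodes not mentioned are empty. Let $\phi\in\mathbb C$ and put $\beta=-2\cos 4\phi$. The bulk face operator of Batchelor and Yung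 is $$\begin{aligned}X(u)={}&\big(\sin2\phi\sin3\phi+\sin u\sin(3\phi-u)\big)\,\varnothing+\sin2\phi\sin(3\phi-u)\big((L_1R_1)+(L_2R_2)\big)\\&+\sin2\phi\sin u\big((L_1L_2)+(R_1R_2)\big)+\sin u\sin(3\phi-u)\big((L_2R_1)+(L_1R_2)\big)\\&+\sin(2\phi-u)\sin(3\phi-u)\,(L_1R_1)(L_2R_2)-\sin u\sin(\phi-u)\,(L_1L_2)(R_1R_2),\end{aligned}$$ where $\varnothing$ is the diagram with all nodes empty. For a diagram $d$ involving only $L_1,R_1$ let $\bar d=d+d\,(L_2R_2)$ be the sum of $d$ without and with the additional string $(L_2R_2)$. The boundary face operator with coefficient functions $a_1,a_2,b_1,\dots,b_8:\mathbb C\to\mathbb C$ is $$\begin{aligned}K(u)={}&a_1(u)\overline{(L_1R_1)}+a_2(u)\overline{\varnothing}+b_1(u)\overline{[L_1R_1]}+b_2(u)\overline{[gL_1gR_1]}+b_3(u)\overline{[gL_1R_1g]}+b_4(u)\overline{[L_1gR_1g]}\\&+b_5(u)\overline{[gL_1]}+b_6(u)\overline{[L_1g]}+b_7(u)\overline{[R_1g]}+b_8(u)\overline{[gR_1]}.\end{aligned}$$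 The top boundary Yang–Baxter equation (BYBE) at $(u,v)$ is the identity in $\mathrm{dGh}^1_2$ $$X(u-v)\,K(u)\,X(u+v)\,K(v)=K(v)\,X(u+v)\,K(u)\,X(u-v).$$ Put $A_1=\alpha_1^2+\alpha_2^2-2\alpha_3^2$, $A_2=\alpha_1\alpha_2-\alpha_3^2$, $P(\theta)=P(\sigma,\tau;\theta)=2\sigma\tau\cos\theta+(\sigma^2-\tau^2)\sin\theta$ and $M=\mu\nu(\alpha_1+\alpha_2)+(\mu^2+\nu^2)\alpha_3$. Consider the following five families; in each of them $b:\mathbb C\to\mathbb C$ is an arbitrary function. * **Solution I** ($\mu,\nu\in\mathbb C$): $a_1=\frac{-b(u)}{2\sin2u\,\sin2\phi}\big(\sin(u-\tfrac\phi2)(\cos2(u-\phi)-\cos\phi)M+4\cos\phi\sin(u-\tfrac{3\phi}2)\big)$, $a_2=\frac{b(u)}{2\sin2u\,\sin2\phi}\big(\sin(u+\tfrac\phi2)(\cos2(u-\phi)-\cos\phi)M+4\cos\phi\sin(u+\tfrac{3\phi}2)\big)$, $b_1=b_3=\mu\nu\, b(u)\sin(u-\tfrac\phi2)$, $b_2=\nu^2b(u)\sin(u-\tfrac\phi2)$,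 $b_4=\mu^2b(u)\sin(u-\tfrac\phi2)$, $b_5=b_8=\nu\, b(u)$, $b_6=b_7=\mu\, b(u)$. * **Solution II** ($\mu,\nu\in\mathbb C$): $a_1=\frac{-b(u)}{2\sin2u\,\sin2\phi}\big(\cos(u-\tfrac\phi2)(\cos2(u-\phi)+\cos\phi)M-4\cos\phi\cos(u-\tfrac{3\phi}2)\big)$, $a_2=\frac{-b(u)}{2\sin2u\,\sin2\phi}\big(\cos(u+\tfrac\phi2)(\cos2(u-\phi)+\cos\phi)M-4\cos\phi\cos(u+\tfrac{3\phi}2)\big)$, $b_1=b_3=\mu\nu\, b(u)\cos(u-\tfrac\phi2)$, $b_2=\nu^2b(u)\cos(u-\tfrac\phi2)$, $b_4=\mu^2b(u)\cos(u-\tfrac\phi2)$, $b_5=-b_8=\nu\, b(u)$, $b_6=-b_7=\mu\, b(u)$. * **Solution III** ($\sigma,\tau\in\mathbb C$ with $A_1P(\phi)+A_2P(-3\phi)=0$): $a_1=\frac{b(u)}{\sin2u}A_1(\sigma\cos u+\tau\sin u)(\sigma\cos(u-\phi)+\tau\sin(u-\phi))$, $a_2=\frac{b(u)}{\sin2u}A_1(\sigma\cos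 u-\tau\sin u)(\sigma\cos(u-\phi)+\tau\sin(u-\phi))$, $b_1=\alpha_1b(u)P(-3\phi)$, $b_2=b_4=-\alpha_3b(u)P(-3\phi)$, $b_3=\alpha_2b(u)P(-3\phi)$, $b_5=b_6=b_7=b_8=0$. * **Solution IV** ($\mu,\nu,\sigma,\tau\in\mathbb C$): $a_1=\frac{b(u)}{\sin2u}(\alpha_1-\alpha_2)M(\sigma\cos u+\tau\sin u)(\sigma\cos(u-\phi)+\tau\sin(u-\phi))$, $a_2=\frac{b(u)}{\sin2u}(\alpha_1-\alpha_2)M(\sigma\cos u-\tau\sin u)(\sigma\cos(u-\phi)+\tau\sin(u-\phi))$, $b_1=\mu\, b(u)x$, $b_2=\nu\, b(u)x$, $b_3=-\nu\, b(u)y$, $b_4=-\mu\, b(u)y$, $b_5=b_6=b_7=b_8=0$, where $x=(\nu\alpha_2+\mu\alpha_3)P(\phi)+(\nu\alpha_1+\mu\alpha_3)P(-3\phi)$ and $y=(\mu\alpha_1+\nu\alpha_3)P(\phi)+(\mu\alpha_2+\nu\alpha_3)P(-3\phi)$. * **Solution V** ($c_2,c_3\in\mathbb C$, and $\sigma,\tau\in\mathbb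 C$ with $A_1P(\phi)P(-3\phi)+A_2(P(\phi)^2+P(-3\phi)^2)=0$): $a_1=\frac{b(u)}{4\sin2u\cos^22\phi}(\alpha_1-\alpha_2)(\sigma\cos u+\tau\sin u)(\sigma\cos(u-\phi)+\tau\sin(u-\phi))\,z$, $a_2=\frac{b(u)}{4\sin2u\cos^22\phi}(\alpha_1-\alpha_2)(\sigma\cos u-\tau\sin u)(\sigma\cos(u-\phi)+\tau\sin(u-\phi))\,z$, with $z=(c_2\alpha_1+c_3\alpha_3)P(-3\phi)+(c_2\alpha_2+c_3\alpha_3)P(\phi)$, $b_1=\frac{c_2b(u)}{2\cos2\phi}P(-\phi)(\alpha_1P(-3\phi)+\alpha_2P(\phi))$, $b_2=-c_2\alpha_3b(u)P(-\phi)^2$, $b_3=-c_3\alpha_3b(u)P(-\phi)^2$, $b_4=\frac{c_3b(u)}{2\cos2\phi}P(-\phi)(\alpha_1P(-3\phi)+\alpha_2P(\phi))$, $b_5=b_6=b_7=b_8=0$. **Theorem 2.** Suppose that $\sin2\phi\ne0$ and $\cos2\phi\ne0$. (1) Every member of the families I–V satisfies the BYBE at all $u,v\in\mathbb C$ with $\sin2u\neq0$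 and $\sin2v\ne0$. (2) Suppose moreover that $\phi$ and the $\alpha_i$ are generic in the sense that $\sin3\phi\neq0$, $\alpha_1,\alpha_2,\alpha_3\ne0$, $\alpha_1\neq\alpha_2$, $A_1\ne0$ and $A_2\neq0$. Then there are no other solutions. More precisely, let $a_1,a_2,b_1,\dots,b_8:\mathbb C\to\mathbb C$ be arbitrary functions such that, for all $u$ off a set without accumulation points in $\mathbb C$, the BYBE holds for all $v$ off a set (possibly depending on $u$) without accumulation points. Then some member of one of the families I–V has the same ten coefficients at all $u$ off a set without accumulation points. -/

import Mathlib

namespace DiluteGhost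

/-! ## Dilute one-boundary ghost diagrams

A diagram on `n` strands is drawn in a rectangle with `n` nodes on the left and `n` nodes on the
right side, numbered downwards, and with a boundary line along the top. Every node carries at most
one string; strings do not cross, and join two nodes or a node and the top boundary. Ghosts sit on
the top boundary; in each domain of the top boundary they are counted modulo two. The total number
of ghosts and string ends on the boundary is even. -/

/-- `(false, i)` is the left node and `(true, i)` the right node at height `i`
(`i = 0` is the node closest to the boundary). -/
abbrev Node (n : ℕ) : Type := Bool × Fin n

/-- The `i`-th left node. -/
abbrev left {n : ℕ} (i : Fin n) : Node n := (false, i)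

/-- The `i`-th right node. -/
abbrev right {n : ℕ} (i : Fin n) : Node n := (true, i)

/-- The place of a node when the nodes are read along the sides of the rectangle from the left end
of the top boundary, down the left side and up the right side, to the right end of the boundary. -/
def Node.pos {n : ℕ} (p : Node n) : ℕ := if p.1 then 2 * n - 1 - p.2 else p.2

/-- What can sit on the top boundary: a ghost, or the end of the string that starts at a node. -/
inductive Item (n : ℕ) : Type where
  | ghost : Item n
  | str : Node n → Item n
  deriving DecidableEq

/-- The node of a string end on the boundary. -/
def Item.node? {n : ℕ} : Item n → Option (Node n)
  | .ghost => none
  | .str p => some p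

/-- The data of a diagram: `link p` is the other end of the string at `p` if that string joins `p`
to a node, and `word` is what is met along the top boundary from left to right. A node that is
neither linked nor listed in `word` is empty. -/
structure RawDiagram (n : ℕ) : Type where
  link : Node n → Option (Node n)
  word : List (Item n)
  deriving DecidableEq

/-- The conditions for such data to describe a diagram. -/
structure RawDiagram.Valid {n : ℕ} (d : RawDiagram n) : Prop where
  symm : ∀ p q, d.link p = some q → q ≠ p ∧ d.link q = some p
  one_string : ∀ p q, d.link p = some q → Item.str p ∉ d.word
  noncrossing : ∀ p q, d.link p = some q → ∀ r s, d.link r = some s →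
    p.pos < r.pos → r.pos < q.pos → p.pos < s.pos ∧ s.pos < q.pos
  noncrossing_top : ∀ p q, d.link p = some q → ∀ r, Item.str r ∈ d.word →
    ¬ (p.pos < r.pos ∧ r.pos < q.pos)
  sorted : (d.word.filterMap Item.node?).Pairwise (fun p q => p.pos < q.pos)
  ghosts : d.word.IsChain (fun s t => ¬ (s = Item.ghost ∧ t = Item.ghost))
  even : d.word.length % 2 = 0

set_option synthInstance.maxHeartbeats 200000 in
set_option synthInstance.maxSize 1024 in
instance {n : ℕ} (d : RawDiagram n) : Decidable d.Valid :=
  decidable_of_iff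
    ((∀ p q, d.link p = some q → q ≠ p ∧ d.link q = some p) ∧
     (∀ p q, d.link p = some q → Item.str p ∉ d.word) ∧
     (∀ p q, d.link p = some q → ∀ r s, d.link r = some s →
        p.pos < r.pos → r.pos < q.pos → p.pos < s.pos ∧ s.pos < q.pos) ∧
     (∀ p q, d.link p = some q → ∀ r, Item.str r ∈ d.word →
        ¬ (p.pos < r.pos ∧ r.pos < q.pos)) ∧
     (d.word.filterMap Item.node?).Pairwise (fun p q => p.pos < q.pos) ∧
     d.word.IsChain (fun s t => ¬ (s = Item.ghost ∧ t = Item.ghost)) ∧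
     d.word.length % 2 = 0)
    ⟨fun ⟨h1, h2, h3, h4, h5, h6, h7⟩ => ⟨h1, h2, h3, h4, h5, h6, h7⟩,
     fun ⟨h1, h2, h3, h4, h5, h6, h7⟩ => ⟨h1, h2, h3, h4, h5, h6, h7⟩⟩

/-- The basis diagrams of the dilute one-boundary ghost algebra on `n` strands. -/
abbrev Diagram (n : ℕ) : Type := {d : RawDiagram n // d.Valid}

/-! ## Concatenation

`x` is drawn to the left of `y`; `false` names the diagram `x` and `true` names `y`. The `i`-th
right node of `x` is glued to the `i`-th left node of `y`. -/

/-- Where a string of the concatenation ends: at an empty node, on the top boundary (as the string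
end at node `p` of the diagram named `d`), at an outer node, or nowhere (a closed loop). -/
inductive End (n : ℕ) : Type where
  | empty : End n
  | top (d : Bool) (p : Node n) : End n
  | outer (p : Node n) : End n
  | loop : End n
  deriving DecidableEq

/-- Follow the string that enters the diagram named `d` at the node `p`. A string that is not a
closed loop passes each of the `n` glued nodes at most once, so `n + 1` steps lead to its end. -/
def trace {n : ℕ} (x y : RawDiagram n) : ℕ → Bool → Node n → End n
  | 0, _, _ => .loop
  | k + 1, d, p =>
    if Item.str p ∈ (if d then y else x).word then .top d p
    else match (if d then y else x).link p with
      | none => .empty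
      | some q => if q.1 = d then .outer q else trace x y k (!d) (d, q.2)

/-- The heights of the glued nodes that are passed on the way. -/
def passed {n : ℕ} (x y : RawDiagram n) : ℕ → Bool → Node n → List (Fin n)
  | 0, _, _ => []
  | k + 1, d, p =>
    if Item.str p ∈ (if d then y else x).word then []
    else match (if d then y else x).link p with
      | none => []
      | some q => if q.1 = d then [] else q.2 :: passed x y k (!d) (d, q.2)

/-- The number of closed loops: each is counted at its topmost glued node. -/
def loops {n : ℕ} (x y : RawDiagram n) : ℕ :=
  ((List.finRange n).filter fun i =>
    trace x y (n + 1) true (left i) = .loop ∧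
      ∀ j ∈ passed x y (n + 1) true (left i), i ≤ j).length

/-- The node is empty. -/
def RawDiagram.IsEmptyAt {n : ℕ} (d : RawDiagram n) (p : Node n) : Prop :=
  d.link p = none ∧ Item.str p ∉ d.word

instance {n : ℕ} (d : RawDiagram n) (p : Node n) : Decidable (d.IsEmptyAt p) :=
  inferInstanceAs (Decidable (_ ∧ _))

/-- Nowhere is a string glued to an empty node. -/
def Compatible {n : ℕ} (x y : RawDiagram n) : Prop :=
  ∀ i : Fin n, x.IsEmptyAt (right i) ↔ y.IsEmptyAt (left i)

instance {n : ℕ} (x y : RawDiagram n) : Decidable (Compatible x y) :=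
  inferInstanceAs (Decidable (∀ _, _))

/-- The boundary of the concatenation before any simplification, from left to right: each ghost or
string end, with the diagram it comes from. -/
def boundary {n : ℕ} (x y : RawDiagram n) : List (Bool × Item n) :=
  x.word.map (Prod.mk false) ++ y.word.map (Prod.mk true)

/-- Where the string ends that meets the boundary as the end at node `p` of the diagram `d`. -/
def otherEnd {n : ℕ} (x y : RawDiagram n) (d : Bool) (p : Node n) : End n :=
  if p.1 = d then .outer p else trace x y (n + 1) (!d) (d, p.2)

/-- What remains of an item on the boundary of the concatenation: a string from the boundary to the
boundary leaves a ghost at each of its two ends. -/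
def resolve {n : ℕ} (x y : RawDiagram n) : Bool × Item n → Item n
  | (_, .ghost) => .ghost
  | (d, .str p) => match otherEnd x y d p with
    | .outer q => .str q
    | _ => .ghost

/-- The strings from the boundary to the boundary, as pairs of positions of their left and right
ends; the items on the boundary are numbered from `1`. -/
def arcs {n : ℕ} (x y : RawDiagram n) : List (ℕ × ℕ) :=
  (boundary x y).zipIdx.filterMap fun t => match t with
    | ((_, .ghost), _) => none
    | ((d, .str p), k) => match otherEnd x y d p with
      | .top e q =>
        if k < (boundary x y).idxOf (e, .str q) then
          some (k + 1, (boundary x y).idxOf (e, .str q) + 1)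
        else none
      | _ => none

/-- Ghosts in the same domain cancel in pairs. -/
def cancelGhosts {n : ℕ} : List (Item n) → List (Item n)
  | [] => []
  | .str p :: l => .str p :: cancelGhosts l
  | .ghost :: l => match cancelGhosts l with
    | .ghost :: l' => l'
    | l' => .ghost :: l'

/-- The diagram that remains after loops and boundary arcs are removed. -/
def concat {n : ℕ} (x y : RawDiagram n) : RawDiagram n where
  link p := match trace x y (n + 1) p.1 p with
    | .outer q => some q
    | _ => none
  word := cancelGhosts ((boundary x y).map (resolve x y))

/-! ## The algebra -/

/-- The dilute one-boundary ghost algebra over `ℂ`: formal linear combinations of diagrams. -/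
def DGh (n : ℕ) (_β _α₁ _α₂ _α₃ : ℂ) : Type := Diagram n →₀ ℂ

section Algebra

variable {n : ℕ} {β α₁ α₂ α₃ : ℂ}

noncomputable instance : AddCommGroup (DGh n β α₁ α₂ α₃) :=
  inferInstanceAs (AddCommGroup (Diagram n →₀ ℂ))

noncomputable instance : Module ℂ (DGh n β α₁ α₂ α₃) :=
  inferInstanceAs (Module ℂ (Diagram n →₀ ℂ))

/-- A diagram as an element of the algebra. -/
noncomputable def diag (d : Diagram n) : DGh n β α₁ α₂ α₃ := Finsupp.single d (1 : ℂ)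

/-- The factor for a string from the boundary to the boundary: `α₁` if its left end is at an odd and
its right end at an even position, `α₂` if left is even and right is odd, `α₃` if both positions
have the same parity. -/
def arcFactor (α₁ α₂ α₃ : ℂ) (a : ℕ × ℕ) : ℂ :=
  if a.1 % 2 = a.2 % 2 then α₃ else if a.1 % 2 = 1 then α₁ else α₂

/-- The product of two diagrams: zero if a string is glued to an empty node; otherwise the
concatenation, with a factor `β` for each closed loop and a factor `αᵢ` for each string from the
boundary to the boundary. (The concatenation is always a diagram; the inner `else` is not used.) -/
noncomputable def mulDiag (x y : Diagram n) : DGh n β α₁ α₂ α₃ :=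
  if Compatible x.1 y.1 then
    if h : (concat x.1 y.1).Valid then
      (β ^ loops x.1 y.1 * ((arcs x.1 y.1).map (arcFactor α₁ α₂ α₃)).prod) •
        diag ⟨concat x.1 y.1, h⟩
    else 0
  else 0

/-- The product of the algebra is the bilinear extension of the product of diagrams. -/
noncomputable instance : Mul (DGh n β α₁ α₂ α₃) where
  mul f g := Finsupp.sum f fun x a => Finsupp.sum g fun y b => (a * b) • mulDiag x y

end Algebra

/-! ## Face operators and the boundary Yang-Baxter equation on two strands -/

/-- A diagram on two strands from a list of node-to-node strings and a boundary word. -/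
def ofArcs (l : List (Node 2 × Node 2)) (w : List (Item 2)) : RawDiagram 2 where
  link p := l.findSome? fun a =>
    if a.1 = p then some a.2 else if a.2 = p then some a.1 else none
  word := w

local notation "L₁" => left (0 : Fin 2)
local notation "L₂" => left (1 : Fin 2)
local notation "R₁" => right (0 : Fin 2)
local notation "R₂" => right (1 : Fin 2)

section Faces

variable {β α₁ α₂ α₃ : ℂ}

/-- The dilute bulk face operator with crossing parameter `3φ` and spectral parameter `u`. -/
noncomputable def bulkFace (φ u : ℂ) : DGh 2 β α₁ α₂ α₃ :=
  (Complex.sin (2 * φ) * Complex.sin (3 * φ) + Complex.sin u * Complex.sin (3 * φ - u)) •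
      diag ⟨ofArcs [] [], by decide⟩
  + (Complex.sin (2 * φ) * Complex.sin (3 * φ - u)) •
      (diag ⟨ofArcs [(L₁, R₁)] [], by decide⟩ + diag ⟨ofArcs [(L₂, R₂)] [], by decide⟩)
  + (Complex.sin (2 * φ) * Complex.sin u) •
      (diag ⟨ofArcs [(L₁, L₂)] [], by decide⟩ + diag ⟨ofArcs [(R₁, R₂)] [], by decide⟩)
  + (Complex.sin u * Complex.sin (3 * φ - u)) •
      (diag ⟨ofArcs [(L₂, R₁)] [], by decide⟩ + diag ⟨ofArcs [(L₁, R₂)] [], by decide⟩)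
  + (Complex.sin (2 * φ - u) * Complex.sin (3 * φ - u)) •
      diag ⟨ofArcs [(L₁, R₁), (L₂, R₂)] [], by decide⟩
  + (-(Complex.sin u * Complex.sin (φ - u))) •
      diag ⟨ofArcs [(L₁, L₂), (R₁, R₂)] [], by decide⟩

/-- The ten coefficients of a boundary face operator. -/
@[ext] structure BoundaryCoeffs : Type where
  (a₁ a₂ b₁ b₂ b₃ b₄ b₅ b₆ b₇ b₈ : ℂ)

/-- A diagram drawn on the upper strand, with a dashed string on the lower strand: the sum of the
diagram with and the diagram without a horizontal string there. -/
noncomputable def dashed (l : List (Node 2 × Node 2)) (w : List (Item 2))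
    (h₁ : (ofArcs ((L₂, R₂) :: l) w).Valid) (h₀ : (ofArcs l w).Valid) : DGh 2 β α₁ α₂ α₃ :=
  diag ⟨_, h₁⟩ + diag ⟨_, h₀⟩

/-- The boundary face operator, acting on the upper strand, with a dashed string below. -/
noncomputable def boundaryFace (k : BoundaryCoeffs) : DGh 2 β α₁ α₂ α₃ :=
  k.a₁ • dashed [(L₁, R₁)] [] (by decide) (by decide)
  + k.a₂ • dashed [] [] (by decide) (by decide)
  + k.b₁ • dashed [] [.str L₁, .str R₁] (by decide) (by decide)
  + k.b₂ • dashed [] [.ghost, .str L₁, .ghost, .str R₁] (by decide) (by decide)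
  + k.b₃ • dashed [] [.ghost, .str L₁, .str R₁, .ghost] (by decide) (by decide)
  + k.b₄ • dashed [] [.str L₁, .ghost, .str R₁, .ghost] (by decide) (by decide)
  + k.b₅ • dashed [] [.ghost, .str L₁] (by decide) (by decide)
  + k.b₆ • dashed [] [.str L₁, .ghost] (by decide) (by decide)
  + k.b₇ • dashed [] [.str R₁, .ghost] (by decide) (by decide)
  + k.b₈ • dashed [] [.ghost, .str R₁] (by decide) (by decide)

end Faces

/-- The boundary Yang-Baxter equation at the spectral parameters `u`, `v`, in the dilute
one-boundary ghost algebra on two strands with `β = -2 cos 4φ`, for boundary face operators with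
coefficient functions `K`. (The algebra is associative; the products are bracketed to the left.) -/
def BYBE (φ α₁ α₂ α₃ : ℂ) (K : ℂ → BoundaryCoeffs) (u v : ℂ) : Prop :=
  (bulkFace φ (u - v) * boundaryFace (K u) * bulkFace φ (u + v) * boundaryFace (K v) :
      DGh 2 (-2 * Complex.cos (4 * φ)) α₁ α₂ α₃)
    = boundaryFace (K v) * bulkFace φ (u + v) * boundaryFace (K u) * bulkFace φ (u - v)

/-! ## The five families of solutions -/

section Solutions

open Complex

/-- `P(σ, τ; θ)`. -/
noncomputable def P (σ τ θ : ℂ) : ℂ := 2 * σ * τ * cos θ + (σ ^ 2 - τ ^ 2) * sin θ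

/-- `A₁`. -/
def A₁ (α₁ α₂ α₃ : ℂ) : ℂ := α₁ ^ 2 + α₂ ^ 2 - 2 * α₃ ^ 2

/-- `A₂`. -/
def A₂ (α₁ α₂ α₃ : ℂ) : ℂ := α₁ * α₂ - α₃ ^ 2

/-- Solution I. -/
noncomputable def solutionI (φ α₁ α₂ α₃ μ ν : ℂ) (b : ℂ → ℂ) (u : ℂ) : BoundaryCoeffs where
  a₁ := -b u / (2 * sin (2 * u) * sin (2 * φ)) *
    (sin (u - φ / 2) * (cos (2 * (u - φ)) - cos φ) * (μ * ν * (α₁ + α₂) + (μ ^ 2 + ν ^ 2) * α₃)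
      + 4 * cos φ * sin (u - 3 * φ / 2))
  a₂ := b u / (2 * sin (2 * u) * sin (2 * φ)) *
    (sin (u + φ / 2) * (cos (2 * (u - φ)) - cos φ) * (μ * ν * (α₁ + α₂) + (μ ^ 2 + ν ^ 2) * α₃)
      + 4 * cos φ * sin (u + 3 * φ / 2))
  b₁ := μ * ν * b u * sin (u - φ / 2)
  b₂ := ν ^ 2 * b u * sin (u - φ / 2)
  b₃ := μ * ν * b u * sin (u - φ / 2)
  b₄ := μ ^ 2 * b u * sin (u - φ / 2)
  b₅ := ν * b u
  b₆ := μ * b u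
  b₇ := μ * b u
  b₈ := ν * b u

/-- Solution II. -/
noncomputable def solutionII (φ α₁ α₂ α₃ μ ν : ℂ) (b : ℂ → ℂ) (u : ℂ) : BoundaryCoeffs where
  a₁ := -b u / (2 * sin (2 * u) * sin (2 * φ)) *
    (cos (u - φ / 2) * (cos (2 * (u - φ)) + cos φ) * (μ * ν * (α₁ + α₂) + (μ ^ 2 + ν ^ 2) * α₃)
      - 4 * cos φ * cos (u - 3 * φ / 2))
  a₂ := -b u / (2 * sin (2 * u) * sin (2 * φ)) *
    (cos (u + φ / 2) * (cos (2 * (u - φ)) + cos φ) * (μ * ν * (α₁ + α₂) + (μ ^ 2 + ν ^ 2) * α₃)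
      - 4 * cos φ * cos (u + 3 * φ / 2))
  b₁ := μ * ν * b u * cos (u - φ / 2)
  b₂ := ν ^ 2 * b u * cos (u - φ / 2)
  b₃ := μ * ν * b u * cos (u - φ / 2)
  b₄ := μ ^ 2 * b u * cos (u - φ / 2)
  b₅ := ν * b u
  b₆ := μ * b u
  b₇ := -(μ * b u)
  b₈ := -(ν * b u)

/-- Solution III. -/
noncomputable def solutionIII (φ α₁ α₂ α₃ σ τ : ℂ) (b : ℂ → ℂ) (u : ℂ) : BoundaryCoeffs where
  a₁ := b u / sin (2 * u) * A₁ α₁ α₂ α₃ * (σ * cos u + τ * sin u) *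
    (σ * cos (u - φ) + τ * sin (u - φ))
  a₂ := b u / sin (2 * u) * A₁ α₁ α₂ α₃ * (σ * cos u - τ * sin u) *
    (σ * cos (u - φ) + τ * sin (u - φ))
  b₁ := α₁ * b u * P σ τ (-3 * φ)
  b₂ := -α₃ * b u * P σ τ (-3 * φ)
  b₃ := α₂ * b u * P σ τ (-3 * φ)
  b₄ := -α₃ * b u * P σ τ (-3 * φ)
  b₅ := 0
  b₆ := 0
  b₇ := 0
  b₈ := 0

/-- Solution IV. -/
noncomputable def solutionIV (φ α₁ α₂ α₃ μ ν σ τ : ℂ) (b : ℂ → ℂ) (u : ℂ) : BoundaryCoeffs where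
  a₁ := b u / sin (2 * u) * (α₁ - α₂) * (μ * ν * (α₁ + α₂) + (μ ^ 2 + ν ^ 2) * α₃) *
    (σ * cos u + τ * sin u) * (σ * cos (u - φ) + τ * sin (u - φ))
  a₂ := b u / sin (2 * u) * (α₁ - α₂) * (μ * ν * (α₁ + α₂) + (μ ^ 2 + ν ^ 2) * α₃) *
    (σ * cos u - τ * sin u) * (σ * cos (u - φ) + τ * sin (u - φ))
  b₁ := μ * b u * ((ν * α₂ + μ * α₃) * P σ τ φ + (ν * α₁ + μ * α₃) * P σ τ (-3 * φ))
  b₂ := ν * b u * ((ν * α₂ + μ * α₃) * P σ τ φ + (ν * α₁ + μ * α₃) * P σ τ (-3 * φ))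
  b₃ := -ν * b u * ((μ * α₁ + ν * α₃) * P σ τ φ + (μ * α₂ + ν * α₃) * P σ τ (-3 * φ))
  b₄ := -μ * b u * ((μ * α₁ + ν * α₃) * P σ τ φ + (μ * α₂ + ν * α₃) * P σ τ (-3 * φ))
  b₅ := 0
  b₆ := 0
  b₇ := 0
  b₈ := 0

/-- Solution V. -/
noncomputable def solutionV (φ α₁ α₂ α₃ c₂ c₃ σ τ : ℂ) (b : ℂ → ℂ) (u : ℂ) : BoundaryCoeffs where
  a₁ := b u / (4 * sin (2 * u) * cos (2 * φ) ^ 2) * (α₁ - α₂) *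
    (σ * cos u + τ * sin u) * (σ * cos (u - φ) + τ * sin (u - φ)) *
    ((c₂ * α₁ + c₃ * α₃) * P σ τ (-3 * φ) + (c₂ * α₂ + c₃ * α₃) * P σ τ φ)
  a₂ := b u / (4 * sin (2 * u) * cos (2 * φ) ^ 2) * (α₁ - α₂) *
    (σ * cos u - τ * sin u) * (σ * cos (u - φ) + τ * sin (u - φ)) *
    ((c₂ * α₁ + c₃ * α₃) * P σ τ (-3 * φ) + (c₂ * α₂ + c₃ * α₃) * P σ τ φ)
  b₁ := c₂ * b u / (2 * cos (2 * φ)) * P σ τ (-φ) * (α₁ * P σ τ (-3 * φ) + α₂ * P σ τ φ)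
  b₂ := -c₂ * α₃ * b u * P σ τ (-φ) ^ 2
  b₃ := -c₃ * α₃ * b u * P σ τ (-φ) ^ 2
  b₄ := c₃ * b u / (2 * cos (2 * φ)) * P σ τ (-φ) * (α₁ * P σ τ (-3 * φ) + α₂ * P σ τ φ)
  b₅ := 0
  b₆ := 0
  b₇ := 0
  b₈ := 0

/-- `K` belongs to one of the five families. -/
def IsSolution (φ α₁ α₂ α₃ : ℂ) (K : ℂ → BoundaryCoeffs) : Prop :=
  (∃ (μ ν : ℂ) (b : ℂ → ℂ), K = solutionI φ α₁ α₂ α₃ μ ν b) ∨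
  (∃ (μ ν : ℂ) (b : ℂ → ℂ), K = solutionII φ α₁ α₂ α₃ μ ν b) ∨
  (∃ (σ τ : ℂ) (b : ℂ → ℂ),
    A₁ α₁ α₂ α₃ * P σ τ φ + A₂ α₁ α₂ α₃ * P σ τ (-3 * φ) = 0 ∧
    K = solutionIII φ α₁ α₂ α₃ σ τ b) ∨
  (∃ (μ ν σ τ : ℂ) (b : ℂ → ℂ), K = solutionIV φ α₁ α₂ α₃ μ ν σ τ b) ∨
  (∃ (c₂ c₃ σ τ : ℂ) (b : ℂ → ℂ),
    A₁ α₁ α₂ α₃ * P σ τ φ * P σ τ (-3 * φ)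
      + A₂ α₁ α₂ α₃ * (P σ τ φ ^ 2 + P σ τ (-3 * φ) ^ 2) = 0 ∧
    K = solutionV φ α₁ α₂ α₃ c₂ c₃ σ τ b)

end Solutions

/-- Genericity of the parameters that the classification needs, in addition to
`sin 2φ ≠ 0` and `cos 2φ ≠ 0`. -/
structure Generic (φ α₁ α₂ α₃ : ℂ) : Prop where
  sin_three : Complex.sin (3 * φ) ≠ 0
  α₁_ne : α₁ ≠ 0
  α₂_ne : α₂ ≠ 0
  α₃_ne : α₃ ≠ 0
  ne : α₁ ≠ α₂
  A₁_ne : A₁ α₁ α₂ α₃ ≠ 0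
  A₂_ne : A₂ α₁ α₂ α₃ ≠ 0

end DiluteGhost

/-! The equation lives in an algebra with 117 basis diagrams, so it is a finite system of equations
that are bilinear in the coefficients of `K u` and `K v`. A verified symbolic computation produces
this system. Two symmetries cut it down to 34 equations (`Quarter`, `bybe_iff`): a ghost added at
both ends of the boundary shifts all positions by one and exchanges `α₁` and `α₂`; a left-right
reflection exchanges the two sides of the equation.

Existence. In solution I the coefficients `b₁, …, b₄` form the outer square of `(μ, ν)`, and the
weights enter only through `M`, so the system reduces to thirteen scalar relations (`RankOnePair`).
Solution II is solution I shifted by `π / 2`, up to signs (`twist`). In III, IV and V the `bᵢ` with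
`i ≤ 4` are a function times a constant matrix `N` with `N C N = λ N`, where `C` is the matrix of
weights, and five scalar relations remain (`EvenPair`). In exponentials all scalar relations are
identities of rational functions.

Uniqueness. The components with four strings to the boundary show that `(b₁, …, b₄)` at two
parameters are proportional, and further components relate `b₅, …, b₈` quadratically. There are
three cases.

If `b₅, …, b₈` do not vanish off a discrete set, the relations give `(b₇, b₈) = ± (b₆, b₅)`, and a
twist makes the sign positive. All `bᵢ` then agree with those of a solution I. The differences of
`a₁` and `a₂` satisfy homogeneous linear relations that force them to vanish (`difference_eq_zero`).

If all `bᵢ` vanish off a discrete set, the ratio of `a₁` and `a₂` is fixed by two constants `σ, τ`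
with `P(-3φ) = 0`. Since `P(-3φ)` is a product of two linear forms, this gives I or II with `μ = ν =
0`.

Otherwise `(b₁, …, b₄)` is a function times a constant matrix `N`. The functional equations then
determine `a₁` and `a₂` by `σ, τ`, with `λ = -P(φ)` and with `P(-3φ)` the weight of the closed-up
boundary face (`exists_even_solution`). It remains to solve `N C N = λ N`: an invertible `N` is a
multiple of `C⁻¹` (III); for `N` of rank one with row `(μ, ν)`, a linear system with determinant
proportional to `M` gives IV if `M ≠ 0`, and the degenerate case `M = 0` is V. -/

namespace DiluteGhost

/-! ## Symbolic computation in the algebra on two strands -/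

/-- The indeterminates of the components of the boundary Yang-Baxter equation: the parameters of the
algebra (`par 0 = β`, `par i = αᵢ`), the coefficients of the two bulk faces and those of the two
boundary faces. -/
inductive Var : Type where
  | par (i : ℕ) | x (i : ℕ) | y (i : ℕ) | k (i : ℕ) | l (i : ℕ)

/-- An injective numbering of the indeterminates. -/
def Var.code : Var → ℕ
  | .par i => 5 * i
  | .x i => 5 * i + 1
  | .y i => 5 * i + 2
  | .k i => 5 * i + 3
  | .l i => 5 * i + 4

theorem Var.code_injective : Function.Injective Var.code := by
  intro a b h
  cases a <;> cases b <;> simp only [Var.code] at h <;> first | omega | (congr 1; omega)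

abbrev Mono : Type := List Var

abbrev Poly : Type := List (ℤ × Mono)

def Mono.eval (ρ : Var → ℂ) (m : Mono) : ℂ := (m.map ρ).prod

def Poly.eval (ρ : Var → ℂ) (f : Poly) : ℂ := (f.map fun t => (t.1 : ℂ) * Mono.eval ρ t.2).sum

/-- Indeterminates are compared through their codes, so that evaluation only compares natural
numbers. -/
def Mono.beq : Mono → Mono → Bool
  | [], [] => true
  | a :: m, b :: m' => a.code == b.code && Mono.beq m m'
  | _, _ => false

theorem Mono.eq_of_beq : ∀ {m m' : Mono}, Mono.beq m m' = true → m = m'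
  | [], [], _ => rfl
  | a :: m, b :: m', h => by
    simp only [Mono.beq, Bool.and_eq_true, beq_iff_eq] at h
    rw [Var.code_injective h.1, Mono.eq_of_beq h.2]

def Mono.insert (a : Var) : Mono → Mono
  | [] => [a]
  | b :: m => if a.code ≤ b.code then a :: b :: m else b :: Mono.insert a m

def Mono.sort : Mono → Mono
  | [] => []
  | a :: m => Mono.insert a (Mono.sort m)

theorem Mono.eval_insert (ρ : Var → ℂ) (a : Var) (m : Mono) :
    Mono.eval ρ (Mono.insert a m) = ρ a * Mono.eval ρ m := by
  induction m with
  | nil => simp [Mono.insert, Mono.eval]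
  | cons b m ih =>
    simp only [Mono.insert]
    split_ifs
    · simp [Mono.eval]
    · simp only [Mono.eval, List.map_cons, List.prod_cons] at ih ⊢
      rw [ih]; ring

theorem Mono.eval_sort (ρ : Var → ℂ) (m : Mono) : Mono.eval ρ (Mono.sort m) = Mono.eval ρ m := by
  induction m with
  | nil => rfl
  | cons b m ih => rw [Mono.sort, Mono.eval_insert, ih]; simp [Mono.eval]

/-- A number that depends only on the multiset of indeterminates. -/
def Mono.hash (m : Mono) : ℕ := m.foldr (fun a k => 8 ^ a.code + k) 0

/-- Forces the evaluation of a number. -/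
def force {α : Type} (f : ℕ → α) (n : ℕ) : α := Nat.rec (f 0) (fun m _ => f (m + 1)) n

/-- In proofs `force` is invisible; its recursor only makes the evaluator compute the numeral once,
before it is substituted. -/
theorem force_eq {α : Type} (f : ℕ → α) (n : ℕ) : force f n = f n := by cases n <;> rfl

/-- Adds a term to a list of terms with pairwise different hashes. -/
def addTerm (k : ℕ) (c : ℤ) (m : Mono) : List (ℕ × ℤ × Mono) → List (ℕ × ℤ × Mono)
  | [] => [(k, c, m)]
  | t :: f => cond (Nat.beq k t.1 && Mono.beq (Mono.sort m) (Mono.sort t.2.2))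
      ((t.1, c + t.2.1, t.2.2) :: f) (t :: addTerm k c m f)

/-- The hash is only a fast filter: terms are merged because their sorted monomials agree, so
collisions of hashes are harmless. -/
theorem eval_addTerm (ρ : Var → ℂ) (k : ℕ) (c : ℤ) (m : Mono) (f : List (ℕ × ℤ × Mono)) :
    Poly.eval ρ ((addTerm k c m f).map Prod.snd)
      = c * Mono.eval ρ m + Poly.eval ρ (f.map Prod.snd) := by
  induction f with
  | nil => simp [addTerm, Poly.eval]
  | cons t f ih =>
    rw [addTerm]
    cases h : (Nat.beq k t.1 && Mono.beq (Mono.sort m) (Mono.sort t.2.2))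
    · simp only [cond_false, Poly.eval, List.map_cons, List.sum_cons] at ih ⊢; rw [ih]; ring
    · have := Mono.eq_of_beq (Bool.and_eq_true_iff.1 h).2
      rw [← Mono.eval_sort ρ m, this, Mono.eval_sort]
      simp only [cond_true, Poly.eval, List.map_cons, List.sum_cons]; push_cast; ring

def Poly.collect : Poly → List (ℕ × ℤ × Mono)
  | [] => []
  | t :: f => force (fun k => addTerm k t.1 t.2 (Poly.collect f)) (Mono.hash t.2)

theorem Poly.eval_collect (ρ : Var → ℂ) (f : Poly) :
    Poly.eval ρ ((Poly.collect f).map Prod.snd) = Poly.eval ρ f := by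
  induction f with
  | nil => rfl
  | cons t f ih => rw [Poly.collect, force_eq, eval_addTerm, ih]; simp [Poly.eval]

def Poly.isZero (f : Poly) : Bool := (Poly.collect f).all fun t => t.2.1 == 0

/-- Soundness of the test is all that is needed; a test that failed wrongly could only make the
final computation fail. -/
theorem Poly.eval_eq_zero {f : Poly} (h : f.isZero = true) (ρ : Var → ℂ) : Poly.eval ρ f = 0 := by
  rw [← Poly.eval_collect]
  refine List.sum_eq_zero fun z hz => ?_
  rw [List.map_map] at hz
  obtain ⟨t, ht, rfl⟩ := List.mem_map.1 hz
  have := (List.all_eq_true.1 h) t ht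
  simp [beq_iff_eq.1 this]

def Poly.smul (c : ℤ) (f : Poly) : Poly := f.map fun t => (c * t.1, t.2)

theorem Poly.eval_smul (ρ : Var → ℂ) (c : ℤ) (f : Poly) :
    Poly.eval ρ (Poly.smul c f) = c * Poly.eval ρ f := by
  induction f with
  | nil => simp [Poly.smul, Poly.eval]
  | cons t f ih =>
    simp only [Poly.smul, Poly.eval, List.map_cons, List.sum_cons] at ih ⊢
    rw [ih]; push_cast; ring

theorem Poly.eval_append (ρ : Var → ℂ) (f g : Poly) :
    Poly.eval ρ (f ++ g) = Poly.eval ρ f + Poly.eval ρ g := by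
  simp [Poly.eval]

def Poly.rename (σ : Var → Var) (f : Poly) : Poly := f.map fun t => (t.1, t.2.map σ)

theorem Poly.eval_rename (ρ : Var → ℂ) (σ : Var → Var) (f : Poly) :
    Poly.eval ρ (Poly.rename σ f) = Poly.eval (ρ ∘ σ) f := by
  simp [Poly.eval, Poly.rename, Mono.eval, Function.comp_def]

/-- The monomial `m` carries the weights of the loops and boundary arcs that arise when two diagrams
are glued. -/
def Poly.mul (m : Mono) (f g : Poly) : Poly :=
  f.flatMap fun s => g.map fun t => (s.1 * t.1, m ++ s.2 ++ t.2)

theorem Poly.eval_mul (ρ : Var → ℂ) (m : Mono) (f g : Poly) :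
    Poly.eval ρ (Poly.mul m f g) = Mono.eval ρ m * Poly.eval ρ f * Poly.eval ρ g := by
  induction f with
  | nil => simp [Poly.mul, Poly.eval]
  | cons s f ih =>
    have : Poly.eval ρ (g.map fun t => (s.1 * t.1, m ++ s.2 ++ t.2))
        = Mono.eval ρ m * (s.1 * Mono.eval ρ s.2) * Poly.eval ρ g := by
      clear ih
      induction g with
      | nil => simp [Poly.eval]
      | cons t g ih =>
        simp only [Poly.eval, Mono.eval, List.map_cons, List.sum_cons, List.map_append,
          List.prod_append] at ih ⊢
        rw [ih]; push_cast; ring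
    rw [Poly.mul] at ih ⊢
    rw [List.flatMap_cons, Poly.eval_append, ih, this]
    simp only [Poly.eval, List.map_cons, List.sum_cons]
    ring

/-! ### The diagrams on two strands -/

/-- All words on the boundary with the given string ends, where `e` tells whether an even number of
items is still to come. -/
def words : List (Node 2) → Bool → List (List (Item 2))
  | [], true => [[]]
  | [], false => [[.ghost]]
  | p :: l, e => (words l (!e)).map (.str p :: ·) ++ (words l e).map (.ghost :: .str p :: ·)

/-- The node-to-node strings of a diagram and the nodes left for strings to the boundary. -/
def linkPatterns : List (List (Node 2 × Node 2) × List (Node 2)) :=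
  [([], [left 0, left 1, right 1, right 0]),
   ([(left 0, right 0)], []),
   ([(left 1, right 1)], [left 0, right 0]),
   ([(left 0, left 1)], [right 1, right 0]),
   ([(right 0, right 1)], [left 0, left 1]),
   ([(left 1, right 0)], [left 0]),
   ([(left 0, right 1)], [right 0]),
   ([(left 0, right 0), (left 1, right 1)], []),
   ([(left 0, left 1), (right 0, right 1)], [])]

/-- The list of all diagrams on two strands. -/
def diagrams : List (RawDiagram 2) :=
  linkPatterns.flatMap fun a => a.2.sublists.flatMap fun s => (words s true).map (ofArcs a.1)

/-- An index out of range gives the empty diagram, so that every index names a valid diagram. -/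
def raw (i : ℕ) : RawDiagram 2 := (diagrams[i]?).getD (ofArcs [] [])

set_option maxRecDepth 100000 in
theorem diagrams_valid : ∀ d ∈ diagrams, d.Valid := by decide +kernel

theorem raw_valid (i : ℕ) : (raw i).Valid := by
  unfold raw
  cases h : diagrams[i]? with
  | none => simp only [Option.getD_none]; decide
  | some d => exact diagrams_valid d (List.mem_of_getElem? h)

def RawDiagram.test (d e : RawDiagram 2) : Bool :=
  decide (d.word = e.word) && decide (d.link (left 0) = e.link (left 0)) &&
    decide (d.link (left 1) = e.link (left 1)) && decide (d.link (right 0) = e.link (right 0)) &&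
    decide (d.link (right 1) = e.link (right 1))

theorem RawDiagram.eq_of_test {d e : RawDiagram 2} (h : d.test e = true) : d = e := by
  simp only [RawDiagram.test, Bool.and_eq_true, decide_eq_true_eq] at h
  obtain ⟨⟨⟨⟨h1, h2⟩, h3⟩, h4⟩, h5⟩ := h
  cases d; cases e
  simp only [RawDiagram.mk.injEq]
  refine ⟨?_, h1⟩
  funext ⟨b, i⟩
  fin_cases i <;> cases b <;> assumption

def nodeKey (p : Node 2) : ℕ := cond p.1 (p.2.val + 3) (p.2.val + 1)

def itemKey : Item 2 → ℕ
  | .ghost => 5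
  | .str p => nodeKey p

def linkKey : Option (Node 2) → ℕ
  | none => 0
  | some p => nodeKey p

/-- A number that determines a diagram. -/
def RawDiagram.key (d : RawDiagram 2) : ℕ :=
  d.word.foldr (fun t k => 8 * k + itemKey t)
    (linkKey (d.link (left 0)) + 8 * linkKey (d.link (left 1)) + 64 * linkKey (d.link (right 0))
      + 512 * linkKey (d.link (right 1)) + 4096)

def keys : List ℕ := diagrams.map RawDiagram.key

/-- The place of a diagram in the list of all diagrams. -/
def index (d : RawDiagram 2) : ℕ :=
  force (fun k => force (fun i => cond ((raw i).test d) i 117) (keys.findIdx fun l => Nat.beq l k))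
    d.key

/-- There are 117 = 81 + 3 · 9 + 2 · 3 + 3 diagrams, since `m` nodes free to reach the boundary
contribute `3 ^ m`. The value 117 of `index` signals a failed lookup. The explicit test guards the
lookup by key, so no injectivity of keys enters. -/
theorem raw_index {d : RawDiagram 2} (h : index d < 117) : raw (index d) = d := by
  rw [index, force_eq, force_eq] at *
  cases ht : (raw (keys.findIdx fun l => Nat.beq l d.key)).test d
  · rw [ht] at h; exact absurd h (by simp)
  · rw [cond_true]; exact RawDiagram.eq_of_test ht

/-- A test for compatibility. -/
def RawDiagram.occupied (d : RawDiagram 2) (p : Node 2) : Bool :=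
  (d.link p).isSome || d.word.any fun t => Nat.beq (itemKey t) (nodeKey p)

theorem nodeKey_injective : Function.Injective nodeKey := by decide

theorem itemKey_eq (t : Item 2) (p : Node 2) : itemKey t = nodeKey p ↔ t = .str p := by
  cases t with
  | ghost => revert p; decide
  | str q => simp [itemKey, nodeKey_injective.eq_iff]

theorem RawDiagram.occupied_iff (d : RawDiagram 2) (p : Node 2) :
    d.occupied p = true ↔ ¬ d.IsEmptyAt p := by
  have h : (d.word.any fun t => Nat.beq (itemKey t) (nodeKey p)) = true ↔ Item.str p ∈ d.word := by
    rw [List.any_eq_true]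
    exact ⟨fun ⟨t, h1, h2⟩ => (itemKey_eq t p).1 (Nat.eq_of_beq_eq_true h2) ▸ h1,
      fun h => ⟨_, h, Nat.beq_refl _⟩⟩
  rw [RawDiagram.occupied, Bool.or_eq_true, h, Option.isSome_iff_ne_none, RawDiagram.IsEmptyAt]
  tauto

def compatible (x y : RawDiagram 2) : Bool :=
  (x.occupied (right 0) == y.occupied (left 0)) && (x.occupied (right 1) == y.occupied (left 1))

theorem compatible_iff (x y : RawDiagram 2) : compatible x y = true ↔ Compatible x y := by
  have h : ∀ i, (x.occupied (right i) == y.occupied (left i)) = true ↔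
      (x.IsEmptyAt (right i) ↔ y.IsEmptyAt (left i)) := by
    intro i
    rw [beq_iff_eq, Bool.eq_iff_iff, RawDiagram.occupied_iff, RawDiagram.occupied_iff]
    tauto
  rw [compatible, Bool.and_eq_true, h, h, Compatible, Fin.forall_fin_two]

/-- The factor in the product of two diagrams. -/
def factor (x y : RawDiagram 2) : Mono :=
  List.replicate (loops x y) (.par 0) ++ (arcs x y).map fun a =>
    if a.1 % 2 = a.2 % 2 then .par 3 else if a.1 % 2 = 1 then .par 1 else .par 2

/-- Linear combinations of diagrams with polynomial coefficients. -/
abbrev Comb : Type := List (Poly × ℕ)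

def Comb.add (p : Poly) (i : ℕ) : Comb → Comb
  | [] => [(p, i)]
  | t :: f => cond (Nat.beq t.2 i) ((p ++ t.1, i) :: f) (t :: Comb.add p i f)

def Comb.mulTerm (p : Poly) (i : ℕ) (q : Poly) (j : ℕ) (h : Comb) : Comb :=
  cond (compatible (raw i) (raw j))
    (force (fun k => Comb.add (Poly.mul (factor (raw i) (raw j)) p q) k h)
      (index (concat (raw i) (raw j))))
    h

def Comb.mul (f g : Comb) : Comb :=
  f.foldr (fun s h => g.foldr (fun t h => Comb.mulTerm s.1 s.2 t.1 t.2 h) h) []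

/-- Diagrams with equal coefficients share an indeterminate: six indeterminates serve nine diagrams.
-/
def xComb (v : ℕ → Var) : Comb :=
  [([(1, [v 0])], index (ofArcs [] [])),
   ([(1, [v 1])], index (ofArcs [(left 0, right 0)] [])),
   ([(1, [v 1])], index (ofArcs [(left 1, right 1)] [])),
   ([(1, [v 2])], index (ofArcs [(left 0, left 1)] [])),
   ([(1, [v 2])], index (ofArcs [(right 0, right 1)] [])),
   ([(1, [v 3])], index (ofArcs [(left 1, right 0)] [])),
   ([(1, [v 3])], index (ofArcs [(left 0, right 1)] [])),
   ([(1, [v 4])], index (ofArcs [(left 0, right 0), (left 1, right 1)] [])),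
   ([(1, [v 5])], index (ofArcs [(left 0, left 1), (right 0, right 1)] []))]

def dashedComb (p : Poly) (l : List (Node 2 × Node 2)) (w : List (Item 2)) : Comb :=
  [(p, index (ofArcs ((left 1, right 1) :: l) w)), (p, index (ofArcs l w))]

/-- The coefficient `a₁` has number 0 and `a₂` has number 9, so that `bᵢ` has number `i`. -/
def kComb (v : ℕ → Var) : Comb :=
  dashedComb [(1, [v 0])] [(left 0, right 0)] []
  ++ dashedComb [(1, [v 9])] [] []
  ++ dashedComb [(1, [v 1])] [] [.str (left 0), .str (right 0)]
  ++ dashedComb [(1, [v 2])] [] [.ghost, .str (left 0), .ghost, .str (right 0)]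
  ++ dashedComb [(1, [v 3])] [] [.ghost, .str (left 0), .str (right 0), .ghost]
  ++ dashedComb [(1, [v 4])] [] [.str (left 0), .ghost, .str (right 0), .ghost]
  ++ dashedComb [(1, [v 5])] [] [.ghost, .str (left 0)]
  ++ dashedComb [(1, [v 6])] [] [.str (left 0), .ghost]
  ++ dashedComb [(1, [v 7])] [] [.str (right 0), .ghost]
  ++ dashedComb [(1, [v 8])] [] [.ghost, .str (right 0)]

def lhsComb : Comb := ((Comb.mul (xComb .x) (kComb .k)).mul (xComb .y)).mul (kComb .l)

def rhsComb : Comb := ((Comb.mul (kComb .l) (xComb .y)).mul (kComb .k)).mul (xComb .x)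

/-! ### Bilinearity of the product -/

section Bilinear

variable {n : ℕ} {β α₁ α₂ α₃ : ℂ}

/-- The product as a bilinear map. -/
noncomputable def mulHom : DGh n β α₁ α₂ α₃ →ₗ[ℂ] DGh n β α₁ α₂ α₃ →ₗ[ℂ] DGh n β α₁ α₂ α₃ :=
  Finsupp.linearCombination (α := Diagram n) (M := DGh n β α₁ α₂ α₃ →ₗ[ℂ] DGh n β α₁ α₂ α₃) ℂ
    fun x => Finsupp.linearCombination (α := Diagram n) (M := DGh n β α₁ α₂ α₃) ℂ
      fun y => mulDiag x y

theorem mul_eq_mulHom (f g : DGh n β α₁ α₂ α₃) : f * g = mulHom f g := by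
  have h1 : f * g = Finsupp.sum (M := ℂ) (N := DGh n β α₁ α₂ α₃) f fun x a =>
      Finsupp.sum (M := ℂ) (N := DGh n β α₁ α₂ α₃) g fun y b => (a * b) • mulDiag x y := rfl
  have h2 : mulHom f = Finsupp.sum (M := ℂ) (N := DGh n β α₁ α₂ α₃ →ₗ[ℂ] DGh n β α₁ α₂ α₃) f
      fun x a => a • Finsupp.linearCombination (α := Diagram n) (M := DGh n β α₁ α₂ α₃) ℂ
        fun y => mulDiag x y := rfl
  rw [h1, h2]
  refine Eq.trans (Finsupp.sum_congr fun x _ => ?_)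
    (LinearMap.finsupp_sum_apply (γ := ℂ) f _ g).symm
  change _ = (_ : ℂ) • Finsupp.sum (M := ℂ) (N := DGh n β α₁ α₂ α₃) g (fun y b => b • mulDiag x y)
  exact (Finset.sum_congr rfl fun y _ => mul_smul _ _ _).trans Finset.smul_sum.symm

theorem dgh_add_mul (f g h : DGh n β α₁ α₂ α₃) : (f + g) * h = f * h + g * h := by
  simp only [mul_eq_mulHom, map_add, LinearMap.add_apply]

theorem dgh_mul_add (f g h : DGh n β α₁ α₂ α₃) : f * (g + h) = f * g + f * h := by
  simp only [mul_eq_mulHom, map_add]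

theorem dgh_smul_mul (c : ℂ) (f g : DGh n β α₁ α₂ α₃) : (c • f) * g = c • (f * g) := by
  simp only [mul_eq_mulHom, map_smul, LinearMap.smul_apply]

theorem dgh_mul_smul (c : ℂ) (f g : DGh n β α₁ α₂ α₃) : f * (c • g) = c • (f * g) := by
  simp only [mul_eq_mulHom, map_smul]

theorem dgh_zero_mul (f : DGh n β α₁ α₂ α₃) : 0 * f = 0 := by
  simpa using dgh_smul_mul 0 (0 : DGh n β α₁ α₂ α₃) f

theorem dgh_mul_zero (f : DGh n β α₁ α₂ α₃) : f * 0 = 0 := by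
  simpa using dgh_mul_smul 0 f (0 : DGh n β α₁ α₂ α₃)

theorem diag_mul_diag (x y : Diagram n) :
    (diag x * diag y : DGh n β α₁ α₂ α₃) = mulDiag x y := by
  have h : ∀ z : Diagram n, mulHom (diag z : DGh n β α₁ α₂ α₃)
      = Finsupp.linearCombination (α := Diagram n) (M := DGh n β α₁ α₂ α₃) ℂ
        fun y => mulDiag z y := fun z =>
    (Finsupp.linearCombination_single ℂ (1 : ℂ) z).trans (one_smul _ _)
  rw [mul_eq_mulHom, h]
  exact (Finsupp.linearCombination_single ℂ (1 : ℂ) y).trans (one_smul _ _)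

end Bilinear

/-! ### Evaluation of symbolic combinations in the algebra -/

/-- The algebra on two strands with parameters read off from an assignment. -/
abbrev Alg (ρ : Var → ℂ) : Type := DGh 2 (ρ (.par 0)) (ρ (.par 1)) (ρ (.par 2)) (ρ (.par 3))

noncomputable def basisElt (ρ : Var → ℂ) (i : ℕ) : Alg ρ := diag ⟨raw i, raw_valid i⟩

theorem basisElt_index (ρ : Var → ℂ) {d : RawDiagram 2} (hd : d.Valid) (h : index d < 117) :
    basisElt ρ (index d) = diag ⟨d, hd⟩ := by
  simp only [basisElt, raw_index h]

theorem eval_factor (ρ : Var → ℂ) (x y : RawDiagram 2) :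
    Mono.eval ρ (factor x y) = ρ (.par 0) ^ loops x y *
      ((arcs x y).map (arcFactor (ρ (.par 1)) (ρ (.par 2)) (ρ (.par 3)))).prod := by
  simp only [Mono.eval, factor, List.map_append, List.prod_append, List.map_replicate,
    List.prod_replicate, List.map_map]
  congr 3
  funext a
  simp only [Function.comp, arcFactor]
  split_ifs <;> rfl

noncomputable def Comb.eval (ρ : Var → ℂ) (f : Comb) : Alg ρ :=
  (f.map fun t => Poly.eval ρ t.1 • basisElt ρ t.2).sum

theorem Comb.eval_cons (ρ : Var → ℂ) (t : Poly × ℕ) (f : Comb) :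
    Comb.eval ρ (t :: f) = Poly.eval ρ t.1 • basisElt ρ t.2 + Comb.eval ρ f := by
  simp [Comb.eval]

theorem Comb.eval_append (ρ : Var → ℂ) (f g : Comb) :
    Comb.eval ρ (f ++ g) = Comb.eval ρ f + Comb.eval ρ g := by
  simp [Comb.eval]

theorem Comb.eval_add (ρ : Var → ℂ) (p : Poly) (i : ℕ) (f : Comb) :
    Comb.eval ρ (Comb.add p i f) = Poly.eval ρ p • basisElt ρ i + Comb.eval ρ f := by
  induction f with
  | nil => simp [Comb.add, Comb.eval]
  | cons t f ih =>
    rw [Comb.add]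
    cases h : Nat.beq t.2 i
    · rw [cond_false, Comb.eval_cons, Comb.eval_cons, ih]; abel
    · rw [cond_true, Comb.eval_cons, Comb.eval_cons, Poly.eval_append, add_smul,
        Nat.eq_of_beq_eq_true h, add_assoc]

/-- No index disappears when a term is added; hence a bound on the indices of a final result also
bounds those of all its partial sums. -/
theorem Comb.indices_add (p : Poly) (i : ℕ) (f : Comb) :
    i ∈ (Comb.add p i f).map Prod.snd ∧ ∀ j ∈ f.map Prod.snd, j ∈ (Comb.add p i f).map Prod.snd := by
  induction f with
  | nil => simp [Comb.add]
  | cons t f ih =>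
    rw [Comb.add]
    cases h : Nat.beq t.2 i
    · simp only [cond_false, List.map_cons, List.mem_cons]
      exact ⟨.inr ih.1, fun j hj => hj.imp id (ih.2 j)⟩
    · obtain rfl := Nat.eq_of_beq_eq_true h; simp

/-- All indices are those of diagrams. -/
def Comb.Good (f : Comb) : Prop := ∀ j ∈ f.map Prod.snd, j < 117

/-- That all indices of the result are below 117 certifies that the lookup of the concatenation
succeeded. This replaces a general proof that a concatenation of diagrams is a diagram. -/
theorem Comb.mulTerm_spec (ρ : Var → ℂ) (p : Poly) (i : ℕ) (q : Poly) (j : ℕ) (h : Comb)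
    (hg : (Comb.mulTerm p i q j h).Good) :
    h.Good ∧ Comb.eval ρ (Comb.mulTerm p i q j h)
      = (Poly.eval ρ p • basisElt ρ i) * (Poly.eval ρ q • basisElt ρ j) + Comb.eval ρ h := by
  rw [dgh_smul_mul, dgh_mul_smul, basisElt, basisElt, diag_mul_diag, mulDiag]
  rw [Comb.mulTerm, force_eq, cond_eq_ite] at *
  simp only [compatible_iff] at *
  split_ifs at hg ⊢ with hc hv
  · have hk := hg _ (Comb.indices_add _ _ _).1
    refine ⟨fun j hj => hg j ((Comb.indices_add _ _ _).2 j hj), ?_⟩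
    rw [Comb.eval_add, Poly.eval_mul, eval_factor, basisElt_index ρ hv hk, smul_smul, smul_smul]
    congr 2; ring
  -- A concatenation that was found in the list is valid, so the inner `else` of `mulDiag` does not
  -- occur.
  · have hk := hg _ (Comb.indices_add _ _ _).1
    exact absurd (raw_index hk ▸ raw_valid _) hv
  · exact ⟨hg, by simp⟩

theorem Comb.mul_spec (ρ : Var → ℂ) (f g : Comb) (hg : (f.mul g).Good) :
    Comb.eval ρ (f.mul g) = Comb.eval ρ f * Comb.eval ρ g := by
  have key : ∀ (p : Poly) (i : ℕ) (g h : Comb),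
      (g.foldr (fun t h => Comb.mulTerm p i t.1 t.2 h) h).Good →
      h.Good ∧ Comb.eval ρ (g.foldr (fun t h => Comb.mulTerm p i t.1 t.2 h) h)
        = (Poly.eval ρ p • basisElt ρ i) * Comb.eval ρ g + Comb.eval ρ h := by
    intro p i g h
    induction g with
    | nil => intro hh; exact ⟨hh, by simp [Comb.eval, dgh_mul_zero]⟩
    | cons t g ih =>
      intro hh
      obtain ⟨h1, h2⟩ := Comb.mulTerm_spec ρ _ _ _ _ _ hh
      obtain ⟨h3, h4⟩ := ih h1
      refine ⟨h3, ?_⟩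
      rw [List.foldr_cons, h2, h4, Comb.eval_cons, dgh_mul_add, add_assoc]
  unfold Comb.mul at hg ⊢
  induction f with
  | nil => simp [Comb.eval, dgh_zero_mul]
  | cons s f ih =>
    obtain ⟨h1, h2⟩ := key _ _ _ _ hg
    rw [List.foldr_cons, h2, ih h1, Comb.eval_cons, dgh_add_mul]

def Comb.component (f : Comb) (i : ℕ) : Poly := f.flatMap fun t => if t.2 = i then t.1 else []

theorem Comb.eval_eq_sum (ρ : Var → ℂ) (f : Comb) (hf : f.Good) :
    Comb.eval ρ f = ∑ i ∈ Finset.range 117, Poly.eval ρ (f.component i) • basisElt ρ i := by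
  induction f with
  | nil => simp [Comb.eval, Comb.component, Poly.eval]
  | cons t f ih =>
    have ht : t.2 < 117 := hf _ (by simp)
    rw [Comb.eval_cons, ih fun j hj => hf j (by simp only [List.map_cons, List.mem_cons]; exact .inr hj)]
    have : ∀ i, Poly.eval ρ (Comb.component (t :: f) i) • basisElt ρ i
        = (if t.2 = i then Poly.eval ρ t.1 • basisElt ρ i else 0)
          + Poly.eval ρ (Comb.component f i) • basisElt ρ i := by
      intro i
      rw [Comb.component, List.flatMap_cons, Poly.eval_append, add_smul, ← Comb.component]
      split_ifs <;> simp [Poly.eval]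
    simp only [this, Finset.sum_add_distrib, Finset.sum_ite_eq, Finset.mem_range, ht, if_true]

set_option maxRecDepth 100000 in
theorem index_raw : ∀ i < 117, index (raw i) = i := by decide +kernel

/-- The listed diagrams are pairwise different basis vectors, since `index` recovers the place of
each; an equation between combinations is therefore an equation of coordinates. -/
theorem Comb.eval_eq_iff (ρ : Var → ℂ) (f g : Comb) (hf : f.Good) (hg : g.Good) :
    Comb.eval ρ f = Comb.eval ρ g ↔
      ∀ i < 117, Poly.eval ρ (f.component i) = Poly.eval ρ (g.component i) := by
  rw [Comb.eval_eq_sum ρ f hf, Comb.eval_eq_sum ρ g hg]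
  constructor
  · intro h i hi
    let c : Alg ρ →ₗ[ℂ] ℂ :=
      Finsupp.lapply (R := ℂ) (M := ℂ) (⟨raw i, raw_valid i⟩ : Diagram 2)
    have hc : ∀ j < 117, c (basisElt ρ j) = if j = i then 1 else 0 := by
      intro j hj
      refine (Finsupp.single_apply (M := ℂ)).trans ?_
      refine if_congr ⟨fun hij => ?_, fun hij => by subst hij; rfl⟩ rfl rfl
      rw [← index_raw i hi, ← index_raw j hj, Subtype.mk.inj hij]
    have key : ∀ f : Comb, c (∑ j ∈ Finset.range 117, Poly.eval ρ (f.component j) • basisElt ρ j)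
        = Poly.eval ρ (f.component i) := by
      intro f
      rw [map_sum, Finset.sum_eq_single i]
      · rw [map_smul, hc i hi]; simp
      · intro j hj hji
        rw [map_smul, hc j (Finset.mem_range.1 hj)]; simp [hji]
      · exact fun h => absurd (Finset.mem_range.2 hi) h
    rw [← key f, ← key g, h]
  · intro h
    exact Finset.sum_congr rfl fun i hi => by rw [h i (Finset.mem_range.1 hi)]

/-! ### The components of the boundary Yang-Baxter equation

Adding a ghost at both ends of the boundary exchanges `α₁` and `α₂`; reflecting the diagrams from left
to right exchanges the two sides of the equation. The components are given up to these symmetries. -/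

def ghostIndex : ℕ → ℕ
  | 1 => 3 | 3 => 1 | 2 => 4 | 4 => 2 | 5 => 6 | 6 => 5 | 7 => 8 | 8 => 7 | i => i

def flipIndex : ℕ → ℕ
  | 2 => 4 | 4 => 2 | 5 => 7 | 7 => 5 | 6 => 8 | 8 => 6 | i => i

def ghostVar : Var → Var
  | .par 1 => .par 2
  | .par 2 => .par 1
  | .k i => .k (ghostIndex i)
  | .l i => .l (ghostIndex i)
  | v => v

def flipVar : Var → Var
  | .k i => .k (flipIndex i)
  | .l i => .l (flipIndex i)
  | v => v

def toggleHead : List (Item 2) → List (Item 2)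
  | .ghost :: w => w
  | w => .ghost :: w

def ghostDiagram (d : RawDiagram 2) : RawDiagram 2 where
  link := d.link
  word := (toggleHead (toggleHead d.word).reverse).reverse

def flipNode (p : Node 2) : Node 2 := (!p.1, p.2)

def flipItem : Item 2 → Item 2
  | .ghost => .ghost
  | .str p => .str (flipNode p)

def flipDiagram (d : RawDiagram 2) : RawDiagram 2 where
  link p := (d.link (flipNode p)).map flipNode
  word := (d.word.map flipItem).reverse

/-- Diagrams, up to the two symmetries, with their coefficients in the difference of the two sides of
the boundary Yang-Baxter equation. -/
def components : List (List (Node 2 × Node 2) × List (Item 2) × Poly) :=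
  [([], [.str (left 0), .str (left 1), .str (right 1), .ghost, .str (right 0), .ghost],
    [(1, [.k 1, .l 4, .x 4, .y 5]), (-1, [.k 4, .l 1, .x 4, .y 5])]),
   ([], [.str (left 0), .str (left 1), .ghost, .str (right 1), .str (right 0), .ghost],
    [(1, [.k 1, .l 3, .x 4, .y 5]), (-1, [.k 3, .l 1, .x 4, .y 5])]),
   ([], [.str (left 0), .str (left 1), .ghost, .str (right 1), .ghost, .str (right 0)],
    [(1, [.k 1, .l 2, .x 4, .y 5]), (-1, [.k 2, .l 1, .x 4, .y 5])]),
   ([], [.str (left 0), .ghost, .str (left 1), .str (right 1), .ghost, .str (right 0)],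
    [(1, [.k 4, .l 2, .x 4, .y 5]), (-1, [.k 2, .l 4, .x 4, .y 5])]),
   ([], [.str (left 0), .str (left 1), .str (right 1), .ghost],
    [(1, [.k 1, .l 6, .x 4, .y 5]), (-1, [.k 7, .l 1, .x 3, .y 2]),
     (-1, [.k 3, .l 6, .x 3, .y 3]), (-1, [.k 6, .l 1, .x 1, .y 5])]),
   ([], [.str (left 0), .str (left 1), .ghost, .str (right 1)],
    [(1, [.k 1, .l 5, .x 4, .y 5]), (-1, [.k 8, .l 1, .x 3, .y 2]),
     (-1, [.k 2, .l 6, .x 3, .y 3]), (-1, [.k 5, .l 1, .x 1, .y 5])]),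
   ([], [.str (left 0), .ghost, .str (left 1), .str (right 1)],
    [(1, [.k 4, .l 5, .x 4, .y 5]), (-1, [.k 8, .l 4, .x 3, .y 2]),
     (-1, [.k 1, .l 6, .x 3, .y 3]), (-1, [.k 5, .l 4, .x 1, .y 5])]),
   ([], [.str (left 0), .ghost, .str (left 1), .ghost, .str (right 1), .ghost],
    [(1, [.k 4, .l 6, .x 4, .y 5]), (-1, [.k 7, .l 4, .x 3, .y 2]),
     (-1, [.k 4, .l 6, .x 3, .y 3]), (-1, [.k 6, .l 4, .x 1, .y 5])]),
   ([], [.str (left 1), .str (right 1)],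
    [(1, [.k 7, .l 5, .x 1, .y 5]), (1, [.k 6, .l 5, .x 3, .y 2]),
     (-1, [.k 8, .l 7, .x 3, .y 2]), (-1, [.k 5, .l 7, .x 1, .y 5])]),
   ([], [.str (left 1), .ghost, .str (right 1), .ghost],
    [(1, [.k 7, .l 6, .x 1, .y 5]), (1, [.k 6, .l 6, .x 3, .y 2]),
     (-1, [.k 7, .l 7, .x 3, .y 2]), (-1, [.k 6, .l 7, .x 1, .y 5])]),
   ([], [.str (left 0), .str (left 1), .str (right 0), .ghost],
    [(1, [.k 1, .l 7, .x 4, .y 2]), (1, [.k 6, .l 3, .x 4, .y 3]),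
     (-1, [.k 7, .l 1, .x 1, .y 2]), (-1, [.k 3, .l 6, .x 1, .y 3]),
     (-1, [.k 6, .l 1, .x 3, .y 5])]),
   ([], [.str (left 0), .str (left 1), .ghost, .str (right 0)],
    [(1, [.k 1, .l 8, .x 4, .y 2]), (1, [.k 6, .l 2, .x 4, .y 3]),
     (-1, [.k 8, .l 1, .x 1, .y 2]), (-1, [.k 2, .l 6, .x 1, .y 3]),
     (-1, [.k 5, .l 1, .x 3, .y 5])]),
   ([], [.str (left 0), .str (right 1), .ghost, .str (right 0)],
    [(1, [.k 1, .l 8, .x 1, .y 3]), (1, [.k 6, .l 2, .x 1, .y 2]), (1, [.k 7, .l 2, .x 3, .y 5]),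
     (-1, [.k 8, .l 1, .x 4, .y 3]), (-1, [.k 2, .l 6, .x 4, .y 2])]),
   ([], [.str (left 0), .ghost, .str (left 1), .ghost, .str (right 0), .ghost],
    [(1, [.k 4, .l 7, .x 4, .y 2]), (1, [.k 6, .l 4, .x 4, .y 3]),
     (-1, [.k 7, .l 4, .x 1, .y 2]), (-1, [.k 4, .l 6, .x 1, .y 3]),
     (-1, [.k 6, .l 4, .x 3, .y 5])]),
   ([(left 0, right 1)], [.str (right 0), .ghost],
    [(1, [.k 0, .l 7, .x 1, .y 3]), (1, [.k 9, .l 7, .x 3, .y 1]), (1, [.k 7, .l 0, .x 3, .y 4]),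
     (1, [.par 1, .k 7, .l 3, .x 3, .y 4]), (1, [.par 3, .k 7, .l 4, .x 3, .y 4]),
     (1, [.par 3, .k 8, .l 3, .x 3, .y 4]), (1, [.par 2, .k 8, .l 4, .x 3, .y 4]),
     (-1, [.k 7, .l 0, .x 4, .y 3])]),
   ([(left 0, right 1)], [],
    [(1, [.k 0, .l 9, .x 1, .y 3]), (1, [.k 9, .l 9, .x 3, .y 1]),
     (1, [.par 1, .k 7, .l 5, .x 3, .y 4]), (1, [.par 3, .k 7, .l 6, .x 3, .y 4]),
     (1, [.par 3, .k 8, .l 5, .x 3, .y 4]), (1, [.par 2, .k 8, .l 6, .x 3, .y 4]),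
     (-1, [.k 0, .l 0, .x 3, .y 1]), (-1, [.k 9, .l 0, .x 1, .y 3])]),
   ([(left 1, right 1)], [.str (left 0), .str (right 0)],
    [(1, [.par 3, .k 1, .l 2, .x 4, .y 4]), (1, [.par 3, .k 4, .l 1, .x 4, .y 4]),
     (1, [.par 1, .k 4, .l 2, .x 4, .y 4]), (1, [.k 6, .l 8, .x 4, .y 1]),
     (-1, [.par 3, .k 2, .l 1, .x 4, .y 4]), (-1, [.par 3, .k 1, .l 4, .x 4, .y 4]),
     (-1, [.par 1, .k 2, .l 4, .x 4, .y 4]), (-1, [.k 8, .l 6, .x 4, .y 1])]),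
   ([(left 1, right 1)], [.str (left 0), .ghost, .str (right 0), .ghost],
    [(1, [.par 3, .k 1, .l 3, .x 4, .y 4]), (1, [.par 2, .k 1, .l 4, .x 4, .y 4]),
     (1, [.par 1, .k 4, .l 3, .x 4, .y 4]), (1, [.k 6, .l 7, .x 4, .y 1]),
     (-1, [.par 3, .k 3, .l 1, .x 4, .y 4]), (-1, [.par 2, .k 4, .l 1, .x 4, .y 4]),
     (-1, [.par 1, .k 3, .l 4, .x 4, .y 4]), (-1, [.k 7, .l 6, .x 4, .y 1])]),
   ([(left 1, right 1)], [],
    [(1, [.par 1, .k 7, .l 5, .x 1, .y 4]), (1, [.par 3, .k 7, .l 6, .x 1, .y 4]),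
     (1, [.par 3, .k 8, .l 5, .x 1, .y 4]), (1, [.par 2, .k 8, .l 6, .x 1, .y 4]),
     (-1, [.par 1, .k 5, .l 7, .x 1, .y 4]), (-1, [.par 3, .k 6, .l 7, .x 1, .y 4]),
     (-1, [.par 3, .k 5, .l 8, .x 1, .y 4]), (-1, [.par 2, .k 6, .l 8, .x 1, .y 4])]),
   ([], [.str (left 0), .str (right 0)],
    [(1, [.par 3, .k 1, .l 2, .x 1, .y 1]), (1, [.par 3, .k 4, .l 1, .x 1, .y 1]),
     (1, [.par 1, .k 4, .l 2, .x 1, .y 1]), (1, [.k 6, .l 8, .x 1, .y 0]),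
     (1, [.k 7, .l 8, .x 3, .y 2]), (-1, [.par 3, .k 2, .l 1, .x 1, .y 1]),
     (-1, [.par 3, .k 1, .l 4, .x 1, .y 1]), (-1, [.par 1, .k 2, .l 4, .x 1, .y 1]),
     (-1, [.k 8, .l 6, .x 1, .y 0]), (-1, [.k 5, .l 6, .x 3, .y 2])]),
   ([], [.str (left 0), .ghost, .str (right 0), .ghost],
    [(1, [.par 3, .k 1, .l 3, .x 1, .y 1]), (1, [.par 2, .k 1, .l 4, .x 1, .y 1]),
     (1, [.par 1, .k 4, .l 3, .x 1, .y 1]), (1, [.k 6, .l 7, .x 1, .y 0]),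
     (1, [.k 7, .l 7, .x 3, .y 2]), (-1, [.par 3, .k 3, .l 1, .x 1, .y 1]),
     (-1, [.par 2, .k 4, .l 1, .x 1, .y 1]), (-1, [.par 1, .k 3, .l 4, .x 1, .y 1]),
     (-1, [.k 7, .l 6, .x 1, .y 0]), (-1, [.k 6, .l 6, .x 3, .y 2])]),
   ([], [.str (left 0), .ghost, .str (right 1), .ghost],
    [(1, [.k 4, .l 9, .x 1, .y 3]), (1, [.k 7, .l 6, .x 3, .y 5]),
     (-1, [.k 4, .l 0, .x 3, .y 1]), (-1, [.par 3, .k 3, .l 1, .x 3, .y 1]),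
     (-1, [.par 2, .k 4, .l 1, .x 3, .y 1]), (-1, [.k 0, .l 4, .x 3, .y 1]),
     (-1, [.par 1, .k 3, .l 4, .x 3, .y 1]), (-1, [.par 3, .k 4, .l 4, .x 3, .y 1]),
     (-1, [.k 7, .l 6, .x 3, .y 0]), (-1, [.k 9, .l 4, .x 1, .y 3])]),
   ([], [.str (left 0), .str (right 1)],
    [(1, [.k 1, .l 9, .x 1, .y 3]), (1, [.k 6, .l 5, .x 1, .y 2]), (1, [.k 7, .l 5, .x 3, .y 5]),
     (-1, [.k 1, .l 0, .x 3, .y 1]), (-1, [.k 0, .l 1, .x 3, .y 1]),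
     (-1, [.par 2, .k 1, .l 1, .x 3, .y 1]), (-1, [.par 3, .k 2, .l 1, .x 3, .y 1]),
     (-1, [.par 3, .k 1, .l 4, .x 3, .y 1]), (-1, [.par 1, .k 2, .l 4, .x 3, .y 1]),
     (-1, [.k 8, .l 6, .x 3, .y 0]), (-1, [.k 9, .l 1, .x 1, .y 3]),
     (-1, [.k 5, .l 6, .x 1, .y 2])]),
   ([(left 1, right 1)], [.str (left 0), .ghost],
    [(1, [.k 0, .l 6, .x 4, .y 4]), (1, [.par 3, .k 1, .l 5, .x 4, .y 4]),
     (1, [.par 2, .k 1, .l 6, .x 4, .y 4]), (1, [.par 1, .k 4, .l 5, .x 4, .y 4]),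
     (1, [.par 3, .k 4, .l 6, .x 4, .y 4]), (1, [.k 6, .l 9, .x 4, .y 1]),
     (-1, [.k 6, .l 0, .x 1, .y 4]), (-1, [.par 3, .k 5, .l 1, .x 1, .y 4]),
     (-1, [.par 2, .k 6, .l 1, .x 1, .y 4]), (-1, [.par 1, .k 5, .l 4, .x 1, .y 4]),
     (-1, [.par 3, .k 6, .l 4, .x 1, .y 4]), (-1, [.k 9, .l 6, .x 1, .y 1]),
     (-1, [.k 0, .l 6, .x 3, .y 3])]),
   ([(left 0, left 1)], [.str (right 1), .str (right 0)],
    [(1, [.k 9, .l 1, .x 2, .y 2]), (1, [.k 0, .l 1, .x 4, .y 5]), (1, [.k 0, .l 1, .x 5, .y 4]),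
     (1, [.par 0, .k 0, .l 1, .x 5, .y 5]), (1, [.par 1, .k 1, .l 1, .x 5, .y 5]),
     (1, [.par 3, .k 2, .l 1, .x 5, .y 5]), (1, [.par 2, .k 3, .l 1, .x 5, .y 5]),
     (1, [.par 3, .k 4, .l 1, .x 5, .y 5]), (1, [.k 7, .l 8, .x 2, .y 3]),
     (1, [.k 6, .l 8, .x 5, .y 1]), (1, [.k 1, .l 0, .x 5, .y 4]),
     (1, [.par 2, .k 1, .l 1, .x 5, .y 4]), (1, [.par 3, .k 1, .l 2, .x 5, .y 4]),
     (1, [.par 3, .k 4, .l 1, .x 5, .y 4]), (1, [.par 1, .k 4, .l 2, .x 5, .y 4]),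
     (-1, [.k 1, .l 0, .x 4, .y 5])]),
   ([(left 0, left 1)], [.str (right 1), .ghost, .str (right 0), .ghost],
    [(1, [.k 9, .l 4, .x 2, .y 2]), (1, [.k 0, .l 4, .x 4, .y 5]), (1, [.k 0, .l 4, .x 5, .y 4]),
     (1, [.par 0, .k 0, .l 4, .x 5, .y 5]), (1, [.par 1, .k 1, .l 4, .x 5, .y 5]),
     (1, [.par 3, .k 2, .l 4, .x 5, .y 5]), (1, [.par 2, .k 3, .l 4, .x 5, .y 5]),
     (1, [.par 3, .k 4, .l 4, .x 5, .y 5]), (1, [.k 7, .l 7, .x 2, .y 3]),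
     (1, [.k 6, .l 7, .x 5, .y 1]), (1, [.par 3, .k 1, .l 3, .x 5, .y 4]),
     (1, [.par 2, .k 1, .l 4, .x 5, .y 4]), (1, [.k 4, .l 0, .x 5, .y 4]),
     (1, [.par 1, .k 4, .l 3, .x 5, .y 4]), (1, [.par 3, .k 4, .l 4, .x 5, .y 4]),
     (-1, [.k 4, .l 0, .x 4, .y 5])]),
   ([(left 0, left 1)], [.str (right 1), .ghost],
    [(1, [.k 9, .l 6, .x 2, .y 2]), (1, [.k 0, .l 6, .x 4, .y 5]), (1, [.k 0, .l 6, .x 5, .y 4]),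
     (1, [.par 0, .k 0, .l 6, .x 5, .y 5]), (1, [.par 1, .k 1, .l 6, .x 5, .y 5]),
     (1, [.par 3, .k 2, .l 6, .x 5, .y 5]), (1, [.par 2, .k 3, .l 6, .x 5, .y 5]),
     (1, [.par 3, .k 4, .l 6, .x 5, .y 5]), (1, [.k 7, .l 9, .x 2, .y 3]),
     (1, [.k 6, .l 9, .x 5, .y 1]), (1, [.par 3, .k 1, .l 5, .x 5, .y 4]),
     (1, [.par 2, .k 1, .l 6, .x 5, .y 4]), (1, [.par 1, .k 4, .l 5, .x 5, .y 4]),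
     (1, [.par 3, .k 4, .l 6, .x 5, .y 4]), (-1, [.k 7, .l 0, .x 3, .y 2]),
     (-1, [.k 6, .l 0, .x 1, .y 5])]),
   ([], [.str (left 0), .str (left 1)],
    [(1, [.k 1, .l 9, .x 4, .y 2]), (1, [.k 6, .l 5, .x 4, .y 3]),
     (-1, [.k 1, .l 0, .x 2, .y 4]), (-1, [.k 0, .l 1, .x 2, .y 4]),
     (-1, [.par 2, .k 1, .l 1, .x 2, .y 4]), (-1, [.par 3, .k 2, .l 1, .x 2, .y 4]),
     (-1, [.par 3, .k 1, .l 4, .x 2, .y 4]), (-1, [.par 1, .k 2, .l 4, .x 2, .y 4]),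
     (-1, [.k 8, .l 6, .x 2, .y 1]), (-1, [.k 9, .l 1, .x 0, .y 2]),
     (-1, [.k 5, .l 6, .x 0, .y 3]), (-1, [.par 0, .k 0, .l 1, .x 2, .y 5]),
     (-1, [.par 1, .k 1, .l 1, .x 2, .y 5]), (-1, [.par 3, .k 2, .l 1, .x 2, .y 5]),
     (-1, [.par 2, .k 3, .l 1, .x 2, .y 5]), (-1, [.par 3, .k 4, .l 1, .x 2, .y 5])]),
   ([], [.str (left 0), .ghost, .str (left 1), .ghost],
    [(1, [.k 4, .l 9, .x 4, .y 2]), (1, [.k 6, .l 6, .x 4, .y 3]),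
     (-1, [.k 4, .l 0, .x 2, .y 4]), (-1, [.par 3, .k 3, .l 1, .x 2, .y 4]),
     (-1, [.par 2, .k 4, .l 1, .x 2, .y 4]), (-1, [.k 0, .l 4, .x 2, .y 4]),
     (-1, [.par 1, .k 3, .l 4, .x 2, .y 4]), (-1, [.par 3, .k 4, .l 4, .x 2, .y 4]),
     (-1, [.k 7, .l 6, .x 2, .y 1]), (-1, [.k 9, .l 4, .x 0, .y 2]),
     (-1, [.k 6, .l 6, .x 0, .y 3]), (-1, [.par 0, .k 0, .l 4, .x 2, .y 5]),
     (-1, [.par 1, .k 1, .l 4, .x 2, .y 5]), (-1, [.par 3, .k 2, .l 4, .x 2, .y 5]),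
     (-1, [.par 2, .k 3, .l 4, .x 2, .y 5]), (-1, [.par 3, .k 4, .l 4, .x 2, .y 5])]),
   ([], [],
    [(1, [.par 1, .k 7, .l 5, .x 0, .y 1]), (1, [.par 1, .k 6, .l 5, .x 2, .y 3]),
     (1, [.par 3, .k 7, .l 6, .x 0, .y 1]), (1, [.par 3, .k 6, .l 6, .x 2, .y 3]),
     (1, [.par 3, .k 8, .l 5, .x 0, .y 1]), (1, [.par 3, .k 5, .l 5, .x 2, .y 3]),
     (1, [.par 2, .k 8, .l 6, .x 0, .y 1]), (1, [.par 2, .k 5, .l 6, .x 2, .y 3]),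
     (-1, [.par 1, .k 5, .l 7, .x 0, .y 1]), (-1, [.par 3, .k 6, .l 7, .x 0, .y 1]),
     (-1, [.par 3, .k 5, .l 8, .x 0, .y 1]), (-1, [.par 2, .k 6, .l 8, .x 0, .y 1]),
     (-1, [.par 1, .k 8, .l 7, .x 2, .y 3]), (-1, [.par 3, .k 8, .l 8, .x 2, .y 3]),
     (-1, [.par 2, .k 7, .l 8, .x 2, .y 3]), (-1, [.par 3, .k 7, .l 7, .x 2, .y 3])]),
   ([(left 0, left 1)], [.str (right 0), .ghost],
    [(1, [.k 9, .l 7, .x 2, .y 0]), (1, [.k 0, .l 7, .x 4, .y 2]),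
     (1, [.par 0, .k 0, .l 7, .x 5, .y 2]), (1, [.par 1, .k 1, .l 7, .x 5, .y 2]),
     (1, [.par 3, .k 2, .l 7, .x 5, .y 2]), (1, [.par 2, .k 3, .l 7, .x 5, .y 2]),
     (1, [.par 3, .k 4, .l 7, .x 5, .y 2]), (1, [.k 7, .l 0, .x 2, .y 1]),
     (1, [.k 6, .l 0, .x 5, .y 3]), (1, [.par 1, .k 7, .l 3, .x 2, .y 1]),
     (1, [.par 1, .k 6, .l 3, .x 5, .y 3]), (1, [.par 3, .k 7, .l 4, .x 2, .y 1]),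
     (1, [.par 3, .k 6, .l 4, .x 5, .y 3]), (1, [.par 3, .k 8, .l 3, .x 2, .y 1]),
     (1, [.par 3, .k 5, .l 3, .x 5, .y 3]), (1, [.par 2, .k 8, .l 4, .x 2, .y 1]),
     (1, [.par 2, .k 5, .l 4, .x 5, .y 3]), (-1, [.k 7, .l 0, .x 1, .y 2]),
     (-1, [.k 6, .l 0, .x 3, .y 5])]),
   ([], [.str (left 1), .ghost],
    [(1, [.k 9, .l 6, .x 1, .y 3]), (1, [.k 0, .l 6, .x 3, .y 1]), (1, [.k 7, .l 9, .x 1, .y 2]),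
     (1, [.k 6, .l 9, .x 3, .y 0]), (1, [.par 3, .k 1, .l 5, .x 3, .y 1]),
     (1, [.par 2, .k 1, .l 6, .x 3, .y 1]), (1, [.par 1, .k 4, .l 5, .x 3, .y 1]),
     (1, [.par 3, .k 4, .l 6, .x 3, .y 1]), (-1, [.k 7, .l 9, .x 2, .y 1]),
     (-1, [.k 0, .l 7, .x 2, .y 4]), (-1, [.par 1, .k 3, .l 7, .x 2, .y 4]),
     (-1, [.par 3, .k 4, .l 7, .x 2, .y 4]), (-1, [.par 3, .k 3, .l 8, .x 2, .y 4]),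
     (-1, [.par 2, .k 4, .l 8, .x 2, .y 4]), (-1, [.k 6, .l 9, .x 0, .y 3]),
     (-1, [.k 9, .l 7, .x 0, .y 2]), (-1, [.par 0, .k 0, .l 7, .x 2, .y 5]),
     (-1, [.par 1, .k 1, .l 7, .x 2, .y 5]), (-1, [.par 3, .k 2, .l 7, .x 2, .y 5]),
     (-1, [.par 2, .k 3, .l 7, .x 2, .y 5]), (-1, [.par 3, .k 4, .l 7, .x 2, .y 5])]),
   ([(left 0, left 1)], [],
    [(1, [.k 9, .l 9, .x 2, .y 0]), (1, [.k 0, .l 9, .x 4, .y 2]),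
     (1, [.par 0, .k 0, .l 9, .x 5, .y 2]), (1, [.par 1, .k 1, .l 9, .x 5, .y 2]),
     (1, [.par 3, .k 2, .l 9, .x 5, .y 2]), (1, [.par 2, .k 3, .l 9, .x 5, .y 2]),
     (1, [.par 3, .k 4, .l 9, .x 5, .y 2]), (1, [.par 1, .k 7, .l 5, .x 2, .y 1]),
     (1, [.par 1, .k 6, .l 5, .x 5, .y 3]), (1, [.par 3, .k 7, .l 6, .x 2, .y 1]),
     (1, [.par 3, .k 6, .l 6, .x 5, .y 3]), (1, [.par 3, .k 8, .l 5, .x 2, .y 1]),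
     (1, [.par 3, .k 5, .l 5, .x 5, .y 3]), (1, [.par 2, .k 8, .l 6, .x 2, .y 1]),
     (1, [.par 2, .k 5, .l 6, .x 5, .y 3]), (-1, [.k 9, .l 0, .x 0, .y 2]),
     (-1, [.k 0, .l 0, .x 2, .y 4]), (-1, [.par 0, .k 0, .l 0, .x 2, .y 5]),
     (-1, [.par 1, .k 1, .l 0, .x 2, .y 5]), (-1, [.par 3, .k 2, .l 0, .x 2, .y 5]),
     (-1, [.par 2, .k 3, .l 0, .x 2, .y 5]), (-1, [.par 3, .k 4, .l 0, .x 2, .y 5])]),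
   ([], [.str (left 0), .ghost],
    [(1, [.k 0, .l 6, .x 1, .y 1]), (1, [.k 9, .l 6, .x 3, .y 3]),
     (1, [.par 3, .k 1, .l 5, .x 1, .y 1]), (1, [.par 2, .k 1, .l 6, .x 1, .y 1]),
     (1, [.par 1, .k 4, .l 5, .x 1, .y 1]), (1, [.par 3, .k 4, .l 6, .x 1, .y 1]),
     (1, [.k 6, .l 9, .x 1, .y 0]), (1, [.k 7, .l 9, .x 3, .y 2]),
     (-1, [.k 6, .l 0, .x 0, .y 1]), (-1, [.par 3, .k 5, .l 1, .x 0, .y 1]),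
     (-1, [.par 2, .k 6, .l 1, .x 0, .y 1]), (-1, [.par 1, .k 5, .l 4, .x 0, .y 1]),
     (-1, [.par 3, .k 6, .l 4, .x 0, .y 1]), (-1, [.k 9, .l 6, .x 0, .y 0]),
     (-1, [.k 7, .l 0, .x 2, .y 3]), (-1, [.par 2, .k 7, .l 1, .x 2, .y 3]),
     (-1, [.par 2, .k 3, .l 6, .x 2, .y 2]), (-1, [.par 3, .k 8, .l 1, .x 2, .y 3]),
     (-1, [.par 3, .k 2, .l 6, .x 2, .y 2]), (-1, [.par 3, .k 7, .l 4, .x 2, .y 3]),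
     (-1, [.par 3, .k 4, .l 6, .x 2, .y 2]), (-1, [.par 1, .k 8, .l 4, .x 2, .y 3]),
     (-1, [.par 1, .k 1, .l 6, .x 2, .y 2]), (-1, [.par 0, .k 0, .l 6, .x 2, .y 2])])]

def Comb.diff (f g : Comb) (i : ℕ) : Poly := f.component i ++ Poly.smul (-1) (g.component i)

def Comb.good (f : Comb) : Bool := f.all fun t => Nat.blt t.2 117

theorem Comb.good_spec {f : Comb} (h : f.good = true) : f.Good := by
  intro j hj
  obtain ⟨t, ht, rfl⟩ := List.mem_map.1 hj
  simpa using (List.all_eq_true.1 h) t ht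

/-- The places of a diagram and of its images under the symmetries. -/
def orbit (d : RawDiagram 2) : List ℕ :=
  [index d, index (ghostDiagram d), index (flipDiagram d), index (flipDiagram (ghostDiagram d))]

/-- A coefficient and its images under the symmetries. -/
def polyOrbit (f : Poly) : List Poly :=
  [f, f.rename ghostVar, Poly.smul (-1) (f.rename flipVar),
    Poly.smul (-1) ((f.rename flipVar).rename ghostVar)]

/-- Two checks: each listed polynomial and its images under the symmetries are the coefficients at
the diagrams of the orbit, and all coefficients outside the orbits cancel. The symmetries are thus
confirmed by computation and need no separate theory. The sign of the reflected polynomials reflects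
the exchange of the two sides. -/
def checkComponents (f g : Comb) : Bool :=
  (components.all fun e =>
    ((orbit (ofArcs e.1 e.2.1)).zip (polyOrbit e.2.2)).all fun t =>
      Nat.blt t.1 117 && (f.diff g t.1 ++ Poly.smul (-1) t.2).isZero) &&
  ((List.range 117).all fun i => 
    (components.any fun e => (orbit (ofArcs e.1 e.2.1)).any (Nat.beq i)) || (f.diff g i).isZero)

set_option maxRecDepth 100000 in
theorem computation :
    ((Comb.mul (xComb .x) (kComb .k)).good && ((Comb.mul (xComb .x) (kComb .k)).mul (xComb .y)).good
    && lhsComb.good && (Comb.mul (kComb .l) (xComb .y)).good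
    && ((Comb.mul (kComb .l) (xComb .y)).mul (kComb .k)).good && rhsComb.good
    && checkComponents lhsComb rhsComb) = true := by decide +kernel

theorem Comb.diff_eval (ρ : Var → ℂ) (f g : Comb) (i : ℕ) :
    Poly.eval ρ (f.diff g i) = Poly.eval ρ (f.component i) - Poly.eval ρ (g.component i) := by
  rw [Comb.diff, Poly.eval_append, Poly.eval_smul]; push_cast; ring

theorem forall₂_exists {α β : Type} {R : α → β → Prop} {l : List α} {l' : List β}
    (h : List.Forall₂ R l l') : (∀ b ∈ l', ∃ a ∈ l, R a b) ∧ ∀ a ∈ l, ∃ b ∈ l', R a b := by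
  induction h with
  | nil => simp
  | cons h _ ih =>
    refine ⟨fun b hb => ?_, fun a ha => ?_⟩
    · rcases List.mem_cons.1 hb with rfl | hb
      · exact ⟨_, List.mem_cons_self, h⟩
      · obtain ⟨a, ha, hab⟩ := ih.1 b hb
        exact ⟨a, List.mem_cons_of_mem _ ha, hab⟩
    · rcases List.mem_cons.1 ha with rfl | ha
      · exact ⟨_, List.mem_cons_self, h⟩
      · obtain ⟨b, hb, hab⟩ := ih.2 a ha
        exact ⟨b, List.mem_cons_of_mem _ hb, hab⟩

theorem eval_lhsComb_eq_iff (ρ : Var → ℂ) :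
    (Comb.eval ρ (xComb .x) * Comb.eval ρ (kComb .k) * Comb.eval ρ (xComb .y)
        * Comb.eval ρ (kComb .l)
      = Comb.eval ρ (kComb .l) * Comb.eval ρ (xComb .y) * Comb.eval ρ (kComb .k)
        * Comb.eval ρ (xComb .x)) ↔
      ∀ e ∈ components, ∀ f ∈ polyOrbit e.2.2, Poly.eval ρ f = 0 := by
  have hc := computation
  simp only [Bool.and_eq_true] at hc
  obtain ⟨⟨⟨⟨⟨⟨h1, h2⟩, h3⟩, h4⟩, h5⟩, h6⟩, h7⟩ := hc
  rw [← Comb.mul_spec _ _ _ (Comb.good_spec h1), ← Comb.mul_spec _ _ _ (Comb.good_spec h2),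
    ← Comb.mul_spec _ _ _ (Comb.good_spec h3), ← Comb.mul_spec _ _ _ (Comb.good_spec h4),
    ← Comb.mul_spec _ _ _ (Comb.good_spec h5), ← Comb.mul_spec _ _ _ (Comb.good_spec h6),
    ← lhsComb, ← rhsComb, Comb.eval_eq_iff _ _ _ (Comb.good_spec h3) (Comb.good_spec h6)]
  simp only [checkComponents, Bool.and_eq_true, List.all_eq_true, List.mem_range, Bool.or_eq_true,
    List.any_eq_true] at h7
  obtain ⟨ha, hb⟩ := h7
  have hd : ∀ e ∈ components, List.Forall₂ (fun i f => i < 117 ∧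
      Poly.eval ρ (lhsComb.component i) - Poly.eval ρ (rhsComb.component i) = Poly.eval ρ f)
      (orbit (ofArcs e.1 e.2.1)) (polyOrbit e.2.2) := by
    intro e he
    refine List.forall₂_iff_zip.2 ⟨rfl, fun {i f} ht => ?_⟩
    obtain ⟨h8, h9⟩ := ha e he _ ht
    refine ⟨by simpa using h8, ?_⟩
    have := Poly.eval_eq_zero h9 ρ
    rw [Poly.eval_append, Comb.diff_eval, Poly.eval_smul] at this
    push_cast at this
    linear_combination this
  constructor
  · intro h e he f hf
    obtain ⟨i, -, h8, h9⟩ := (forall₂_exists (hd e he)).1 f hf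
    rw [← h9, h _ h8, sub_self]
  · intro h i hi
    -- A diagram either lies in the orbit of a listed one, or its coefficients on the two sides
    -- agree identically.
    rcases hb i hi with ⟨e, he, j, hj, hij⟩ | h0
    · obtain rfl := Nat.eq_of_beq_eq_true hij
      obtain ⟨f, hf, -, h9⟩ := (forall₂_exists (hd e he)).2 i hj
      rw [h e he _ hf] at h9
      exact sub_eq_zero.1 h9
    · have := Poly.eval_eq_zero h0 ρ
      rw [Comb.diff_eval] at this
      exact sub_eq_zero.1 this

/-! ### The face operators as symbolic combinations -/

/-- The coefficients of the bulk face operator. -/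
noncomputable def faceCoeff (φ u : ℂ) : ℕ → ℂ
  | 0 => Complex.sin (2 * φ) * Complex.sin (3 * φ) + Complex.sin u * Complex.sin (3 * φ - u)
  | 1 => Complex.sin (2 * φ) * Complex.sin (3 * φ - u)
  | 2 => Complex.sin (2 * φ) * Complex.sin u
  | 3 => Complex.sin u * Complex.sin (3 * φ - u)
  | 4 => Complex.sin (2 * φ - u) * Complex.sin (3 * φ - u)
  | _ => -(Complex.sin u * Complex.sin (φ - u))

def BoundaryCoeffs.get (k : BoundaryCoeffs) : ℕ → ℂ
  | 0 => k.a₁ | 1 => k.b₁ | 2 => k.b₂ | 3 => k.b₃ | 4 => k.b₄ | 5 => k.b₅ | 6 => k.b₆ | 7 => k.b₇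
  | 8 => k.b₈ | 9 => k.a₂ | _ => 0

/-- The coefficients after adding a ghost at both ends of the boundary. -/
def BoundaryCoeffs.ghost (k : BoundaryCoeffs) : BoundaryCoeffs :=
  ⟨k.a₁, k.a₂, k.b₃, k.b₄, k.b₁, k.b₂, k.b₆, k.b₅, k.b₈, k.b₇⟩

/-- The coefficients after a reflection from left to right. -/
def BoundaryCoeffs.flip (k : BoundaryCoeffs) : BoundaryCoeffs :=
  ⟨k.a₁, k.a₂, k.b₁, k.b₄, k.b₃, k.b₂, k.b₇, k.b₈, k.b₅, k.b₆⟩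

def assign (β α₁ α₂ α₃ : ℂ) (x y : ℕ → ℂ) (k l : BoundaryCoeffs) : Var → ℂ
  | .par 0 => β
  | .par 1 => α₁
  | .par 2 => α₂
  | .par _ => α₃
  | .x i => x i
  | .y i => y i
  | .k i => k.get i
  | .l i => l.get i

theorem get_ghost (k : BoundaryCoeffs) (i : ℕ) : k.get (ghostIndex i) = k.ghost.get i := by
  match i with
  | 0 | 1 | 2 | 3 | 4 | 5 | 6 | 7 | 8 | 9 => rfl
  | i + 10 => rfl

theorem get_flip (k : BoundaryCoeffs) (i : ℕ) : k.get (flipIndex i) = k.flip.get i := by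
  match i with
  | 0 | 1 | 2 | 3 | 4 | 5 | 6 | 7 | 8 | 9 => rfl
  | i + 10 => rfl

theorem assign_ghost (β α₁ α₂ α₃ : ℂ) (x y : ℕ → ℂ) (k l : BoundaryCoeffs) :
    assign β α₁ α₂ α₃ x y k l ∘ ghostVar = assign β α₂ α₁ α₃ x y k.ghost l.ghost := by
  funext v
  match v with
  | .par 0 | .par 1 | .par 2 | .x i | .y i => rfl
  | .par (i + 3) => rfl
  | .k i => exact get_ghost k i
  | .l i => exact get_ghost l i

theorem assign_flip (β α₁ α₂ α₃ : ℂ) (x y : ℕ → ℂ) (k l : BoundaryCoeffs) :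
    assign β α₁ α₂ α₃ x y k l ∘ flipVar = assign β α₁ α₂ α₃ x y k.flip l.flip := by
  funext v
  match v with
  | .par 0 | .par 1 | .par 2 | .x i | .y i => rfl
  | .par (i + 3) => rfl
  | .k i => exact get_flip k i
  | .l i => exact get_flip l i

theorem eval_cons_index (ρ : Var → ℂ) (p : Poly) {d : RawDiagram 2} (hd : d.Valid)
    (h : index d < 117) (f : Comb) :
    Comb.eval ρ ((p, index d) :: f) = Poly.eval ρ p • diag ⟨d, hd⟩ + Comb.eval ρ f := by
  rw [Comb.eval_cons, basisElt_index ρ hd h]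

theorem eval_var (ρ : Var → ℂ) (v : Var) : Poly.eval ρ [(1, [v])] = ρ v := by
  simp [Poly.eval, Mono.eval]

theorem eval_nil (ρ : Var → ℂ) : Comb.eval ρ [] = 0 := rfl

theorem eval_dashedComb (ρ : Var → ℂ) (v : Var) (l : List (Node 2 × Node 2)) (w : List (Item 2))
    (h₁ : (ofArcs ((left 1, right 1) :: l) w).Valid) (h₀ : (ofArcs l w).Valid)
    (i₁ : index (ofArcs ((left 1, right 1) :: l) w) < 117) (i₀ : index (ofArcs l w) < 117) :
    Comb.eval ρ (dashedComb [(1, [v])] l w) = ρ v • dashed l w h₁ h₀ := by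
  rw [dashedComb, eval_cons_index ρ _ h₁ i₁, eval_cons_index ρ _ h₀ i₀, eval_nil, eval_var, dashed,
    smul_add, add_zero]

theorem eval_xComb (β α₁ α₂ α₃ φ u : ℂ) (x y : ℕ → ℂ) (k l : BoundaryCoeffs) (v : ℕ → Var)
    (hv : ∀ i, assign β α₁ α₂ α₃ x y k l (v i) = faceCoeff φ u i) :
    Comb.eval (assign β α₁ α₂ α₃ x y k l) (xComb v) = bulkFace φ u := by
  rw [xComb, eval_cons_index _ _ (by decide) (by decide +kernel),
    eval_cons_index _ _ (by decide) (by decide +kernel),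
    eval_cons_index _ _ (by decide) (by decide +kernel),
    eval_cons_index _ _ (by decide) (by decide +kernel),
    eval_cons_index _ _ (by decide) (by decide +kernel),
    eval_cons_index _ _ (by decide) (by decide +kernel),
    eval_cons_index _ _ (by decide) (by decide +kernel),
    eval_cons_index _ _ (by decide) (by decide +kernel),
    eval_cons_index _ _ (by decide) (by decide +kernel), eval_nil]
  simp only [eval_var, hv, faceCoeff, bulkFace, smul_add, add_zero, add_assoc]

theorem eval_kComb (β α₁ α₂ α₃ : ℂ) (x y : ℕ → ℂ) (k l m : BoundaryCoeffs) (v : ℕ → Var)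
    (hv : ∀ i, assign β α₁ α₂ α₃ x y k l (v i) = m.get i) :
    Comb.eval (assign β α₁ α₂ α₃ x y k l) (kComb v) = boundaryFace m := by
  simp only [kComb, Comb.eval_append]
  rw [eval_dashedComb _ _ _ _ (by decide) (by decide) (by decide +kernel) (by decide +kernel),
    eval_dashedComb _ _ _ _ (by decide) (by decide) (by decide +kernel) (by decide +kernel),
    eval_dashedComb _ _ _ _ (by decide) (by decide) (by decide +kernel) (by decide +kernel),
    eval_dashedComb _ _ _ _ (by decide) (by decide) (by decide +kernel) (by decide +kernel),
    eval_dashedComb _ _ _ _ (by decide) (by decide) (by decide +kernel) (by decide +kernel),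
    eval_dashedComb _ _ _ _ (by decide) (by decide) (by decide +kernel) (by decide +kernel),
    eval_dashedComb _ _ _ _ (by decide) (by decide) (by decide +kernel) (by decide +kernel),
    eval_dashedComb _ _ _ _ (by decide) (by decide) (by decide +kernel) (by decide +kernel),
    eval_dashedComb _ _ _ _ (by decide) (by decide) (by decide +kernel) (by decide +kernel),
    eval_dashedComb _ _ _ _ (by decide) (by decide) (by decide +kernel) (by decide +kernel)]
  simp only [hv, BoundaryCoeffs.get]
  rfl

/-- A quarter of the components of the boundary Yang-Baxter equation; the others follow from the
symmetries. A field is named after its diagram: `c` for strings between nodes and `w` for the word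
on the boundary. -/
structure Quarter (β α₁ α₂ α₃ : ℂ) (x y : ℕ → ℂ) (k l : BoundaryCoeffs) : Prop where
  wL1L2R2gR1g : k.b₁ * l.b₄ * x 4 * y 5 - k.b₄ * l.b₁ * x 4 * y 5 = 0
  wL1L2gR2R1g : k.b₁ * l.b₃ * x 4 * y 5 - k.b₃ * l.b₁ * x 4 * y 5 = 0
  wL1L2gR2gR1 : k.b₁ * l.b₂ * x 4 * y 5 - k.b₂ * l.b₁ * x 4 * y 5 = 0
  wL1gL2R2gR1 : k.b₄ * l.b₂ * x 4 * y 5 - k.b₂ * l.b₄ * x 4 * y 5 = 0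
  wL1L2R2g : k.b₁ * l.b₆ * x 4 * y 5 - k.b₇ * l.b₁ * x 3 * y 2 - k.b₃ * l.b₆ * x 3 * y 3
    - k.b₆ * l.b₁ * x 1 * y 5 = 0
  wL1L2gR2 : k.b₁ * l.b₅ * x 4 * y 5 - k.b₈ * l.b₁ * x 3 * y 2 - k.b₂ * l.b₆ * x 3 * y 3
    - k.b₅ * l.b₁ * x 1 * y 5 = 0
  wL1gL2R2 : k.b₄ * l.b₅ * x 4 * y 5 - k.b₈ * l.b₄ * x 3 * y 2 - k.b₁ * l.b₆ * x 3 * y 3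
    - k.b₅ * l.b₄ * x 1 * y 5 = 0
  wL1gL2gR2g : k.b₄ * l.b₆ * x 4 * y 5 - k.b₇ * l.b₄ * x 3 * y 2 - k.b₄ * l.b₆ * x 3 * y 3
    - k.b₆ * l.b₄ * x 1 * y 5 = 0
  wL2R2 : k.b₇ * l.b₅ * x 1 * y 5 + k.b₆ * l.b₅ * x 3 * y 2 - k.b₈ * l.b₇ * x 3 * y 2
    - k.b₅ * l.b₇ * x 1 * y 5 = 0
  wL2gR2g : k.b₇ * l.b₆ * x 1 * y 5 + k.b₆ * l.b₆ * x 3 * y 2 - k.b₇ * l.b₇ * x 3 * y 2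
    - k.b₆ * l.b₇ * x 1 * y 5 = 0
  wL1L2R1g : k.b₁ * l.b₇ * x 4 * y 2 + k.b₆ * l.b₃ * x 4 * y 3 - k.b₇ * l.b₁ * x 1 * y 2
    - k.b₃ * l.b₆ * x 1 * y 3 - k.b₆ * l.b₁ * x 3 * y 5 = 0
  wL1L2gR1 : k.b₁ * l.b₈ * x 4 * y 2 + k.b₆ * l.b₂ * x 4 * y 3 - k.b₈ * l.b₁ * x 1 * y 2
    - k.b₂ * l.b₆ * x 1 * y 3 - k.b₅ * l.b₁ * x 3 * y 5 = 0
  wL1R2gR1 : k.b₁ * l.b₈ * x 1 * y 3 + k.b₆ * l.b₂ * x 1 * y 2 + k.b₇ * l.b₂ * x 3 * y 5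
    - k.b₈ * l.b₁ * x 4 * y 3 - k.b₂ * l.b₆ * x 4 * y 2 = 0
  wL1gL2gR1g : k.b₄ * l.b₇ * x 4 * y 2 + k.b₆ * l.b₄ * x 4 * y 3 - k.b₇ * l.b₄ * x 1 * y 2
    - k.b₄ * l.b₆ * x 1 * y 3 - k.b₆ * l.b₄ * x 3 * y 5 = 0
  cL1R2_wR1g : k.a₁ * l.b₇ * x 1 * y 3 + k.a₂ * l.b₇ * x 3 * y 1 + k.b₇ * l.a₁ * x 3 * y 4
    + α₁ * k.b₇ * l.b₃ * x 3 * y 4 + α₃ * k.b₇ * l.b₄ * x 3 * y 4 + α₃ * k.b₈ * l.b₃ * x 3 * y 4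
    + α₂ * k.b₈ * l.b₄ * x 3 * y 4 - k.b₇ * l.a₁ * x 4 * y 3 = 0
  cL1R2_w : k.a₁ * l.a₂ * x 1 * y 3 + k.a₂ * l.a₂ * x 3 * y 1 + α₁ * k.b₇ * l.b₅ * x 3 * y 4
    + α₃ * k.b₇ * l.b₆ * x 3 * y 4 + α₃ * k.b₈ * l.b₅ * x 3 * y 4 + α₂ * k.b₈ * l.b₆ * x 3 * y 4
    - k.a₁ * l.a₁ * x 3 * y 1 - k.a₂ * l.a₁ * x 1 * y 3 = 0
  cL2R2_wL1R1 : α₃ * k.b₁ * l.b₂ * x 4 * y 4 + α₃ * k.b₄ * l.b₁ * x 4 * y 4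
    + α₁ * k.b₄ * l.b₂ * x 4 * y 4 + k.b₆ * l.b₈ * x 4 * y 1 - α₃ * k.b₂ * l.b₁ * x 4 * y 4
    - α₃ * k.b₁ * l.b₄ * x 4 * y 4 - α₁ * k.b₂ * l.b₄ * x 4 * y 4 - k.b₈ * l.b₆ * x 4 * y 1 = 0
  cL2R2_wL1gR1g : α₃ * k.b₁ * l.b₃ * x 4 * y 4 + α₂ * k.b₁ * l.b₄ * x 4 * y 4
    + α₁ * k.b₄ * l.b₃ * x 4 * y 4 + k.b₆ * l.b₇ * x 4 * y 1 - α₃ * k.b₃ * l.b₁ * x 4 * y 4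
    - α₂ * k.b₄ * l.b₁ * x 4 * y 4 - α₁ * k.b₃ * l.b₄ * x 4 * y 4 - k.b₇ * l.b₆ * x 4 * y 1 = 0
  cL2R2_w : α₁ * k.b₇ * l.b₅ * x 1 * y 4 + α₃ * k.b₇ * l.b₆ * x 1 * y 4
    + α₃ * k.b₈ * l.b₅ * x 1 * y 4 + α₂ * k.b₈ * l.b₆ * x 1 * y 4 - α₁ * k.b₅ * l.b₇ * x 1 * y 4
    - α₃ * k.b₆ * l.b₇ * x 1 * y 4 - α₃ * k.b₅ * l.b₈ * x 1 * y 4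
    - α₂ * k.b₆ * l.b₈ * x 1 * y 4 = 0
  wL1R1 : α₃ * k.b₁ * l.b₂ * x 1 * y 1 + α₃ * k.b₄ * l.b₁ * x 1 * y 1
    + α₁ * k.b₄ * l.b₂ * x 1 * y 1 + k.b₆ * l.b₈ * x 1 * y 0 + k.b₇ * l.b₈ * x 3 * y 2
    - α₃ * k.b₂ * l.b₁ * x 1 * y 1 - α₃ * k.b₁ * l.b₄ * x 1 * y 1 - α₁ * k.b₂ * l.b₄ * x 1 * y 1
    - k.b₈ * l.b₆ * x 1 * y 0 - k.b₅ * l.b₆ * x 3 * y 2 = 0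
  wL1gR1g : α₃ * k.b₁ * l.b₃ * x 1 * y 1 + α₂ * k.b₁ * l.b₄ * x 1 * y 1
    + α₁ * k.b₄ * l.b₃ * x 1 * y 1 + k.b₆ * l.b₇ * x 1 * y 0 + k.b₇ * l.b₇ * x 3 * y 2
    - α₃ * k.b₃ * l.b₁ * x 1 * y 1 - α₂ * k.b₄ * l.b₁ * x 1 * y 1 - α₁ * k.b₃ * l.b₄ * x 1 * y 1
    - k.b₇ * l.b₆ * x 1 * y 0 - k.b₆ * l.b₆ * x 3 * y 2 = 0
  wL1gR2g : k.b₄ * l.a₂ * x 1 * y 3 + k.b₇ * l.b₆ * x 3 * y 5 - k.b₄ * l.a₁ * x 3 * y 1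
    - α₃ * k.b₃ * l.b₁ * x 3 * y 1 - α₂ * k.b₄ * l.b₁ * x 3 * y 1 - k.a₁ * l.b₄ * x 3 * y 1
    - α₁ * k.b₃ * l.b₄ * x 3 * y 1 - α₃ * k.b₄ * l.b₄ * x 3 * y 1 - k.b₇ * l.b₆ * x 3 * y 0
    - k.a₂ * l.b₄ * x 1 * y 3 = 0
  wL1R2 : k.b₁ * l.a₂ * x 1 * y 3 + k.b₆ * l.b₅ * x 1 * y 2 + k.b₇ * l.b₅ * x 3 * y 5
    - k.b₁ * l.a₁ * x 3 * y 1 - k.a₁ * l.b₁ * x 3 * y 1 - α₂ * k.b₁ * l.b₁ * x 3 * y 1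
    - α₃ * k.b₂ * l.b₁ * x 3 * y 1 - α₃ * k.b₁ * l.b₄ * x 3 * y 1 - α₁ * k.b₂ * l.b₄ * x 3 * y 1
    - k.b₈ * l.b₆ * x 3 * y 0 - k.a₂ * l.b₁ * x 1 * y 3 - k.b₅ * l.b₆ * x 1 * y 2 = 0
  cL2R2_wL1g : k.a₁ * l.b₆ * x 4 * y 4 + α₃ * k.b₁ * l.b₅ * x 4 * y 4
    + α₂ * k.b₁ * l.b₆ * x 4 * y 4 + α₁ * k.b₄ * l.b₅ * x 4 * y 4 + α₃ * k.b₄ * l.b₆ * x 4 * y 4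
    + k.b₆ * l.a₂ * x 4 * y 1 - k.b₆ * l.a₁ * x 1 * y 4 - α₃ * k.b₅ * l.b₁ * x 1 * y 4
    - α₂ * k.b₆ * l.b₁ * x 1 * y 4 - α₁ * k.b₅ * l.b₄ * x 1 * y 4 - α₃ * k.b₆ * l.b₄ * x 1 * y 4
    - k.a₂ * l.b₆ * x 1 * y 1 - k.a₁ * l.b₆ * x 3 * y 3 = 0
  cL1L2_wR2R1 : k.a₂ * l.b₁ * x 2 * y 2 + k.a₁ * l.b₁ * x 4 * y 5 + k.a₁ * l.b₁ * x 5 * y 4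
    + β * k.a₁ * l.b₁ * x 5 * y 5 + α₁ * k.b₁ * l.b₁ * x 5 * y 5 + α₃ * k.b₂ * l.b₁ * x 5 * y 5
    + α₂ * k.b₃ * l.b₁ * x 5 * y 5 + α₃ * k.b₄ * l.b₁ * x 5 * y 5 + k.b₇ * l.b₈ * x 2 * y 3
    + k.b₆ * l.b₈ * x 5 * y 1 + k.b₁ * l.a₁ * x 5 * y 4 + α₂ * k.b₁ * l.b₁ * x 5 * y 4
    + α₃ * k.b₁ * l.b₂ * x 5 * y 4 + α₃ * k.b₄ * l.b₁ * x 5 * y 4 + α₁ * k.b₄ * l.b₂ * x 5 * y 4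
    - k.b₁ * l.a₁ * x 4 * y 5 = 0
  cL1L2_wR2gR1g : k.a₂ * l.b₄ * x 2 * y 2 + k.a₁ * l.b₄ * x 4 * y 5 + k.a₁ * l.b₄ * x 5 * y 4
    + β * k.a₁ * l.b₄ * x 5 * y 5 + α₁ * k.b₁ * l.b₄ * x 5 * y 5 + α₃ * k.b₂ * l.b₄ * x 5 * y 5
    + α₂ * k.b₃ * l.b₄ * x 5 * y 5 + α₃ * k.b₄ * l.b₄ * x 5 * y 5 + k.b₇ * l.b₇ * x 2 * y 3
    + k.b₆ * l.b₇ * x 5 * y 1 + α₃ * k.b₁ * l.b₃ * x 5 * y 4 + α₂ * k.b₁ * l.b₄ * x 5 * y 4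
    + k.b₄ * l.a₁ * x 5 * y 4 + α₁ * k.b₄ * l.b₃ * x 5 * y 4 + α₃ * k.b₄ * l.b₄ * x 5 * y 4
    - k.b₄ * l.a₁ * x 4 * y 5 = 0
  cL1L2_wR2g : k.a₂ * l.b₆ * x 2 * y 2 + k.a₁ * l.b₆ * x 4 * y 5 + k.a₁ * l.b₆ * x 5 * y 4
    + β * k.a₁ * l.b₆ * x 5 * y 5 + α₁ * k.b₁ * l.b₆ * x 5 * y 5 + α₃ * k.b₂ * l.b₆ * x 5 * y 5
    + α₂ * k.b₃ * l.b₆ * x 5 * y 5 + α₃ * k.b₄ * l.b₆ * x 5 * y 5 + k.b₇ * l.a₂ * x 2 * y 3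
    + k.b₆ * l.a₂ * x 5 * y 1 + α₃ * k.b₁ * l.b₅ * x 5 * y 4 + α₂ * k.b₁ * l.b₆ * x 5 * y 4
    + α₁ * k.b₄ * l.b₅ * x 5 * y 4 + α₃ * k.b₄ * l.b₆ * x 5 * y 4 - k.b₇ * l.a₁ * x 3 * y 2
    - k.b₆ * l.a₁ * x 1 * y 5 = 0
  wL1L2 : k.b₁ * l.a₂ * x 4 * y 2 + k.b₆ * l.b₅ * x 4 * y 3 - k.b₁ * l.a₁ * x 2 * y 4
    - k.a₁ * l.b₁ * x 2 * y 4 - α₂ * k.b₁ * l.b₁ * x 2 * y 4 - α₃ * k.b₂ * l.b₁ * x 2 * y 4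
    - α₃ * k.b₁ * l.b₄ * x 2 * y 4 - α₁ * k.b₂ * l.b₄ * x 2 * y 4 - k.b₈ * l.b₆ * x 2 * y 1
    - k.a₂ * l.b₁ * x 0 * y 2 - k.b₅ * l.b₆ * x 0 * y 3 - β * k.a₁ * l.b₁ * x 2 * y 5
    - α₁ * k.b₁ * l.b₁ * x 2 * y 5 - α₃ * k.b₂ * l.b₁ * x 2 * y 5 - α₂ * k.b₃ * l.b₁ * x 2 * y 5
    - α₃ * k.b₄ * l.b₁ * x 2 * y 5 = 0
  wL1gL2g : k.b₄ * l.a₂ * x 4 * y 2 + k.b₆ * l.b₆ * x 4 * y 3 - k.b₄ * l.a₁ * x 2 * y 4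
    - α₃ * k.b₃ * l.b₁ * x 2 * y 4 - α₂ * k.b₄ * l.b₁ * x 2 * y 4 - k.a₁ * l.b₄ * x 2 * y 4
    - α₁ * k.b₃ * l.b₄ * x 2 * y 4 - α₃ * k.b₄ * l.b₄ * x 2 * y 4 - k.b₇ * l.b₆ * x 2 * y 1
    - k.a₂ * l.b₄ * x 0 * y 2 - k.b₆ * l.b₆ * x 0 * y 3 - β * k.a₁ * l.b₄ * x 2 * y 5
    - α₁ * k.b₁ * l.b₄ * x 2 * y 5 - α₃ * k.b₂ * l.b₄ * x 2 * y 5 - α₂ * k.b₃ * l.b₄ * x 2 * y 5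
    - α₃ * k.b₄ * l.b₄ * x 2 * y 5 = 0
  w : α₁ * k.b₇ * l.b₅ * x 0 * y 1 + α₁ * k.b₆ * l.b₅ * x 2 * y 3 + α₃ * k.b₇ * l.b₆ * x 0 * y 1
    + α₃ * k.b₆ * l.b₆ * x 2 * y 3 + α₃ * k.b₈ * l.b₅ * x 0 * y 1 + α₃ * k.b₅ * l.b₅ * x 2 * y 3
    + α₂ * k.b₈ * l.b₆ * x 0 * y 1 + α₂ * k.b₅ * l.b₆ * x 2 * y 3 - α₁ * k.b₅ * l.b₇ * x 0 * y 1
    - α₃ * k.b₆ * l.b₇ * x 0 * y 1 - α₃ * k.b₅ * l.b₈ * x 0 * y 1 - α₂ * k.b₆ * l.b₈ * x 0 * y 1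
    - α₁ * k.b₈ * l.b₇ * x 2 * y 3 - α₃ * k.b₈ * l.b₈ * x 2 * y 3 - α₂ * k.b₇ * l.b₈ * x 2 * y 3
    - α₃ * k.b₇ * l.b₇ * x 2 * y 3 = 0
  cL1L2_wR1g : k.a₂ * l.b₇ * x 2 * y 0 + k.a₁ * l.b₇ * x 4 * y 2 + β * k.a₁ * l.b₇ * x 5 * y 2
    + α₁ * k.b₁ * l.b₇ * x 5 * y 2 + α₃ * k.b₂ * l.b₇ * x 5 * y 2 + α₂ * k.b₃ * l.b₇ * x 5 * y 2
    + α₃ * k.b₄ * l.b₇ * x 5 * y 2 + k.b₇ * l.a₁ * x 2 * y 1 + k.b₆ * l.a₁ * x 5 * y 3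
    + α₁ * k.b₇ * l.b₃ * x 2 * y 1 + α₁ * k.b₆ * l.b₃ * x 5 * y 3 + α₃ * k.b₇ * l.b₄ * x 2 * y 1
    + α₃ * k.b₆ * l.b₄ * x 5 * y 3 + α₃ * k.b₈ * l.b₃ * x 2 * y 1 + α₃ * k.b₅ * l.b₃ * x 5 * y 3
    + α₂ * k.b₈ * l.b₄ * x 2 * y 1 + α₂ * k.b₅ * l.b₄ * x 5 * y 3 - k.b₇ * l.a₁ * x 1 * y 2
    - k.b₆ * l.a₁ * x 3 * y 5 = 0
  wL2g : k.a₂ * l.b₆ * x 1 * y 3 + k.a₁ * l.b₆ * x 3 * y 1 + k.b₇ * l.a₂ * x 1 * y 2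
    + k.b₆ * l.a₂ * x 3 * y 0 + α₃ * k.b₁ * l.b₅ * x 3 * y 1 + α₂ * k.b₁ * l.b₆ * x 3 * y 1
    + α₁ * k.b₄ * l.b₅ * x 3 * y 1 + α₃ * k.b₄ * l.b₆ * x 3 * y 1 - k.b₇ * l.a₂ * x 2 * y 1
    - k.a₁ * l.b₇ * x 2 * y 4 - α₁ * k.b₃ * l.b₇ * x 2 * y 4 - α₃ * k.b₄ * l.b₇ * x 2 * y 4
    - α₃ * k.b₃ * l.b₈ * x 2 * y 4 - α₂ * k.b₄ * l.b₈ * x 2 * y 4 - k.b₆ * l.a₂ * x 0 * y 3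
    - k.a₂ * l.b₇ * x 0 * y 2 - β * k.a₁ * l.b₇ * x 2 * y 5 - α₁ * k.b₁ * l.b₇ * x 2 * y 5
    - α₃ * k.b₂ * l.b₇ * x 2 * y 5 - α₂ * k.b₃ * l.b₇ * x 2 * y 5
    - α₃ * k.b₄ * l.b₇ * x 2 * y 5 = 0
  cL1L2_w : k.a₂ * l.a₂ * x 2 * y 0 + k.a₁ * l.a₂ * x 4 * y 2 + β * k.a₁ * l.a₂ * x 5 * y 2
    + α₁ * k.b₁ * l.a₂ * x 5 * y 2 + α₃ * k.b₂ * l.a₂ * x 5 * y 2 + α₂ * k.b₃ * l.a₂ * x 5 * y 2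
    + α₃ * k.b₄ * l.a₂ * x 5 * y 2 + α₁ * k.b₇ * l.b₅ * x 2 * y 1 + α₁ * k.b₆ * l.b₅ * x 5 * y 3
    + α₃ * k.b₇ * l.b₆ * x 2 * y 1 + α₃ * k.b₆ * l.b₆ * x 5 * y 3 + α₃ * k.b₈ * l.b₅ * x 2 * y 1
    + α₃ * k.b₅ * l.b₅ * x 5 * y 3 + α₂ * k.b₈ * l.b₆ * x 2 * y 1 + α₂ * k.b₅ * l.b₆ * x 5 * y 3
    - k.a₂ * l.a₁ * x 0 * y 2 - k.a₁ * l.a₁ * x 2 * y 4 - β * k.a₁ * l.a₁ * x 2 * y 5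
    - α₁ * k.b₁ * l.a₁ * x 2 * y 5 - α₃ * k.b₂ * l.a₁ * x 2 * y 5 - α₂ * k.b₃ * l.a₁ * x 2 * y 5
    - α₃ * k.b₄ * l.a₁ * x 2 * y 5 = 0
  wL1g : k.a₁ * l.b₆ * x 1 * y 1 + k.a₂ * l.b₆ * x 3 * y 3 + α₃ * k.b₁ * l.b₅ * x 1 * y 1
    + α₂ * k.b₁ * l.b₆ * x 1 * y 1 + α₁ * k.b₄ * l.b₅ * x 1 * y 1 + α₃ * k.b₄ * l.b₆ * x 1 * y 1
    + k.b₆ * l.a₂ * x 1 * y 0 + k.b₇ * l.a₂ * x 3 * y 2 - k.b₆ * l.a₁ * x 0 * y 1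
    - α₃ * k.b₅ * l.b₁ * x 0 * y 1 - α₂ * k.b₆ * l.b₁ * x 0 * y 1 - α₁ * k.b₅ * l.b₄ * x 0 * y 1
    - α₃ * k.b₆ * l.b₄ * x 0 * y 1 - k.a₂ * l.b₆ * x 0 * y 0 - k.b₇ * l.a₁ * x 2 * y 3
    - α₂ * k.b₇ * l.b₁ * x 2 * y 3 - α₂ * k.b₃ * l.b₆ * x 2 * y 2 - α₃ * k.b₈ * l.b₁ * x 2 * y 3
    - α₃ * k.b₂ * l.b₆ * x 2 * y 2 - α₃ * k.b₇ * l.b₄ * x 2 * y 3 - α₃ * k.b₄ * l.b₆ * x 2 * y 2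
    - α₁ * k.b₈ * l.b₄ * x 2 * y 3 - α₁ * k.b₁ * l.b₆ * x 2 * y 2
    - β * k.a₁ * l.b₆ * x 2 * y 2 = 0

theorem quarter_iff (β α₁ α₂ α₃ : ℂ) (x y : ℕ → ℂ) (k l : BoundaryCoeffs) :
    Quarter β α₁ α₂ α₃ x y k l ↔
      ∀ e ∈ components, Poly.eval (assign β α₁ α₂ α₃ x y k l) e.2.2 = 0 := by
  simp only [components, List.forall_mem_cons, Poly.eval, Mono.eval, List.map_cons, List.map_nil,
    List.sum_cons, List.sum_nil, List.prod_cons, List.prod_nil, assign, BoundaryCoeffs.get]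
  constructor
  · intro h
    refine ⟨?_, ?_, ?_, ?_, ?_, ?_, ?_, ?_, ?_, ?_, ?_, ?_, ?_, ?_, ?_, ?_, ?_, ?_, ?_, ?_, ?_, ?_, ?_, ?_, ?_, ?_, ?_, ?_, ?_, ?_, ?_, ?_, ?_, ?_,
      by simp⟩
    · linear_combination h.wL1L2R2gR1g
    · linear_combination h.wL1L2gR2R1g
    · linear_combination h.wL1L2gR2gR1
    · linear_combination h.wL1gL2R2gR1
    · linear_combination h.wL1L2R2g
    · linear_combination h.wL1L2gR2
    · linear_combination h.wL1gL2R2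
    · linear_combination h.wL1gL2gR2g
    · linear_combination h.wL2R2
    · linear_combination h.wL2gR2g
    · linear_combination h.wL1L2R1g
    · linear_combination h.wL1L2gR1
    · linear_combination h.wL1R2gR1
    · linear_combination h.wL1gL2gR1g
    · linear_combination h.cL1R2_wR1g
    · linear_combination h.cL1R2_w
    · linear_combination h.cL2R2_wL1R1
    · linear_combination h.cL2R2_wL1gR1g
    · linear_combination h.cL2R2_w
    · linear_combination h.wL1R1
    · linear_combination h.wL1gR1g
    · linear_combination h.wL1gR2g
    · linear_combination h.wL1R2
    · linear_combination h.cL2R2_wL1g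
    · linear_combination h.cL1L2_wR2R1
    · linear_combination h.cL1L2_wR2gR1g
    · linear_combination h.cL1L2_wR2g
    · linear_combination h.wL1L2
    · linear_combination h.wL1gL2g
    · linear_combination h.w
    · linear_combination h.cL1L2_wR1g
    · linear_combination h.wL2g
    · linear_combination h.cL1L2_w
    · linear_combination h.wL1g
  · rintro ⟨h0, h1, h2, h3, h4, h5, h6, h7, h8, h9, h10, h11, h12, h13, h14, h15, h16, h17, h18, h19, h20, h21, h22, h23, h24, h25, h26, h27, h28, h29, h30, h31, h32, h33,
      -⟩
    constructor
    · linear_combination h0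
    · linear_combination h1
    · linear_combination h2
    · linear_combination h3
    · linear_combination h4
    · linear_combination h5
    · linear_combination h6
    · linear_combination h7
    · linear_combination h8
    · linear_combination h9
    · linear_combination h10
    · linear_combination h11
    · linear_combination h12
    · linear_combination h13
    · linear_combination h14
    · linear_combination h15
    · linear_combination h16
    · linear_combination h17
    · linear_combination h18
    · linear_combination h19
    · linear_combination h20
    · linear_combination h21
    · linear_combination h22
    · linear_combination h23
    · linear_combination h24
    · linear_combination h25
    · linear_combination h26
    · linear_combination h27
    · linear_combination h28
    · linear_combination h29
    · linear_combination h30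
    · linear_combination h31
    · linear_combination h32
    · linear_combination h33

/-- The boundary Yang-Baxter equation in components. -/
theorem bybe_iff (φ α₁ α₂ α₃ : ℂ) (K : ℂ → BoundaryCoeffs) (u v : ℂ) :
    BYBE φ α₁ α₂ α₃ K u v ↔
      Quarter (-2 * Complex.cos (4 * φ)) α₁ α₂ α₃ (faceCoeff φ (u - v)) (faceCoeff φ (u + v))
        (K u) (K v) ∧
      Quarter (-2 * Complex.cos (4 * φ)) α₂ α₁ α₃ (faceCoeff φ (u - v)) (faceCoeff φ (u + v))
        (K u).ghost (K v).ghost ∧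
      Quarter (-2 * Complex.cos (4 * φ)) α₁ α₂ α₃ (faceCoeff φ (u - v)) (faceCoeff φ (u + v))
        (K u).flip (K v).flip ∧
      Quarter (-2 * Complex.cos (4 * φ)) α₂ α₁ α₃ (faceCoeff φ (u - v)) (faceCoeff φ (u + v))
        (K u).ghost.flip (K v).ghost.flip := by
  have h := eval_lhsComb_eq_iff (assign (-2 * Complex.cos (4 * φ)) α₁ α₂ α₃ (faceCoeff φ (u - v))
    (faceCoeff φ (u + v)) (K u) (K v))
  rw [eval_xComb _ _ _ _ φ (u - v) (faceCoeff φ (u - v)) (faceCoeff φ (u + v)) (K u) (K v) .x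
      fun i => rfl,
    eval_xComb _ _ _ _ φ (u + v) (faceCoeff φ (u - v)) (faceCoeff φ (u + v)) (K u) (K v) .y
      fun i => rfl,
    eval_kComb _ _ _ _ _ _ _ _ (K u) .k fun i => rfl,
    eval_kComb _ _ _ _ _ _ _ _ (K v) .l fun i => rfl] at h
  refine Iff.trans h ?_
  simp only [polyOrbit, List.forall_mem_cons, List.not_mem_nil, false_imp_iff, implies_true,
    and_true, Poly.eval_smul, Poly.eval_rename, assign_ghost, assign_flip, quarter_iff,
    Int.cast_neg, Int.cast_one, neg_mul, one_mul, neg_eq_zero, forall_and]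

/-! ### Boundary faces of rank one: the scalar relations behind solutions I and II -/

/-- The components of the boundary Yang-Baxter equation for boundary faces with the coefficients
`a₁ = f`, `a₂ = g`, `(b₅, b₆, b₇, b₈) = D (ν, μ, μ, ν)` and
`(b₁, b₂, b₃, b₄) = S (μν, ν², μν, μ²)`. -/
structure RankOnePair (β M : ℂ) (x y : ℕ → ℂ) (f g S D F G T E : ℂ) : Prop where
  top_nested : - D * T * x 1 * y 5 - D * T * x 3 * y 2 - E * S * x 3 * y 3
    + E * S * x 4 * y 5 = 0
  top_side : - D * T * x 1 * y 2 - D * T * x 3 * y 5 + D * T * x 4 * y 3 - E * S * x 1 * y 3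
    + E * S * x 4 * y 2 = 0
  string_end : D * F * x 3 * y 4 - D * F * x 4 * y 3 + D * M * T * x 3 * y 4 + E * f * x 1 * y 3
    + E * g * x 3 * y 1 = 0
  arc_empty : D * E * M * x 3 * y 4 - F * f * x 3 * y 1 - F * g * x 1 * y 3 + G * f * x 1 * y 3
    + G * g * x 3 * y 1 = 0
  two_ends : - D * E * x 3 * y 0 + D * E * x 3 * y 5 - F * S * x 3 * y 1 + G * S * x 1 * y 3
    - M * S * T * x 3 * y 1 - T * f * x 3 * y 1 - T * g * x 1 * y 3 = 0
  string_through : - D * F * x 1 * y 4 + D * G * x 4 * y 1 - D * M * T * x 1 * y 4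
    + E * M * S * x 4 * y 4 - E * f * x 3 * y 3 + E * f * x 4 * y 4 - E * g * x 1 * y 1 = 0
  arc_two_ends : D * E * x 2 * y 3 + D * E * x 5 * y 1 - F * S * x 4 * y 5 + F * S * x 5 * y 4
    + M * S * T * x 5 * y 4 + M * S * T * x 5 * y 5 + T * f * x 4 * y 5 + T * f * x 5 * y 4
    + T * f * x 5 * y 5 * β + T * g * x 2 * y 2 = 0
  arc_end : - D * F * x 1 * y 5 - D * F * x 3 * y 2 + D * G * x 2 * y 3 + D * G * x 5 * y 1
    + E * M * S * x 5 * y 4 + E * M * S * x 5 * y 5 + E * f * x 4 * y 5 + E * f * x 5 * y 4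
    + E * f * x 5 * y 5 * β + E * g * x 2 * y 2 = 0
  nested_ends : - D * E * x 0 * y 3 - D * E * x 2 * y 1 + D * E * x 4 * y 3 - F * S * x 2 * y 4
    + G * S * x 4 * y 2 - M * S * T * x 2 * y 4 - M * S * T * x 2 * y 5 - T * f * x 2 * y 4
    - T * f * x 2 * y 5 * β - T * g * x 0 * y 2 = 0
  arc_near_end : - D * F * x 1 * y 2 + D * F * x 2 * y 1 - D * F * x 3 * y 5 + D * F * x 5 * y 3
    + D * M * T * x 2 * y 1 + D * M * T * x 5 * y 3 + E * M * S * x 5 * y 2 + E * f * x 4 * y 2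
    + E * f * x 5 * y 2 * β + E * g * x 2 * y 0 = 0
  lower_end : - D * G * x 0 * y 3 + D * G * x 1 * y 2 - D * G * x 2 * y 1 + D * G * x 3 * y 0
    - E * M * S * x 2 * y 4 - E * M * S * x 2 * y 5 + E * M * S * x 3 * y 1 - E * f * x 2 * y 4
    - E * f * x 2 * y 5 * β + E * f * x 3 * y 1 - E * g * x 0 * y 2 + E * g * x 1 * y 3 = 0
  arc_only : D * E * M * x 2 * y 1 + D * E * M * x 5 * y 3 - F * M * S * x 2 * y 5
    - F * f * x 2 * y 4 - F * f * x 2 * y 5 * β - F * g * x 0 * y 2 + G * M * S * x 5 * y 2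
    + G * f * x 4 * y 2 + G * f * x 5 * y 2 * β + G * g * x 2 * y 0 = 0
  upper_end : - D * F * x 0 * y 1 - D * F * x 2 * y 3 + D * G * x 1 * y 0 + D * G * x 3 * y 2
    - D * M * T * x 0 * y 1 - D * M * T * x 2 * y 3 + E * M * S * x 1 * y 1
    - E * M * S * x 2 * y 2 + E * f * x 1 * y 1 - E * f * x 2 * y 2 * β - E * g * x 0 * y 0
    + E * g * x 3 * y 3 = 0

/-- The coefficients `a₁ = f`, `a₂ = g`, `(b₅, b₆, b₇, b₈) = D (ν, μ, μ, ν)` and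
`(b₁, b₂, b₃, b₄) = S (μν, ν², μν, μ²)`. -/
def rankOne (μ ν f g S D : ℂ) : BoundaryCoeffs :=
  ⟨f, g, μ * ν * S, ν ^ 2 * S, μ * ν * S, μ ^ 2 * S, ν * D, μ * D, μ * D, ν * D⟩

/-- Since the coefficients are products of entries of `(μ, ν)`, each component either cancels or is
a monomial in `μ, ν` times one scalar relation. The weights `αᵢ` only occur contracted with two
copies of `(μ, ν)`, that is, as `M`. -/
theorem RankOnePair.quarter {β M : ℂ} {x y : ℕ → ℂ} {f g S D F G T E : ℂ}
    (h : RankOnePair β M x y f g S D F G T E) {α₁ α₂ α₃ μ ν : ℂ}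
    (hM : M = μ * ν * (α₁ + α₂) + (μ ^ 2 + ν ^ 2) * α₃) :
    Quarter β α₁ α₂ α₃ x y (rankOne μ ν f g S D) (rankOne μ ν F G T E) := by
  subst hM
  constructor <;> simp only [rankOne]
  · ring
  · ring
  · ring
  · ring
  · linear_combination μ * μ * ν * h.top_nested
  · linear_combination μ * ν * ν * h.top_nested
  · linear_combination μ * μ * ν * h.top_nested
  · linear_combination μ * μ * μ * h.top_nested
  · ring
  · ring
  · linear_combination μ * μ * ν * h.top_side
  · linear_combination μ * ν * ν * h.top_side
  · linear_combination -(μ * ν * ν) * h.top_side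
  · linear_combination μ * μ * μ * h.top_side
  · linear_combination μ * h.string_end
  · linear_combination h.arc_empty
  · ring
  · ring
  · ring
  · ring
  · ring
  · linear_combination μ * μ * h.two_ends
  · linear_combination μ * ν * h.two_ends
  · linear_combination μ * h.string_through
  · linear_combination μ * ν * h.arc_two_ends
  · linear_combination μ * μ * h.arc_two_ends
  · linear_combination μ * h.arc_end
  · linear_combination μ * ν * h.nested_ends
  · linear_combination μ * μ * h.nested_ends
  · ring
  · linear_combination μ * h.arc_near_end
  · linear_combination μ * h.lower_end
  · linear_combination h.arc_only
  · linear_combination μ * h.upper_end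

/-- The sine of an angle with exponential `Z`, where `j = 1 / 2i`. -/
noncomputable def sinExp (j Z : ℂ) : ℂ := j * (Z - Z⁻¹)

/-- The coefficients of the bulk face operator in terms of exponentials. -/
noncomputable def faceExp (j W Z : ℂ) : ℕ → ℂ
  | 0 => sinExp j (W ^ 2) * sinExp j (W ^ 3) + sinExp j Z * sinExp j (W ^ 3 * Z⁻¹)
  | 1 => sinExp j (W ^ 2) * sinExp j (W ^ 3 * Z⁻¹)
  | 2 => sinExp j (W ^ 2) * sinExp j Z
  | 3 => sinExp j Z * sinExp j (W ^ 3 * Z⁻¹)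
  | 4 => sinExp j (W ^ 2 * Z⁻¹) * sinExp j (W ^ 3 * Z⁻¹)
  | _ => -(sinExp j Z * sinExp j (W * Z⁻¹))

-- The exponentials are `X` of `u - φ / 2`, `Y` of `v - φ / 2` and `W` of `φ`; then `X Y⁻¹`, `X Y W`
-- and `X² W` belong to `u - v`, `u + v` and `2u`, and no half angles are left. Writing the strength
-- as `m / j ^ 2` makes every relation homogeneous in `j`, so `j` can remain an indeterminate and no
-- property of the imaginary unit enters.
set_option maxHeartbeats 2000000 in
theorem rankOnePair_exp (X Y W j m : ℂ) (hX : X ≠ 0) (hY : Y ≠ 0) (hW : W ≠ 0) (hj : j ≠ 0) :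
    RankOnePair (-(W ^ 4 + (W ^ 4)⁻¹)) (m / j ^ 2) (faceExp j W (X * Y⁻¹)) (faceExp j W (X * Y * W))
      (sinExp j (X * W⁻¹) * (m / j ^ 2 * sinExp j X ^ 2 - (W + W⁻¹)))
      (-(m / j ^ 2) * sinExp j X * sinExp j (X * W⁻¹) * sinExp j (X * W)
        + (W + W⁻¹) * sinExp j (X * W ^ 2))
      (sinExp j (X ^ 2 * W) * sinExp j (W ^ 2) * sinExp j X)
      (sinExp j (X ^ 2 * W) * sinExp j (W ^ 2))
      (sinExp j (Y * W⁻¹) * (m / j ^ 2 * sinExp j Y ^ 2 - (W + W⁻¹)))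
      (-(m / j ^ 2) * sinExp j Y * sinExp j (Y * W⁻¹) * sinExp j (Y * W)
        + (W + W⁻¹) * sinExp j (Y * W ^ 2))
      (sinExp j (Y ^ 2 * W) * sinExp j (W ^ 2) * sinExp j Y)
      (sinExp j (Y ^ 2 * W) * sinExp j (W ^ 2)) := by
  constructor <;> simp only [faceExp, sinExp] <;> field_simp <;> ring

/-! ### Boundary faces without strings that end on the boundary at one node only -/

/-- The components of the boundary Yang-Baxter equation for boundary faces with the coefficients
`a₁ = f`, `a₂ = g`, `bᵢ = D nᵢ` for `i ≤ 4` and `bᵢ = 0` for `i > 4`. -/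
structure EvenPair (β kap lam : ℂ) (x y : ℕ → ℂ) (f g D F G E : ℂ) : Prop where
  string_pair : D * G * x 1 * y 3 - D * F * x 3 * y 1 - E * f * x 3 * y 1
    - lam * D * E * x 3 * y 1 - E * g * x 1 * y 3 = 0
  arc_empty : f * G * x 1 * y 3 + g * G * x 3 * y 1 - f * F * x 3 * y 1 - g * F * x 1 * y 3 = 0
  arc_two_ends : g * E * x 2 * y 2 + f * E * x 4 * y 5 + f * E * x 5 * y 4 + β * f * E * x 5 * y 5
    + kap * D * E * x 5 * y 5 + D * F * x 5 * y 4 + lam * D * E * x 5 * y 4 - D * F * x 4 * y 5 = 0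
  nested_ends : D * G * x 4 * y 2 - D * F * x 2 * y 4 - f * E * x 2 * y 4 - lam * D * E * x 2 * y 4
    - g * E * x 0 * y 2 - β * f * E * x 2 * y 5 - kap * D * E * x 2 * y 5 = 0
  arc_only : g * G * x 2 * y 0 + f * G * x 4 * y 2 + β * f * G * x 5 * y 2 + kap * D * G * x 5 * y 2
    - g * F * x 0 * y 2 - f * F * x 2 * y 4 - β * f * F * x 2 * y 5 - kap * D * F * x 2 * y 5 = 0

/-- The strength of the boundary tells apart the four ways in which both nodes are joined to it:
the matrix `N` of these coefficients satisfies `N C N = λ N` for the matrix `C` of the weights. -/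
structure Idempotent (α₁ α₂ α₃ lam n₁ n₂ n₃ n₄ : ℂ) : Prop where
  eq₁ : α₂ * n₁ * n₁ + α₃ * n₂ * n₁ + α₃ * n₁ * n₄ + α₁ * n₂ * n₄ = lam * n₁
  eq₂ : α₂ * n₁ * n₂ + α₃ * n₂ * n₂ + α₃ * n₁ * n₃ + α₁ * n₂ * n₃ = lam * n₂
  eq₃ : α₃ * n₃ * n₂ + α₂ * n₄ * n₂ + α₁ * n₃ * n₃ + α₃ * n₄ * n₃ = lam * n₃
  eq₄ : α₃ * n₃ * n₁ + α₂ * n₄ * n₁ + α₁ * n₃ * n₄ + α₃ * n₄ * n₄ = lam * n₄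

theorem Idempotent.ghost {α₁ α₂ α₃ lam n₁ n₂ n₃ n₄ : ℂ}
    (h : Idempotent α₁ α₂ α₃ lam n₁ n₂ n₃ n₄) : Idempotent α₂ α₁ α₃ lam n₃ n₄ n₁ n₂ := by
  constructor
  · linear_combination h.eq₃
  · linear_combination h.eq₄
  · linear_combination h.eq₁
  · linear_combination h.eq₂

theorem Idempotent.flip {α₁ α₂ α₃ lam n₁ n₂ n₃ n₄ : ℂ}
    (h : Idempotent α₁ α₂ α₃ lam n₁ n₂ n₃ n₄) : Idempotent α₁ α₂ α₃ lam n₁ n₄ n₃ n₂ := by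
  constructor
  · linear_combination h.eq₁
  · linear_combination h.eq₄
  · linear_combination h.eq₃
  · linear_combination h.eq₂

/-- The coefficients `a₁ = f`, `a₂ = g`, `bᵢ = D nᵢ` for `i ≤ 4` and `bᵢ = 0` for `i > 4`. -/
def evenFace (n₁ n₂ n₃ n₄ f g D : ℂ) : BoundaryCoeffs :=
  ⟨f, g, n₁ * D, n₂ * D, n₃ * D, n₄ * D, 0, 0, 0, 0⟩

/-- The quadratic expressions in the `nᵢ` are the entries of `N C N` and become `λ nᵢ`; what remains
is `nᵢ` times a scalar relation. The number `kap` is the weight of the boundary face when its two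
nodes are joined by an arc of a bulk face. -/
theorem EvenPair.quarter {β kap lam : ℂ} {x y : ℕ → ℂ} {f g D F G E : ℂ}
    (h : EvenPair β kap lam x y f g D F G E) {α₁ α₂ α₃ n₁ n₂ n₃ n₄ : ℂ}
    (hn : Idempotent α₁ α₂ α₃ lam n₁ n₂ n₃ n₄)
    (hk : kap = α₁ * n₁ + α₃ * n₂ + α₂ * n₃ + α₃ * n₄) :
    Quarter β α₁ α₂ α₃ x y (evenFace n₁ n₂ n₃ n₄ f g D) (evenFace n₁ n₂ n₃ n₄ F G E) := by
  subst hk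
  constructor <;> simp only [evenFace]
  · ring
  · ring
  · ring
  · ring
  · ring
  · ring
  · ring
  · ring
  · ring
  · ring
  · ring
  · ring
  · ring
  · ring
  · ring
  · linear_combination h.arc_empty
  · ring
  · ring
  · ring
  · ring
  · ring
  · linear_combination n₄ * h.string_pair - D * E * x 3 * y 1 * hn.eq₄
  · linear_combination n₁ * h.string_pair - D * E * x 3 * y 1 * hn.eq₁
  · ring
  · linear_combination n₁ * h.arc_two_ends + D * E * x 5 * y 4 * hn.eq₁
  · linear_combination n₄ * h.arc_two_ends + D * E * x 5 * y 4 * hn.eq₄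
  · ring
  · linear_combination n₁ * h.nested_ends - D * E * x 2 * y 4 * hn.eq₁
  · linear_combination n₄ * h.nested_ends - D * E * x 2 * y 4 * hn.eq₄
  · ring
  · ring
  · ring
  · linear_combination h.arc_only
  · ring

set_option maxHeartbeats 2000000 in
theorem evenPair_exp (U V W j a b w : ℂ) (hU : U ≠ 0) (hV : V ≠ 0) (hW : W ≠ 0) :
    EvenPair (-(W ^ 4 + (W ^ 4)⁻¹)) (w * ((a ^ 2 * W ^ 3 - b ^ 2 * (W ^ 3)⁻¹) / j))
      (-w * ((a ^ 2 * W⁻¹ - b ^ 2 * W) / j)) (faceExp j W (U * V⁻¹)) (faceExp j W (U * V))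
      (w * ((a * U + b * U⁻¹) * (a * (U * W⁻¹) + b * (U * W⁻¹)⁻¹)))
      (w * ((a * U⁻¹ + b * U) * (a * (U * W⁻¹) + b * (U * W⁻¹)⁻¹)))
      (sinExp j (U ^ 2))
      (w * ((a * V + b * V⁻¹) * (a * (V * W⁻¹) + b * (V * W⁻¹)⁻¹)))
      (w * ((a * V⁻¹ + b * V) * (a * (V * W⁻¹) + b * (V * W⁻¹)⁻¹)))
      (sinExp j (V ^ 2)) := by
  constructor <;> simp only [faceExp, sinExp] <;> field_simp <;> ring

/-! ### From exponentials to sines and cosines -/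

theorem sinExp_exp (z : ℂ) : sinExp (2 * Complex.I)⁻¹ (Complex.exp (z * Complex.I)) = Complex.sin z := by
  rw [sinExp, Complex.sin, ← Complex.exp_neg, ← neg_mul, mul_inv, Complex.inv_I]
  ring

theorem exp_add_inv (z : ℂ) :
    Complex.exp (z * Complex.I) + (Complex.exp (z * Complex.I))⁻¹ = 2 * Complex.cos z := by
  rw [Complex.cos, ← Complex.exp_neg, ← neg_mul]; ring

theorem exp_mul_I_mul (a b : ℂ) : Complex.exp (a * Complex.I) * Complex.exp (b * Complex.I)
    = Complex.exp ((a + b) * Complex.I) := by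
  rw [← Complex.exp_add, add_mul]

theorem exp_mul_I_inv (a : ℂ) : (Complex.exp (a * Complex.I))⁻¹ = Complex.exp (-a * Complex.I) := by
  rw [← Complex.exp_neg, neg_mul]

theorem exp_mul_I_pow (a : ℂ) (n : ℕ) :
    Complex.exp (a * Complex.I) ^ n = Complex.exp (n * a * Complex.I) := by
  rw [← Complex.exp_nat_mul, mul_assoc]

theorem faceExp_exp (φ u : ℂ) :
    faceExp (2 * Complex.I)⁻¹ (Complex.exp (φ * Complex.I)) (Complex.exp (u * Complex.I))
      = faceCoeff φ u := by
  funext i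
  match i with
  | 0 | 1 | 2 | 3 | 4 | (i + 5) =>
    simp only [faceExp, faceCoeff, exp_mul_I_inv, exp_mul_I_pow, exp_mul_I_mul, sinExp_exp,
      ← sub_eq_add_neg, Nat.cast_ofNat]

/-- The coefficient `a₁` of the first family, up to a factor. -/
noncomputable def firstDiag (φ M u : ℂ) : ℂ :=
  Complex.sin (u - 3 * φ / 2) * (M * Complex.sin (u - φ / 2) ^ 2 - 2 * Complex.cos φ)

/-- The coefficient `a₂` of the first family, up to a factor. -/
noncomputable def firstEmpty (φ M u : ℂ) : ℂ :=
  -M * Complex.sin (u - φ / 2) * Complex.sin (u - 3 * φ / 2) * Complex.sin (u + φ / 2)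
    + 2 * Complex.cos φ * Complex.sin (u + 3 * φ / 2)

theorem rankOnePair_sin (φ M u v : ℂ) :
    RankOnePair (-2 * Complex.cos (4 * φ)) M (faceCoeff φ (u - v)) (faceCoeff φ (u + v))
      (firstDiag φ M u) (firstEmpty φ M u)
      (Complex.sin (2 * u) * Complex.sin (2 * φ) * Complex.sin (u - φ / 2))
      (Complex.sin (2 * u) * Complex.sin (2 * φ))
      (firstDiag φ M v) (firstEmpty φ M v)
      (Complex.sin (2 * v) * Complex.sin (2 * φ) * Complex.sin (v - φ / 2))
      (Complex.sin (2 * v) * Complex.sin (2 * φ)) := by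
  have hI : (2 * Complex.I)⁻¹ ≠ 0 := by simp [Complex.I_ne_zero]
  -- The choice `m = M j ^ 2` makes the strength `m / j ^ 2` equal to `M`.
  have h := rankOnePair_exp (Complex.exp ((u - φ / 2) * Complex.I))
    (Complex.exp ((v - φ / 2) * Complex.I)) (Complex.exp (φ * Complex.I)) (2 * Complex.I)⁻¹
    (M * (2 * Complex.I)⁻¹ ^ 2) (Complex.exp_ne_zero _) (Complex.exp_ne_zero _)
    (Complex.exp_ne_zero _) hI
  rw [mul_div_cancel_right₀ _ (pow_ne_zero 2 hI)] at h
  rw [exp_add_inv, exp_mul_I_pow φ 4, exp_add_inv] at h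
  simp only [exp_mul_I_inv, exp_mul_I_pow, exp_mul_I_mul, sinExp_exp, faceExp_exp,
    Nat.cast_ofNat] at h
  have e (z : ℂ) : z - φ / 2 + -φ = z - 3 * φ / 2 ∧ z - φ / 2 + φ = z + φ / 2 ∧
      z - φ / 2 + 2 * φ = z + 3 * φ / 2 ∧ 2 * (z - φ / 2) + φ = 2 * z :=
    ⟨by ring, by ring, by ring, by ring⟩
  have e₁ : u - φ / 2 + -(v - φ / 2) = u - v := by ring
  have e₂ : u - φ / 2 + (v - φ / 2) + φ = u + v := by ring
  simp only [e, e₁, e₂] at h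
  rw [← neg_mul] at h
  exact h

theorem evenPair_sin (φ σ τ w u v : ℂ) :
    EvenPair (-2 * Complex.cos (4 * φ)) (w * P σ τ (-3 * φ)) (-w * P σ τ φ)
      (faceCoeff φ (u - v)) (faceCoeff φ (u + v))
      (w * ((σ * Complex.cos u + τ * Complex.sin u)
        * (σ * Complex.cos (u - φ) + τ * Complex.sin (u - φ))))
      (w * ((σ * Complex.cos u - τ * Complex.sin u)
        * (σ * Complex.cos (u - φ) + τ * Complex.sin (u - φ))))
      (Complex.sin (2 * u))
      (w * ((σ * Complex.cos v + τ * Complex.sin v)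
        * (σ * Complex.cos (v - φ) + τ * Complex.sin (v - φ))))
      (w * ((σ * Complex.cos v - τ * Complex.sin v)
        * (σ * Complex.cos (v - φ) + τ * Complex.sin (v - φ))))
      (Complex.sin (2 * v)) := by
  -- These are the coefficients of `exp(iz)` and `exp(-iz)` in `σ cos z + τ sin z`.
  have h := evenPair_exp (Complex.exp (u * Complex.I)) (Complex.exp (v * Complex.I))
    (Complex.exp (φ * Complex.I)) (2 * Complex.I)⁻¹ ((σ - τ * Complex.I) / 2)
    ((σ + τ * Complex.I) / 2) w (Complex.exp_ne_zero _) (Complex.exp_ne_zero _)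
    (Complex.exp_ne_zero _)
  rw [exp_mul_I_pow φ 4, exp_add_inv] at h
  simp only [exp_mul_I_inv, exp_mul_I_pow, exp_mul_I_mul, sinExp_exp, faceExp_exp,
    Nat.cast_ofNat] at h
  have e (z : ℂ) : (σ - τ * Complex.I) / 2 * Complex.exp (z * Complex.I)
      + (σ + τ * Complex.I) / 2 * Complex.exp (-z * Complex.I)
      = σ * Complex.cos z + τ * Complex.sin z := by
    rw [Complex.exp_mul_I, Complex.exp_mul_I, Complex.cos_neg, Complex.sin_neg]
    linear_combination -τ * Complex.sin z * Complex.I_sq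
  have e' (z : ℂ) : (σ - τ * Complex.I) / 2 * Complex.exp (-z * Complex.I)
      + (σ + τ * Complex.I) / 2 * Complex.exp (z * Complex.I)
      = σ * Complex.cos z - τ * Complex.sin z := by
    rw [Complex.exp_mul_I, Complex.exp_mul_I, Complex.cos_neg, Complex.sin_neg]
    linear_combination τ * Complex.sin z * Complex.I_sq
  have p (z : ℂ) : (((σ - τ * Complex.I) / 2) ^ 2 * Complex.exp (-z * Complex.I)
      - ((σ + τ * Complex.I) / 2) ^ 2 * Complex.exp (z * Complex.I)) / (2 * Complex.I)⁻¹
      = P σ τ z := by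
    rw [Complex.exp_mul_I, Complex.exp_mul_I, Complex.cos_neg, Complex.sin_neg, P, div_inv_eq_mul]
    linear_combination (-2 * σ * τ * Complex.cos z - σ ^ 2 * Complex.sin z
      - τ ^ 2 * Complex.sin z * (Complex.I ^ 2 - 1)) * Complex.I_sq
  have h3 := p (-(3 * φ))
  rw [neg_neg] at h3
  simp only [e, e', p, h3, ← sub_eq_add_neg] at h
  rw [show -3 * φ = -(3 * φ) by ring, neg_mul 2]
  exact h

/-! ## The five families satisfy the boundary Yang-Baxter equation -/

def BoundaryCoeffs.smul (c : ℂ) (k : BoundaryCoeffs) : BoundaryCoeffs :=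
  ⟨c * k.a₁, c * k.a₂, c * k.b₁, c * k.b₂, c * k.b₃, c * k.b₄, c * k.b₅, c * k.b₆, c * k.b₇, c * k.b₈⟩

/-- The effect on the boundary face of a shift of the spectral parameter by `π / 2`. -/
def BoundaryCoeffs.twist (k : BoundaryCoeffs) : BoundaryCoeffs :=
  ⟨k.a₁, -k.a₂, k.b₁, k.b₂, k.b₃, k.b₄, k.b₅, k.b₆, -k.b₇, -k.b₈⟩

theorem BoundaryCoeffs.twist_twist (k : BoundaryCoeffs) : k.twist.twist = k := by
  simp [BoundaryCoeffs.twist]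

/-- Every component is bilinear in the coefficients of the two boundary faces. -/
theorem Quarter.smul {β α₁ α₂ α₃ : ℂ} {x y : ℕ → ℂ} {k l : BoundaryCoeffs}
    (h : Quarter β α₁ α₂ α₃ x y k l) (c d : ℂ) :
    Quarter β α₁ α₂ α₃ x y (k.smul c) (l.smul d) := by
  constructor <;> simp only [BoundaryCoeffs.smul]
  · linear_combination c * d * h.wL1L2R2gR1g
  · linear_combination c * d * h.wL1L2gR2R1g
  · linear_combination c * d * h.wL1L2gR2gR1
  · linear_combination c * d * h.wL1gL2R2gR1
  · linear_combination c * d * h.wL1L2R2g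
  · linear_combination c * d * h.wL1L2gR2
  · linear_combination c * d * h.wL1gL2R2
  · linear_combination c * d * h.wL1gL2gR2g
  · linear_combination c * d * h.wL2R2
  · linear_combination c * d * h.wL2gR2g
  · linear_combination c * d * h.wL1L2R1g
  · linear_combination c * d * h.wL1L2gR1
  · linear_combination c * d * h.wL1R2gR1
  · linear_combination c * d * h.wL1gL2gR1g
  · linear_combination c * d * h.cL1R2_wR1g
  · linear_combination c * d * h.cL1R2_w
  · linear_combination c * d * h.cL2R2_wL1R1
  · linear_combination c * d * h.cL2R2_wL1gR1g
  · linear_combination c * d * h.cL2R2_w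
  · linear_combination c * d * h.wL1R1
  · linear_combination c * d * h.wL1gR1g
  · linear_combination c * d * h.wL1gR2g
  · linear_combination c * d * h.wL1R2
  · linear_combination c * d * h.cL2R2_wL1g
  · linear_combination c * d * h.cL1L2_wR2R1
  · linear_combination c * d * h.cL1L2_wR2gR1g
  · linear_combination c * d * h.cL1L2_wR2g
  · linear_combination c * d * h.wL1L2
  · linear_combination c * d * h.wL1gL2g
  · linear_combination c * d * h.w
  · linear_combination c * d * h.cL1L2_wR1g
  · linear_combination c * d * h.wL2g
  · linear_combination c * d * h.cL1L2_w
  · linear_combination c * d * h.wL1g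

/-- Each component is homogeneous for the grading modulo 2 in which `y 1`, `y 2`, `a₂`, `b₇`, `b₈`
are odd, and also for the one with `b₅`, `b₆` in place of `b₇`, `b₈`. The second conclusion serves
the reflected quarters, because a reflection exchanges these two pairs. -/
theorem Quarter.twist {β α₁ α₂ α₃ : ℂ} {x y y' : ℕ → ℂ} {k l : BoundaryCoeffs}
    (h : Quarter β α₁ α₂ α₃ x y k l) (h0 : y' 0 = y 0) (h1 : y' 1 = -y 1) (h2 : y' 2 = -y 2)
    (h3 : y' 3 = y 3) (h4 : y' 4 = y 4) (h5 : y' 5 = y 5) :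
    Quarter β α₁ α₂ α₃ x y' k.twist l.twist ∧
      Quarter β α₁ α₂ α₃ x y' k.flip.twist.flip l.flip.twist.flip := by
  constructor <;> constructor <;>
    simp only [BoundaryCoeffs.twist, BoundaryCoeffs.flip, h0, h1, h2, h3, h4, h5]
  · linear_combination h.wL1L2R2gR1g
  · linear_combination h.wL1L2gR2R1g
  · linear_combination h.wL1L2gR2gR1
  · linear_combination h.wL1gL2R2gR1
  · linear_combination h.wL1L2R2g
  · linear_combination h.wL1L2gR2
  · linear_combination h.wL1gL2R2
  · linear_combination h.wL1gL2gR2g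
  · linear_combination -h.wL2R2
  · linear_combination -h.wL2gR2g
  · linear_combination h.wL1L2R1g
  · linear_combination h.wL1L2gR1
  · linear_combination -h.wL1R2gR1
  · linear_combination h.wL1gL2gR1g
  · linear_combination -h.cL1R2_wR1g
  · linear_combination -h.cL1R2_w
  · linear_combination h.cL2R2_wL1R1
  · linear_combination h.cL2R2_wL1gR1g
  · linear_combination -h.cL2R2_w
  · linear_combination -h.wL1R1
  · linear_combination -h.wL1gR1g
  · linear_combination -h.wL1gR2g
  · linear_combination -h.wL1R2
  · linear_combination h.cL2R2_wL1g
  · linear_combination h.cL1L2_wR2R1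
  · linear_combination h.cL1L2_wR2gR1g
  · linear_combination h.cL1L2_wR2g
  · linear_combination h.wL1L2
  · linear_combination h.wL1gL2g
  · linear_combination h.w
  · linear_combination h.cL1L2_wR1g
  · linear_combination -h.wL2g
  · linear_combination h.cL1L2_w
  · linear_combination -h.wL1g
  · linear_combination h.wL1L2R2gR1g
  · linear_combination h.wL1L2gR2R1g
  · linear_combination h.wL1L2gR2gR1
  · linear_combination h.wL1gL2R2gR1
  · linear_combination -h.wL1L2R2g
  · linear_combination -h.wL1L2gR2
  · linear_combination -h.wL1gL2R2
  · linear_combination -h.wL1gL2gR2g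
  · linear_combination -h.wL2R2
  · linear_combination -h.wL2gR2g
  · linear_combination -h.wL1L2R1g
  · linear_combination -h.wL1L2gR1
  · linear_combination h.wL1R2gR1
  · linear_combination -h.wL1gL2gR1g
  · linear_combination h.cL1R2_wR1g
  · linear_combination -h.cL1R2_w
  · linear_combination h.cL2R2_wL1R1
  · linear_combination h.cL2R2_wL1gR1g
  · linear_combination -h.cL2R2_w
  · linear_combination -h.wL1R1
  · linear_combination -h.wL1gR1g
  · linear_combination -h.wL1gR2g
  · linear_combination -h.wL1R2
  · linear_combination -h.cL2R2_wL1g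
  · linear_combination h.cL1L2_wR2R1
  · linear_combination h.cL1L2_wR2gR1g
  · linear_combination -h.cL1L2_wR2g
  · linear_combination h.wL1L2
  · linear_combination h.wL1gL2g
  · linear_combination h.w
  · linear_combination -h.cL1L2_wR1g
  · linear_combination h.wL2g
  · linear_combination h.cL1L2_w
  · linear_combination h.wL1g

theorem faceCoeff_add_pi (φ u : ℂ) :
    faceCoeff φ (u + Real.pi) 0 = faceCoeff φ u 0 ∧ faceCoeff φ (u + Real.pi) 1 = -faceCoeff φ u 1 ∧
    faceCoeff φ (u + Real.pi) 2 = -faceCoeff φ u 2 ∧ faceCoeff φ (u + Real.pi) 3 = faceCoeff φ u 3 ∧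
    faceCoeff φ (u + Real.pi) 4 = faceCoeff φ u 4 ∧ faceCoeff φ (u + Real.pi) 5 = faceCoeff φ u 5 := by
  simp only [faceCoeff, ← sub_sub, Complex.sin_sub_pi, Complex.sin_add_pi]
  refine ⟨?_, ?_, ?_, ?_, ?_, ?_⟩ <;> ring

theorem bybe_twist {φ α₁ α₂ α₃ : ℂ} {K L : ℂ → BoundaryCoeffs} {u v u' v' : ℂ}
    (hu : L u' = (K u).twist) (hv : L v' = (K v).twist) (hs : u' - v' = u - v)
    (ht : u' + v' = u + v + Real.pi)
    (h : BYBE φ α₁ α₂ α₃ K u v) : BYBE φ α₁ α₂ α₃ L u' v' := by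
  rw [bybe_iff] at h ⊢
  obtain ⟨h0, h1, h2, h3, h4, h5⟩ := faceCoeff_add_pi φ (u + v)
  rw [hu, hv, hs, ht]
  obtain ⟨q1, q2, q3, q4⟩ := h
  exact ⟨(q1.twist h0 h1 h2 h3 h4 h5).1, (q2.twist h0 h1 h2 h3 h4 h5).1,
    (q3.twist h0 h1 h2 h3 h4 h5).2, (q4.twist h0 h1 h2 h3 h4 h5).2⟩

theorem rankOne_ghost (μ ν f g S D : ℂ) :
    (rankOne μ ν f g S D).ghost = rankOne ν μ f g S D := by
  simp only [rankOne, BoundaryCoeffs.ghost, mul_comm μ ν]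

theorem rankOne_flip (μ ν f g S D : ℂ) : (rankOne μ ν f g S D).flip = rankOne ν μ f g S D := by
  simp only [rankOne, BoundaryCoeffs.flip, mul_comm μ ν]

theorem smul_ghost (c : ℂ) (k : BoundaryCoeffs) : (k.smul c).ghost = k.ghost.smul c := rfl

theorem smul_flip (c : ℂ) (k : BoundaryCoeffs) : (k.smul c).flip = k.flip.smul c := rfl

/-- The first family, up to a factor. -/
noncomputable def firstFace (φ α₁ α₂ α₃ μ ν u : ℂ) : BoundaryCoeffs :=
  rankOne μ ν (firstDiag φ (μ * ν * (α₁ + α₂) + (μ ^ 2 + ν ^ 2) * α₃) u)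
    (firstEmpty φ (μ * ν * (α₁ + α₂) + (μ ^ 2 + ν ^ 2) * α₃) u)
    (Complex.sin (2 * u) * Complex.sin (2 * φ) * Complex.sin (u - φ / 2))
    (Complex.sin (2 * u) * Complex.sin (2 * φ))

theorem bybe_of_firstFace {φ α₁ α₂ α₃ : ℂ} (μ ν : ℂ) {K : ℂ → BoundaryCoeffs} {u v c d : ℂ}
    (hu : K u = (firstFace φ α₁ α₂ α₃ μ ν u).smul c)
    (hv : K v = (firstFace φ α₁ α₂ α₃ μ ν v).smul d) : BYBE φ α₁ α₂ α₃ K u v := by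
  rw [bybe_iff, hu, hv]
  simp only [smul_ghost, smul_flip, firstFace, rankOne_ghost, rankOne_flip]
  exact ⟨((rankOnePair_sin φ _ u v).quarter rfl).smul c d,
    ((rankOnePair_sin φ _ u v).quarter (by ring)).smul c d,
    ((rankOnePair_sin φ _ u v).quarter (by ring)).smul c d,
    ((rankOnePair_sin φ _ u v).quarter (by ring)).smul c d⟩

/-- A boundary face without strings that end on the boundary at one node only. -/
noncomputable def evenSolution (φ σ τ w n₁ n₂ n₃ n₄ u : ℂ) : BoundaryCoeffs :=
  evenFace n₁ n₂ n₃ n₄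
    (w * ((σ * Complex.cos u + τ * Complex.sin u)
      * (σ * Complex.cos (u - φ) + τ * Complex.sin (u - φ))))
    (w * ((σ * Complex.cos u - τ * Complex.sin u)
      * (σ * Complex.cos (u - φ) + τ * Complex.sin (u - φ)))) (Complex.sin (2 * u))

theorem evenFace_ghost (n₁ n₂ n₃ n₄ f g D : ℂ) :
    (evenFace n₁ n₂ n₃ n₄ f g D).ghost = evenFace n₃ n₄ n₁ n₂ f g D := rfl

theorem evenFace_flip (n₁ n₂ n₃ n₄ f g D : ℂ) :
    (evenFace n₁ n₂ n₃ n₄ f g D).flip = evenFace n₁ n₄ n₃ n₂ f g D := rfl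

theorem bybe_of_evenSolution {φ α₁ α₂ α₃ σ τ w n₁ n₂ n₃ n₄ : ℂ}
    (hn : Idempotent α₁ α₂ α₃ (-w * P σ τ φ) n₁ n₂ n₃ n₄)
    (hk : w * P σ τ (-3 * φ) = α₁ * n₁ + α₃ * n₂ + α₂ * n₃ + α₃ * n₄)
    {K : ℂ → BoundaryCoeffs} {u v c d : ℂ}
    (hu : K u = (evenSolution φ σ τ w n₁ n₂ n₃ n₄ u).smul c)
    (hv : K v = (evenSolution φ σ τ w n₁ n₂ n₃ n₄ v).smul d) : BYBE φ α₁ α₂ α₃ K u v := by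
  rw [bybe_iff, hu, hv]
  simp only [smul_ghost, smul_flip, evenSolution, evenFace_ghost, evenFace_flip]
  have h := evenPair_sin φ σ τ w u v
  exact ⟨(h.quarter hn hk).smul c d, (h.quarter hn.ghost (by rw [hk]; ring)).smul c d,
    (h.quarter hn.flip (by rw [hk]; ring)).smul c d,
    (h.quarter hn.ghost.flip (by rw [hk]; ring)).smul c d⟩

/-! ### Verification of the five families -/

section Families

open Complex

variable (φ α₁ α₂ α₃ : ℂ)

theorem solutionI_eq (hs : sin (2 * φ) ≠ 0) (μ ν : ℂ) (b : ℂ → ℂ) {u : ℂ} (hu : sin (2 * u) ≠ 0) :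
    solutionI φ α₁ α₂ α₃ μ ν b u
      = (firstFace φ α₁ α₂ α₃ μ ν u).smul (b u / (sin (2 * u) * sin (2 * φ))) := by
  -- This factorisation shows that `sin (u - 3φ/2)` divides `a₁`, as in `firstDiag`.
  have h : cos (2 * (u - φ)) - cos φ = -2 * sin (u - φ / 2) * sin (u - 3 * φ / 2) := by
    rw [cos_sub_cos]; ring_nf
  ext <;> simp only [solutionI, firstFace, rankOne, firstDiag, firstEmpty, BoundaryCoeffs.smul] <;>
    try rw [h]
  · field_simp
    ring
  · field_simp
    ring
  iterate 4 rw [div_mul_eq_mul_div, eq_div_iff (mul_ne_zero hu hs)]; ring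
  all_goals field_simp

/-- The shift by `π / 2` turns the sines of solution I into the cosines of solution II, so that II
needs no computation of its own. The function `b` is shifted back in order to be evaluated at `u`.
-/
theorem solutionII_eq (μ ν : ℂ) (b : ℂ → ℂ) (u : ℂ) :
    solutionII φ α₁ α₂ α₃ μ ν b u
      = (solutionI φ α₁ α₂ α₃ μ ν (fun z => b (z - Real.pi / 2)) (u + Real.pi / 2)).twist := by
  have h (a : ℂ) : sin (u + Real.pi / 2 - a) = cos (u - a) := by
    rw [← sin_add_pi_div_two]; congr 1; ring
  have h' (a : ℂ) : sin (u + Real.pi / 2 + a) = cos (u + a) := by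
    rw [← sin_add_pi_div_two]; congr 1; ring
  have h2 : sin (2 * (u + Real.pi / 2)) = -sin (2 * u) := by
    rw [← sin_add_pi]; congr 1; ring
  have h3 : cos (2 * (u + Real.pi / 2 - φ)) = -cos (2 * (u - φ)) := by
    rw [← cos_add_pi]; congr 1; ring
  ext <;> simp only [solutionII, solutionI, BoundaryCoeffs.twist, h, h', h2, h3,
    add_sub_cancel_right, mul_neg, neg_mul, div_neg] <;> ring

/-- Here `N` is `P(-3φ)` times the adjugate of `C`, whose determinant is `A₂`; hence `N C N = A₂
P(-3φ) N`. The constraint on `σ, τ` identifies this factor with the required one. -/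
theorem idempotent_solutionIII {σ τ : ℂ}
    (h : A₁ α₁ α₂ α₃ * P σ τ φ + A₂ α₁ α₂ α₃ * P σ τ (-3 * φ) = 0) :
    Idempotent α₁ α₂ α₃ (-A₁ α₁ α₂ α₃ * P σ τ φ) (α₁ * P σ τ (-3 * φ)) (-α₃ * P σ τ (-3 * φ))
      (α₂ * P σ τ (-3 * φ)) (-α₃ * P σ τ (-3 * φ)) := by
  have h' : -A₁ α₁ α₂ α₃ * P σ τ φ = A₂ α₁ α₂ α₃ * P σ τ (-3 * φ) := by linear_combination -h
  rw [h', A₂]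
  constructor <;> ring

/-- The matrix `N` is a column times the row `(μ, ν)`, so `N C N` is `N` times the scalar row · `C`
· column, in which `p'` cancels. -/
theorem idempotent_solutionIV (μ ν p p' : ℂ) :
    Idempotent α₁ α₂ α₃ (-((α₁ - α₂) * (μ * ν * (α₁ + α₂) + (μ ^ 2 + ν ^ 2) * α₃)) * p)
      (μ * ((ν * α₂ + μ * α₃) * p + (ν * α₁ + μ * α₃) * p'))
      (ν * ((ν * α₂ + μ * α₃) * p + (ν * α₁ + μ * α₃) * p'))
      (-ν * ((μ * α₁ + ν * α₃) * p + (μ * α₂ + ν * α₃) * p'))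
      (-μ * ((μ * α₁ + ν * α₃) * p + (μ * α₂ + ν * α₃) * p')) := by
  constructor <;> ring

/-- A sum-to-product formula: `-φ` is the midpoint of `φ` and `-3φ`, at distance `2φ` from both. -/
theorem P_neg (σ τ : ℂ) : 2 * cos (2 * φ) * P σ τ (-φ) = P σ τ φ + P σ τ (-3 * φ) := by
  have e1 : (-3 : ℂ) * φ = -(2 * φ) - φ := by ring
  have e2 : φ = 2 * φ - φ := by ring
  have h1 : cos φ = cos (2 * φ) * cos φ + sin (2 * φ) * sin φ := by
    conv_lhs => rw [e2, cos_sub]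
  have h2 : sin φ = sin (2 * φ) * cos φ - cos (2 * φ) * sin φ := by
    conv_lhs => rw [e2, sin_sub]
  simp only [P, e1, cos_sub, sin_sub, cos_neg, sin_neg]
  linear_combination -2 * σ * τ * h1 - (σ ^ 2 - τ ^ 2) * h2

/-- Again `N` has rank one, with column `(c₂, c₃)` and row proportional to `(α₁ p' + α₂ p, -α₃ (p +
p'))`. The constraint says that `M` vanishes on this row. The number `e` stands for `1 / (4 cos²
2φ)`, which arises when `P(-φ)` is expressed by `p + p'`. -/
theorem idempotent_solutionV {p p' : ℂ} (c₂ c₃ e : ℂ)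
    (h : A₁ α₁ α₂ α₃ * p * p' + A₂ α₁ α₂ α₃ * (p ^ 2 + p' ^ 2) = 0) :
    Idempotent α₁ α₂ α₃
      (-((α₁ - α₂) * ((c₂ * α₁ + c₃ * α₃) * p' + (c₂ * α₂ + c₃ * α₃) * p) * e) * p)
      (c₂ * ((p + p') * (α₁ * p' + α₂ * p)) * e) (-c₂ * α₃ * (p + p') ^ 2 * e)
      (-c₃ * α₃ * (p + p') ^ 2 * e) (c₃ * ((p + p') * (α₁ * p' + α₂ * p)) * e) ∧
    (α₁ - α₂) * ((c₂ * α₁ + c₃ * α₃) * p' + (c₂ * α₂ + c₃ * α₃) * p) * e * p'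
      = α₁ * (c₂ * ((p + p') * (α₁ * p' + α₂ * p)) * e) + α₃ * (-c₂ * α₃ * (p + p') ^ 2 * e)
        + α₂ * (-c₃ * α₃ * (p + p') ^ 2 * e)
        + α₃ * (c₃ * ((p + p') * (α₁ * p' + α₂ * p)) * e) := by
  simp only [A₁, A₂] at h
  refine ⟨⟨?_, ?_, ?_, ?_⟩, ?_⟩
  · linear_combination c₂ * e * (c₂ * ((p + p') * (α₁ * p' + α₂ * p)) * e) * h
  · linear_combination c₂ * e * (-c₂ * α₃ * (p + p') ^ 2 * e) * h
  · linear_combination c₂ * e * (-c₃ * α₃ * (p + p') ^ 2 * e) * h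
  · linear_combination c₂ * e * (c₃ * ((p + p') * (α₁ * p' + α₂ * p)) * e) * h
  · linear_combination -c₂ * e * h

theorem bybe_of_isSolution (hs : sin (2 * φ) ≠ 0) (hc : cos (2 * φ) ≠ 0) {K : ℂ → BoundaryCoeffs}
    (hK : IsSolution φ α₁ α₂ α₃ K) {u v : ℂ} (hu : sin (2 * u) ≠ 0) (hv : sin (2 * v) ≠ 0) :
    BYBE φ α₁ α₂ α₃ K u v := by
  rcases hK with ⟨μ, ν, b, rfl⟩ | ⟨μ, ν, b, rfl⟩ | ⟨σ, τ, b, h, rfl⟩ | ⟨μ, ν, σ, τ, b, rfl⟩ |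
    ⟨c₂, c₃, σ, τ, b, h, rfl⟩
  · exact bybe_of_firstFace μ ν (solutionI_eq φ α₁ α₂ α₃ hs μ ν b hu)
      (solutionI_eq φ α₁ α₂ α₃ hs μ ν b hv)
  -- Solution II at `u, v` is the twist of solution I at `u + π/2, v + π/2`: the difference of the
  -- parameters is unchanged and their sum moves by `π`.
  · have h2 (z : ℂ) : sin (2 * (z + Real.pi / 2)) = -sin (2 * z) := by
      rw [← sin_add_pi]; congr 1; ring
    have hu' : sin (2 * (u + Real.pi / 2)) ≠ 0 := by rwa [h2, neg_ne_zero]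
    have hv' : sin (2 * (v + Real.pi / 2)) ≠ 0 := by rwa [h2, neg_ne_zero]
    have h := bybe_of_firstFace μ ν
      (solutionI_eq φ α₁ α₂ α₃ hs μ ν (fun z => b (z - Real.pi / 2)) hu')
      (solutionI_eq φ α₁ α₂ α₃ hs μ ν (fun z => b (z - Real.pi / 2)) hv')
    rw [bybe_iff] at h ⊢
    have e : u + Real.pi / 2 - (v + Real.pi / 2) = u - v := by ring
    have e' : u + Real.pi / 2 + (v + Real.pi / 2) = u + v + Real.pi := by ring
    rw [e, e'] at h
    obtain ⟨h0, h1, h2, h3, h4, h5⟩ := faceCoeff_add_pi φ (u + v)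
    obtain ⟨q1, q2, q3, q4⟩ := h
    rw [solutionII_eq, solutionII_eq]
    have h1' := neg_eq_iff_eq_neg.2 h1
    have h2' := neg_eq_iff_eq_neg.2 h2
    exact ⟨(q1.twist h0.symm h1'.symm h2'.symm h3.symm h4.symm h5.symm).1,
      (q2.twist h0.symm h1'.symm h2'.symm h3.symm h4.symm h5.symm).1,
      (q3.twist h0.symm h1'.symm h2'.symm h3.symm h4.symm h5.symm).2,
      (q4.twist h0.symm h1'.symm h2'.symm h3.symm h4.symm h5.symm).2⟩
  · have key (z : ℂ) (hz : sin (2 * z) ≠ 0) : solutionIII φ α₁ α₂ α₃ σ τ b z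
        = (evenSolution φ σ τ (A₁ α₁ α₂ α₃) (α₁ * P σ τ (-3 * φ)) (-α₃ * P σ τ (-3 * φ))
          (α₂ * P σ τ (-3 * φ)) (-α₃ * P σ τ (-3 * φ)) z).smul (b z / sin (2 * z)) := by
      ext <;> simp only [solutionIII, evenSolution, evenFace, BoundaryCoeffs.smul] <;>
        field_simp <;> ring
    exact bybe_of_evenSolution (idempotent_solutionIII φ α₁ α₂ α₃ h) (by rw [A₁]; ring)
      (key u hu) (key v hv)
  · have key (z : ℂ) (hz : sin (2 * z) ≠ 0) := by
      refine (show solutionIV φ α₁ α₂ α₃ μ ν σ τ b z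
        = (evenSolution φ σ τ ((α₁ - α₂) * (μ * ν * (α₁ + α₂) + (μ ^ 2 + ν ^ 2) * α₃))
          (μ * ((ν * α₂ + μ * α₃) * P σ τ φ + (ν * α₁ + μ * α₃) * P σ τ (-3 * φ)))
          (ν * ((ν * α₂ + μ * α₃) * P σ τ φ + (ν * α₁ + μ * α₃) * P σ τ (-3 * φ)))
          (-ν * ((μ * α₁ + ν * α₃) * P σ τ φ + (μ * α₂ + ν * α₃) * P σ τ (-3 * φ)))
          (-μ * ((μ * α₁ + ν * α₃) * P σ τ φ + (μ * α₂ + ν * α₃) * P σ τ (-3 * φ))) z).smul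
            (b z / sin (2 * z)) from ?_)
      ext <;> simp only [solutionIV, evenSolution, evenFace, BoundaryCoeffs.smul] <;>
        field_simp <;> ring
    exact bybe_of_evenSolution (idempotent_solutionIV α₁ α₂ α₃ μ ν _ _) (by ring)
      (key u hu) (key v hv)
  · obtain ⟨hn, hk⟩ := idempotent_solutionV α₁ α₂ α₃ c₂ c₃ (1 / (4 * cos (2 * φ) ^ 2)) h
    have hP : P σ τ (-φ) = (P σ τ φ + P σ τ (-3 * φ)) / (2 * cos (2 * φ)) := by
      rw [← P_neg, mul_div_cancel_left₀ _ (mul_ne_zero two_ne_zero hc)]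
    refine bybe_of_evenSolution hn hk (c := b u / sin (2 * u)) (d := b v / sin (2 * v)) ?_ ?_ <;>
    · ext <;> simp only [solutionV, evenSolution, evenFace, BoundaryCoeffs.smul, hP] <;>
        field_simp <;> norm_num <;> try ring

end Families

/-! ## Properties that hold off a discrete set -/

section Codiscrete

open Filter Topology

theorem eventually_codiscrete_iff {p : ℂ → Prop} :
    (∀ᶠ z in codiscrete ℂ, p z) ↔ ∀ x, ∀ᶠ z in 𝓝[≠] x, p z := by
  simp [codiscrete, codiscreteWithin, Set.compl_eq_univ_sdiff]

instance : (codiscrete ℂ).NeBot := by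
  refine ⟨fun h => ?_⟩
  have h' : ∀ᶠ _ in codiscrete ℂ, False := by rw [h]; exact eventually_bot
  exact (eventually_codiscrete_iff.1 h' 0).exists.elim fun _ h => h

theorem eventually_codiscrete_add {p : ℂ → Prop} (h : ∀ᶠ z in codiscrete ℂ, p z) (c : ℂ) :
    ∀ᶠ z in codiscrete ℂ, p (z + c) := by
  rw [eventually_codiscrete_iff] at h ⊢
  intro x
  refine Tendsto.eventually (tendsto_nhdsWithin_of_tendsto_nhds_of_eventually_within _ ?_ ?_)
    (h (x + c))
  · exact ((continuous_id.add continuous_const).tendsto x).mono_left nhdsWithin_le_nhds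
  · filter_upwards [self_mem_nhdsWithin] with z hz
    simpa using hz

/-- An entire function that vanishes on a set with an accumulation point vanishes everywhere. -/
theorem eq_zero_of_frequently {f : ℂ → ℂ} (hf : Differentiable ℂ f)
    (h : ∃ᶠ z in codiscrete ℂ, f z = 0) (z : ℂ) : f z = 0 := by
  have hf' : AnalyticOnNhd ℂ f Set.univ := fun x _ => hf.analyticAt x
  by_contra hz
  refine h (eventually_codiscrete_iff.2 fun x => ?_)
  rcases (hf.analyticAt x).eventually_eq_zero_or_eventually_ne_zero with h0 | h0
  · exact absurd (hf'.eqOn_zero_of_preconnected_of_eventuallyEq_zero isPreconnected_univ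
      (Set.mem_univ x) h0 (Set.mem_univ z)) hz
  · exact h0

theorem eventually_ne_zero {f : ℂ → ℂ} (hf : Differentiable ℂ f) {z : ℂ} (hz : f z ≠ 0) :
    ∀ᶠ z in codiscrete ℂ, f z ≠ 0 := by
  by_contra h
  exact hz (eq_zero_of_frequently hf (not_eventually.1 h |>.mono fun _ h => not_not.1 h) z)

theorem eventually_sin_ne_zero {g : ℂ → ℂ} {a c : ℂ} (ha : a ≠ 0) (h : ∀ z, g z = a * z + c) :
    ∀ᶠ z in codiscrete ℂ, Complex.sin (g z) ≠ 0 := by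
  have hd : Differentiable ℂ fun z => Complex.sin (g z) := by
    simp only [h]; fun_prop
  refine eventually_ne_zero hd (z := (Real.pi / 2 - c) / a) ?_
  simp only [h]
  rw [mul_div_cancel₀ _ ha, sub_add_cancel, Complex.sin_pi_div_two]
  exact one_ne_zero

theorem eventually_add_cos_sin_ne_zero {σ τ : ℂ} (h : σ ≠ 0 ∨ τ ≠ 0) :
    ∀ᶠ z in codiscrete ℂ, σ * Complex.cos z + τ * Complex.sin z ≠ 0 := by
  have hd : Differentiable ℂ fun z => σ * Complex.cos z + τ * Complex.sin z := by fun_prop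
  rcases h with h | h
  · exact eventually_ne_zero hd (z := 0) (by simpa using h)
  · exact eventually_ne_zero hd (z := Real.pi / 2) (by simpa using h)

/-- The spectral parameters at which the components can be simplified. -/
structure Regular (φ u v : ℂ) : Prop where
  sub : Complex.sin (u - v) ≠ 0
  add : Complex.sin (u + v) ≠ 0
  three_sub : Complex.sin (3 * φ - (u - v)) ≠ 0
  three_add : Complex.sin (3 * φ - (u + v)) ≠ 0
  two_sub : Complex.sin (2 * φ - (u - v)) ≠ 0
  one_add : Complex.sin (φ - (u + v)) ≠ 0
  two : Complex.sin (2 * v) ≠ 0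
  half : Complex.sin (v - φ / 2) ≠ 0
  half_sub : Complex.cos (v - φ / 2) ≠ 0
  half_add : Complex.cos (v + φ / 2) ≠ 0

theorem eventually_regular (φ u : ℂ) : ∀ᶠ v in codiscrete ℂ, Regular φ u v := by
  have h1 : (1 : ℂ) ≠ 0 := one_ne_zero
  have h1' : (-1 : ℂ) ≠ 0 := neg_ne_zero.2 one_ne_zero
  filter_upwards [eventually_sin_ne_zero (g := fun v => u - v) (c := u) h1' fun v => by ring,
    eventually_sin_ne_zero (g := fun v => u + v) (c := u) h1 fun v => by ring,
    eventually_sin_ne_zero (g := fun v => 3 * φ - (u - v)) (c := 3 * φ - u) h1 fun v => by ring,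
    eventually_sin_ne_zero (g := fun v => 3 * φ - (u + v)) (c := 3 * φ - u) h1' fun v => by ring,
    eventually_sin_ne_zero (g := fun v => 2 * φ - (u - v)) (c := 2 * φ - u) h1 fun v => by ring,
    eventually_sin_ne_zero (g := fun v => φ - (u + v)) (c := φ - u) h1' fun v => by ring,
    eventually_sin_ne_zero (g := fun v => 2 * v) (c := 0) two_ne_zero fun v => by ring,
    eventually_sin_ne_zero (g := fun v => v - φ / 2) (c := -φ / 2) h1 fun v => by ring,
    eventually_sin_ne_zero (g := fun v => v - φ / 2 + Real.pi / 2) (c := -φ / 2 + Real.pi / 2) h1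
      fun v => by ring,
    eventually_sin_ne_zero (g := fun v => v + φ / 2 + Real.pi / 2) (c := φ / 2 + Real.pi / 2) h1
      fun v => by ring] with v a b c d e f g h i j
  rw [Complex.sin_add_pi_div_two] at i j
  exact ⟨a, b, c, d, e, f, g, h, i, j⟩

/-- The hypothesis of the classification. -/
def Solves (φ α₁ α₂ α₃ : ℂ) (K : ℂ → BoundaryCoeffs) : Prop :=
  ∀ᶠ u in codiscrete ℂ, ∀ᶠ v in codiscrete ℂ, BYBE φ α₁ α₂ α₃ K u v

/-- The conclusion of the classification. -/
def Classified (φ α₁ α₂ α₃ : ℂ) (K : ℂ → BoundaryCoeffs) : Prop :=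
  ∃ L : ℂ → BoundaryCoeffs, IsSolution φ α₁ α₂ α₃ L ∧ ∀ᶠ u in codiscrete ℂ, K u = L u

theorem Solves.ghost {φ α₁ α₂ α₃ : ℂ} {K : ℂ → BoundaryCoeffs} (h : Solves φ α₁ α₂ α₃ K) :
    Solves φ α₂ α₁ α₃ fun u => (K u).ghost := by
  filter_upwards [h] with u hu
  filter_upwards [hu] with v hv
  rw [bybe_iff] at hv ⊢
  obtain ⟨q1, q2, q3, q4⟩ := hv
  exact ⟨q2, q1, q4, q3⟩

theorem Solves.twist {φ α₁ α₂ α₃ : ℂ} {K : ℂ → BoundaryCoeffs} (h : Solves φ α₁ α₂ α₃ K) :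
    Solves φ α₁ α₂ α₃ fun u => (K (u - Real.pi / 2)).twist := by
  filter_upwards [eventually_codiscrete_add h (-(Real.pi / 2))] with u hu
  filter_upwards [eventually_codiscrete_add hu (-(Real.pi / 2))] with v hv
  rw [← sub_eq_add_neg, ← sub_eq_add_neg] at hv
  exact bybe_twist rfl rfl (by ring) (by ring) hv

end Codiscrete

/-! ## Boundary faces with strings that end on the boundary at one node only -/

section Ends

open Complex Filter

/-- The relations between the coefficients `b₁, …, b₄` at two spectral parameters. -/
structure Proportional (k l : BoundaryCoeffs) : Prop where
  eq₁₂ : k.b₁ * l.b₂ = k.b₂ * l.b₁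
  eq₁₃ : k.b₁ * l.b₃ = k.b₃ * l.b₁
  eq₁₄ : k.b₁ * l.b₄ = k.b₄ * l.b₁
  eq₂₃ : k.b₂ * l.b₃ = k.b₃ * l.b₂
  eq₂₄ : k.b₂ * l.b₄ = k.b₄ * l.b₂
  eq₃₄ : k.b₃ * l.b₄ = k.b₄ * l.b₃

/-- The relations between the coefficients `b₅, …, b₈` at two spectral parameters. -/
structure EndsRelation (k l : BoundaryCoeffs) : Prop where
  eq₆₈ : k.b₆ * l.b₈ = k.b₈ * l.b₆
  eq₆₇ : k.b₆ * l.b₇ = k.b₇ * l.b₆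
  eq₅₇ : k.b₅ * l.b₇ = k.b₇ * l.b₅
  eq₅₈ : k.b₅ * l.b₈ = k.b₈ * l.b₅
  eq₇₈ : k.b₇ * l.b₈ = k.b₅ * l.b₆
  eq₇₇ : k.b₇ * l.b₇ = k.b₆ * l.b₆
  eq₈₇ : k.b₈ * l.b₇ = k.b₆ * l.b₅
  eq₈₈ : k.b₈ * l.b₈ = k.b₅ * l.b₅

variable {φ α₁ α₂ α₃ : ℂ} {K : ℂ → BoundaryCoeffs} {u v : ℂ}

/-- Only one pair of bulk diagrams lets all four nodes reach the boundary, with coefficient `x 4 * y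
5`. These components are therefore 2 × 2 minors of `(b₁, …, b₄)` times a nonzero factor. -/
theorem Regular.proportional (hr : Regular φ u v) (h : BYBE φ α₁ α₂ α₃ K u v) :
    Proportional (K u) (K v) := by
  obtain ⟨q1, q2, q3, q4⟩ := (bybe_iff ..).1 h
  have h4 : faceCoeff φ (u - v) 4 ≠ 0 := mul_ne_zero hr.two_sub hr.three_sub
  have h5 : faceCoeff φ (u + v) 5 ≠ 0 := neg_ne_zero.2 (mul_ne_zero hr.add hr.one_add)
  have h45 := mul_ne_zero h4 h5
  have e1 := q1.wL1L2gR2gR1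
  have e2 := q1.wL1L2gR2R1g
  have e3 := q1.wL1L2R2gR1g
  have e4 := q2.wL1L2R2gR1g
  have e5 := q1.wL1gL2R2gR1
  have e6 := q2.wL1L2gR2gR1
  simp only [BoundaryCoeffs.ghost] at e4 e6
  constructor <;> refine mul_right_cancel₀ h45 ?_
  · linear_combination e1
  · linear_combination e2
  · linear_combination e3
  · linear_combination -e4
  · linear_combination -e5
  · linear_combination e6

/-- Once the minors of `(b₁, …, b₄)` vanish, the components with a horizontal string below reduce to
minors of `(b₅, …, b₈)`. With these removed too, the corresponding components with empty lower nodes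
leave the last four relations, times `x 3 * y 2`. -/
theorem Regular.endsRelation (hs : sin (2 * φ) ≠ 0) (hr : Regular φ u v)
    (h : BYBE φ α₁ α₂ α₃ K u v) : EndsRelation (K u) (K v) := by
  have hp := hr.proportional h
  obtain ⟨q1, q2, q3, q4⟩ := (bybe_iff ..).1 h
  have h41 : faceCoeff φ (u - v) 4 * faceCoeff φ (u + v) 1 ≠ 0 :=
    mul_ne_zero (mul_ne_zero hr.two_sub hr.three_sub) (mul_ne_zero hs hr.three_add)
  have h32 : faceCoeff φ (u - v) 3 * faceCoeff φ (u + v) 2 ≠ 0 :=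
    mul_ne_zero (mul_ne_zero hr.sub hr.three_sub) (mul_ne_zero hs hr.add)
  have a1 := q1.cL2R2_wL1R1
  have a2 := q1.cL2R2_wL1gR1g
  have a3 := q2.cL2R2_wL1R1
  have a4 := q2.cL2R2_wL1gR1g
  have b1 := q1.wL1R1
  have b2 := q1.wL1gR1g
  have b3 := q2.wL1R1
  have b4 := q2.wL1gR1g
  simp only [BoundaryCoeffs.ghost] at a3 a4 b3 b4
  generalize faceCoeff φ (u - v) = x at *
  generalize faceCoeff φ (u + v) = y at *
  have e68 : (K u).b₆ * (K v).b₈ = (K u).b₈ * (K v).b₆ := by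
    refine mul_right_cancel₀ h41 ?_
    linear_combination a1 - x 4 * y 4 * (α₃ * hp.eq₁₂ - α₃ * hp.eq₁₄ - α₁ * hp.eq₂₄)
  have e67 : (K u).b₆ * (K v).b₇ = (K u).b₇ * (K v).b₆ := by
    refine mul_right_cancel₀ h41 ?_
    linear_combination a2 - x 4 * y 4 * (α₃ * hp.eq₁₃ + α₂ * hp.eq₁₄ - α₁ * hp.eq₃₄)
  have e57 : (K u).b₅ * (K v).b₇ = (K u).b₇ * (K v).b₅ := by
    refine mul_right_cancel₀ h41 ?_
    linear_combination a3 - x 4 * y 4 * (α₃ * hp.eq₃₄ + α₃ * hp.eq₂₃ + α₂ * hp.eq₂₄)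
  have e58 : (K u).b₅ * (K v).b₈ = (K u).b₈ * (K v).b₅ := by
    refine mul_right_cancel₀ h41 ?_
    linear_combination a4 - x 4 * y 4 * (-α₃ * hp.eq₁₃ - α₁ * hp.eq₂₃ - α₂ * hp.eq₁₂)
  refine ⟨e68, e67, e57, e58, ?_, ?_, ?_, ?_⟩ <;> refine mul_right_cancel₀ h32 ?_
  · linear_combination b1 - x 1 * y 0 * e68
      - x 1 * y 1 * (α₃ * hp.eq₁₂ - α₃ * hp.eq₁₄ - α₁ * hp.eq₂₄)
  · linear_combination b2 - x 1 * y 0 * e67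
      - x 1 * y 1 * (α₃ * hp.eq₁₃ + α₂ * hp.eq₁₄ - α₁ * hp.eq₃₄)
  · linear_combination b3 - x 1 * y 0 * e57
      - x 1 * y 1 * (α₃ * hp.eq₃₄ + α₃ * hp.eq₂₃ + α₂ * hp.eq₂₄)
  · linear_combination b4 - x 1 * y 0 * e58
      - x 1 * y 1 * (-α₃ * hp.eq₁₃ - α₁ * hp.eq₂₃ - α₂ * hp.eq₁₂)

/-- No string ends on the boundary at one node only. -/
def BoundaryCoeffs.IsEven (k : BoundaryCoeffs) : Prop := k.b₅ = 0 ∧ k.b₆ = 0 ∧ k.b₇ = 0 ∧ k.b₈ = 0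

theorem BoundaryCoeffs.IsEven.of_ghost {k : BoundaryCoeffs} (h : k.ghost.IsEven) : k.IsEven :=
  ⟨h.2.1, h.1, h.2.2.2, h.2.2.1⟩

/-- If only `b₇` or `b₈` survives at one parameter, it annihilates all ends at the other. So a
solution whose ends persist has `b₅ ≠ 0` or `b₆ ≠ 0` at suitable parameters. -/
theorem EndsRelation.isEven {k l : BoundaryCoeffs} (h : EndsRelation k l) (h5 : k.b₅ = 0)
    (h6 : k.b₆ = 0) (hk : ¬ k.IsEven) : l.IsEven := by
  obtain ⟨e1, e2, e3, e4, e5, e6, e7, e8⟩ := h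
  simp only [h5, h6, zero_mul, mul_eq_zero, zero_eq_mul] at e1 e2 e3 e4 e5 e6 e7 e8
  simp only [BoundaryCoeffs.IsEven, not_and_or] at hk
  rcases hk with hk | hk | hk | hk
  · exact absurd h5 hk
  · exact absurd h6 hk
  · exact ⟨e3.resolve_left hk, e2.resolve_left hk, e6.resolve_left hk, e5.resolve_left hk⟩
  · exact ⟨e4.resolve_left hk, e1.resolve_left hk, e7.resolve_left hk, e8.resolve_left hk⟩

/-- Eliminating the second parameter leaves `b₇² = b₆²` and `b₇ b₈ = b₆ b₅`, which fixes the ends at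
the right node up to one common sign. -/
theorem EndsRelation.sign {k l : BoundaryCoeffs} (h : EndsRelation k l) (hk : k.b₆ ≠ 0)
    (hl : l.b₆ ≠ 0) : ∃ ε : ℂ, (ε = 1 ∨ ε = -1) ∧ k.b₇ = ε * k.b₆ ∧ k.b₈ = ε * k.b₅ := by
  have h7 : k.b₇ ^ 2 = k.b₆ ^ 2 := by
    refine mul_right_cancel₀ hl ?_
    linear_combination -k.b₇ * h.eq₆₇ + k.b₆ * h.eq₇₇
  have h8 : k.b₇ * k.b₈ = k.b₆ * k.b₅ := by
    refine mul_right_cancel₀ hl ?_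
    linear_combination -k.b₇ * h.eq₆₈ + k.b₆ * h.eq₇₈
  rcases sq_eq_sq_iff_eq_or_eq_neg.1 h7 with e | e
  · refine ⟨1, .inl rfl, by rw [e, one_mul], mul_left_cancel₀ hk ?_⟩
    rw [e] at h8; linear_combination h8
  · refine ⟨-1, .inr rfl, by rw [e]; ring, mul_left_cancel₀ hk ?_⟩
    rw [e] at h8; linear_combination -h8

theorem EndsRelation.shape {k l : BoundaryCoeffs} (h : EndsRelation k l) (hk : k.b₆ ≠ 0)
    {ε : ℂ} (hε : ε = 1 ∨ ε = -1) (h7 : k.b₇ = ε * k.b₆) (h8 : k.b₈ = ε * k.b₅) :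
    l.b₅ = k.b₅ / k.b₆ * l.b₆ ∧ l.b₇ = ε * l.b₆ ∧ l.b₈ = ε * (k.b₅ / k.b₆ * l.b₆) := by
  have hε2 : ε * ε = 1 := by rcases hε with rfl | rfl <;> ring
  have e7 : l.b₇ = ε * l.b₆ := mul_left_cancel₀ hk (by rw [h.eq₆₇, h7]; ring)
  refine ⟨mul_left_cancel₀ hk ?_, e7, mul_left_cancel₀ hk ?_⟩
  · rw [← h.eq₈₇, h8, e7]; field_simp; linear_combination k.b₅ * l.b₆ * hε2
  · rw [h.eq₆₈, h8]; field_simp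

theorem Solves.eventually_endsRelation (hs : sin (2 * φ) ≠ 0) (h : Solves φ α₁ α₂ α₃ K) :
    ∀ᶠ u in codiscrete ℂ, ∀ᶠ v in codiscrete ℂ, EndsRelation (K u) (K v) := by
  filter_upwards [h] with u hu
  filter_upwards [hu, eventually_regular φ u] with v hv hr
  exact hr.endsRelation hs hv

theorem exists_shape_of_b₆_ne_zero {u₀ : ℂ}
    (h : ∀ᶠ v in codiscrete ℂ, EndsRelation (K u₀) (K v)) (h6 : (K u₀).b₆ ≠ 0)
    (hK : ∃ᶠ u in codiscrete ℂ, ¬ (K u).IsEven) :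
    ∃ ν ε : ℂ, (ε = 1 ∨ ε = -1) ∧ (∃ᶠ u in codiscrete ℂ, (K u).b₆ ≠ 0) ∧
      ∀ᶠ u in codiscrete ℂ,
        (K u).b₅ = ν * (K u).b₆ ∧ (K u).b₇ = ε * (K u).b₆ ∧ (K u).b₈ = ε * (ν * (K u).b₆) := by
  have hf : ∃ᶠ v in codiscrete ℂ, (K v).b₆ ≠ 0 := by
    refine (hK.and_eventually h).mono fun v ⟨hv, hr⟩ hv6 => hv ?_
    obtain ⟨e1, e2, e3, e4, e5, e6, e7, e8⟩ := hr
    simp only [hv6, mul_zero, mul_eq_zero, h6, false_or] at e1 e2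
    simp only [e2, mul_zero, zero_eq_mul, h6, false_or] at e7
    exact ⟨e7, hv6, e2, e1⟩
  obtain ⟨v₁, h61, hr1⟩ := (hf.and_eventually h).exists
  obtain ⟨ε, hε, h7, h8⟩ := hr1.sign h6 h61
  exact ⟨_, ε, hε, hf, h.mono fun v hv => hv.shape h6 hε h7 h8⟩

end Ends

/-! ### Determination of solutions I and II from their ends -/

section Ends

open Complex Filter

/-- Ptolemy's theorem in trigonometric form; it factorises the difference of coefficients in
`HasEnds.nested_eq`. -/
theorem sin_ptolemy (a s w : ℂ) :
    sin (a - s) * sin w + sin s * sin (a + w) = sin a * sin (w + s) := by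
  simp only [sin_add, sin_sub]; ring

variable {φ α₁ α₂ α₃ : ℂ} {K : ℂ → BoundaryCoeffs} {u v : ℂ}

/-- The strings that end on the boundary at one node only, normalised. -/
def HasEnds (ν : ℂ) (k : BoundaryCoeffs) : Prop :=
  k.b₅ = ν * k.b₆ ∧ k.b₇ = k.b₆ ∧ k.b₈ = ν * k.b₆

/-- Components whose words differ only by the places of ghosts differ by a multiple of `x 3 * y 3`,
which gives the linear relations among the `bᵢ (u)`. Each component then reads `b₆(v) bᵢ(u) (x₄y₅ -
x₃y₃) = b₆(u) bᵢ(v) (x₃y₂ + x₁y₅)`. The two brackets have a common factor and the cofactors `sin (v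
- φ/2)` and `sin (u - φ/2)`, so `bᵢ` is a constant multiple of `b₆ sin (u - φ/2)`. -/
theorem HasEnds.nested_eq {ν : ℂ} (hs : sin (2 * φ) ≠ 0) (hr : Regular φ u v)
    (h : BYBE φ α₁ α₂ α₃ K u v) (hu : HasEnds ν (K u)) (hv : HasEnds ν (K v)) :
    ((K v).b₆ ≠ 0 → (K u).b₁ = ν * (K u).b₄ ∧ (K u).b₂ = ν * (K u).b₃ ∧
      (K u).b₃ = ν * (K u).b₄) ∧
    ((K u).b₁ = ν * (K u).b₄ → (K u).b₂ = ν * (K u).b₃ → (K u).b₃ = ν * (K u).b₄ →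
      (K u).b₆ * sin (u - φ / 2) * (K v).b₁ = (K v).b₆ * sin (v - φ / 2) * (K u).b₁ ∧
      (K u).b₆ * sin (u - φ / 2) * (K v).b₂ = (K v).b₆ * sin (v - φ / 2) * (K u).b₂ ∧
      (K u).b₆ * sin (u - φ / 2) * (K v).b₃ = (K v).b₆ * sin (v - φ / 2) * (K u).b₃ ∧
      (K u).b₆ * sin (u - φ / 2) * (K v).b₄ = (K v).b₆ * sin (v - φ / 2) * (K u).b₄) := by
  obtain ⟨q1, q2, q3, q4⟩ := (bybe_iff ..).1 h
  obtain ⟨u5, u7, u8⟩ := hu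
  obtain ⟨v5, v7, v8⟩ := hv
  have h33 : faceCoeff φ (u - v) 3 * faceCoeff φ (u + v) 3 ≠ 0 :=
    mul_ne_zero (mul_ne_zero hr.sub hr.three_sub) (mul_ne_zero hr.add hr.three_add)
  have t4 := q1.wL1gL2gR2g
  have t1 := q1.wL1gL2R2
  have t3 := q4.wL1gL2R2
  have t2 := q1.wL1L2gR2
  have t2' := q1.wL1L2R2g
  have t3' := q4.wL1L2R2g
  have t2'' := q2.wL1gL2R2
  simp only [BoundaryCoeffs.ghost, BoundaryCoeffs.flip, u5, u7, u8, v5, v7, v8] at *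
  have hd : 2 * sin (2 * φ) * cos (v - φ / 2) * sin (3 * φ - (u - v)) * sin (u + v) ≠ 0 :=
    mul_ne_zero (mul_ne_zero (mul_ne_zero (mul_ne_zero two_ne_zero hs) hr.half_sub) hr.three_sub)
      hr.add
  have e1 : faceCoeff φ (u - v) 4 * faceCoeff φ (u + v) 5
      - faceCoeff φ (u - v) 3 * faceCoeff φ (u + v) 3
      = 2 * sin (2 * φ) * cos (v - φ / 2) * sin (3 * φ - (u - v)) * sin (u + v)
        * sin (v - φ / 2) := by
    have p := sin_ptolemy (2 * φ) (u - v) (φ - (u + v))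
    have p' : sin (φ - (u + v) + (u - v)) = -(2 * sin (v - φ / 2) * cos (v - φ / 2)) := by
      rw [← sin_two_mul, ← sin_neg]; congr 1; ring
    have p'' : 2 * φ + (φ - (u + v)) = 3 * φ - (u + v) := by ring
    rw [p', p''] at p
    simp only [faceCoeff]
    linear_combination -sin (3 * φ - (u - v)) * sin (u + v) * p
  have e2 : faceCoeff φ (u - v) 3 * faceCoeff φ (u + v) 2
      + faceCoeff φ (u - v) 1 * faceCoeff φ (u + v) 5
      = 2 * sin (2 * φ) * cos (v - φ / 2) * sin (3 * φ - (u - v)) * sin (u + v)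
        * sin (u - φ / 2) := by
    have p := sin_sub_sin (u - v) (φ - (u + v))
    have p' : (u - v - (φ - (u + v))) / 2 = u - φ / 2 := by ring
    have p'' : (u - v + (φ - (u + v))) / 2 = -(v - φ / 2) := by ring
    rw [p', p'', cos_neg] at p
    simp only [faceCoeff]
    linear_combination sin (2 * φ) * sin (3 * φ - (u - v)) * sin (u + v) * p
  generalize faceCoeff φ (u - v) = x at *
  generalize faceCoeff φ (u + v) = y at *
  constructor
  · intro hv6
    have hne := mul_ne_zero hv6 h33
    refine ⟨mul_left_cancel₀ hne ?_, mul_left_cancel₀ hne ?_, mul_left_cancel₀ hne ?_⟩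
    · linear_combination ν * t4 - t1
    · linear_combination ν * t2' - t2
    · linear_combination ν * t4 - t3
  · intro h1 h2 h3
    refine ⟨mul_left_cancel₀ hd ?_, mul_left_cancel₀ hd ?_, mul_left_cancel₀ hd ?_,
      mul_left_cancel₀ hd ?_⟩
    · have h13 : (K u).b₁ = (K u).b₃ := h1.trans h3.symm
      linear_combination (K v).b₆ * x 3 * y 3 * h13 - t2' + (K v).b₆ * (K u).b₁ * e1
        - (K u).b₆ * (K v).b₁ * e2
    · linear_combination (K v).b₆ * x 3 * y 3 * h2 - t2'' + (K v).b₆ * (K u).b₂ * e1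
        - (K u).b₆ * (K v).b₂ * e2
    · have h13 : (K u).b₃ = (K u).b₁ := h3.trans h1.symm
      linear_combination (K v).b₆ * x 3 * y 3 * h13 - t3' + (K v).b₆ * (K u).b₃ * e1
        - (K u).b₆ * (K v).b₃ * e2
    · linear_combination -t4 + (K v).b₆ * (K u).b₄ * e1 - (K u).b₆ * (K v).b₄ * e2

/-- If `b₄` vanished, so would `b₁, b₂, b₃` and the needed coefficients at `v`. One component would
then consist of two products of ends, whose sum factorises into nonzero sines and cosines. -/
theorem HasEnds.b₄_ne_zero {ν : ℂ} (hs : sin (2 * φ) ≠ 0) (hr : Regular φ u v)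
    (hu2 : sin (u - φ / 2) ≠ 0)
    (h : BYBE φ α₁ α₂ α₃ K u v) (hu : HasEnds ν (K u)) (hv : HasEnds ν (K v))
    (hu6 : (K u).b₆ ≠ 0) (hv6 : (K v).b₆ ≠ 0) (h1 : (K u).b₁ = ν * (K u).b₄)
    (h2 : (K u).b₂ = ν * (K u).b₃) (h3 : (K u).b₃ = ν * (K u).b₄) : (K u).b₄ ≠ 0 := by
  intro h4
  obtain ⟨-, -, k3, k4⟩ := (HasEnds.nested_eq hs hr h hu hv).2 h1 h2 h3
  rw [h4, mul_zero] at h3 h1 k4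
  rw [h3, mul_zero] at h2 k3
  have hne := mul_ne_zero hu6 hu2
  have t := ((bybe_iff ..).1 h).1.cL1L2_wR2gR1g
  rw [hu.2.1, hv.2.1, h1, h2, h3, h4, (mul_eq_zero.1 k3).resolve_left hne,
    (mul_eq_zero.1 k4).resolve_left hne] at t
  have p := sin_sub_sin (u + v) (φ - (u - v))
  have p' : (u + v - (φ - (u - v))) / 2 = u - φ / 2 := by ring
  have p'' : (u + v + (φ - (u - v))) / 2 = v + φ / 2 := by ring
  rw [p', p''] at p
  simp only [faceCoeff] at t
  have e : (K u).b₆ * (K v).b₆ * sin (2 * φ) * sin (u - v) * sin (3 * φ - (u + v))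
      * (2 * sin (u - φ / 2) * cos (v + φ / 2)) = 0 := by
    rw [← p]; linear_combination t
  simp [hu6, hv6, hs, hr.sub, hr.three_add, hu2, hr.half_add] at e

/-- The difference of two solutions with the same coefficients `bᵢ`. -/
theorem HasEnds.difference {ν k : ℂ} {L : ℂ → BoundaryCoeffs} (hs : sin (2 * φ) ≠ 0) (hk : k ≠ 0)
    (hr : Regular φ u v) (h : BYBE φ α₁ α₂ α₃ K u v) (h' : BYBE φ α₁ α₂ α₃ L u v)
    (hu : HasEnds ν (K u)) (hv : HasEnds ν (K v))
    (hu4 : (K u).b₄ = k * (K u).b₆ * sin (u - φ / 2))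
    (hv4 : (K v).b₄ = k * (K v).b₆ * sin (v - φ / 2))
    (hKu : K u = { L u with a₁ := (K u).a₁, a₂ := (K u).a₂ })
    (hKv : K v = { L v with a₁ := (K v).a₁, a₂ := (K v).a₂ }) :
    ((K u).a₁ - (L u).a₁) * (K v).b₆ * sin (u + v) + ((K u).a₂ - (L u).a₂) * (K v).b₆ * sin (u - v)
      = ((K v).a₁ - (L v).a₁) * (K u).b₆ * sin (2 * v) ∧
    (K u).b₆ * sin (u - φ / 2)
      * (((K v).a₂ - (L v).a₂) * sin (u + v) - ((K v).a₁ - (L v).a₁) * sin (u - v))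
      = (K v).b₆ * sin (v - φ / 2)
        * (((K u).a₁ - (L u).a₁) * sin (u - v) + ((K u).a₂ - (L u).a₂) * sin (u + v)) := by
  have q := ((bybe_iff ..).1 h).1
  have q' := ((bybe_iff ..).1 h').1
  have s1 := q.cL1R2_wR1g
  have s1' := q'.cL1R2_wR1g
  have s2 := q.wL1gR2g
  have s2' := q'.wL1gR2g
  simp only [BoundaryCoeffs.ext_iff] at hKu hKv
  obtain ⟨-, -, u1, u2, u3, u4, u5, u6, u7, u8⟩ := hKu
  obtain ⟨-, -, v1, v2, v3, v4, v5, v6, v7, v8⟩ := hKv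
  rw [← u7, ← u8, ← v7, ← v3, ← v4] at s1'
  rw [← u4, ← v4, ← v1, ← u3, ← u7, ← v6] at s2'
  rw [hu.2.1, hv.2.1] at s1 s1'
  rw [hu4, hv4] at s2 s2'
  have hne : sin (2 * φ) * sin (3 * φ - (u - v)) * sin (3 * φ - (u + v)) ≠ 0 :=
    mul_ne_zero (mul_ne_zero hs hr.three_sub) hr.three_add
  have p : sin (u - v) * sin (2 * φ - (u + v)) - sin (2 * φ - (u - v)) * sin (u + v)
      = -sin (2 * φ) * sin (2 * v) := by
    rw [show 2 * v = u + v - (u - v) by ring]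
    simp only [sin_sub _ (u - v), sin_sub _ (u + v)]; ring
  simp only [faceCoeff] at s1 s1' s2 s2'
  -- Both components are linear in `a₁` and `a₂` apart from terms in the `bᵢ` alone, which the two
  -- solutions share; subtraction leaves homogeneous relations.
  constructor
  · refine mul_left_cancel₀ hne ?_
    linear_combination s1 - s1' - sin (3 * φ - (u - v)) * sin (3 * φ - (u + v)) * (K u).b₆
      * ((K v).a₁ - (L v).a₁) * p
  · refine mul_left_cancel₀ (mul_ne_zero hne hk) ?_
    linear_combination s2 - s2'

/-- The first relation at a fixed `u` gives `f(v) sin 2v = c(v) (A cos v + B sin v)`, where `A` and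
`B` are `(f + g) sin / c` and `(f - g) cos / c` at `u`; comparing two choices of `u` shows that they
are constants. By the second relation `sin (v - φ/2) (A cos v - B sin v)` is then constant in `v`,
and this forces `A = B = 0`. -/
theorem difference_eq_zero {c f g : ℂ → ℂ} (hc : ∃ᶠ u in codiscrete ℂ, c u ≠ 0) (hs : sin φ ≠ 0)
    (h : ∀ᶠ u in codiscrete ℂ, ∀ᶠ v in codiscrete ℂ,
      f u * c v * sin (u + v) + g u * c v * sin (u - v) = f v * c u * sin (2 * v) ∧
      c u * sin (u - φ / 2) * (g v * sin (u + v) - f v * sin (u - v))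
        = c v * sin (v - φ / 2) * (f u * sin (u - v) + g u * sin (u + v))) :
    ∀ᶠ u in codiscrete ℂ, f u = 0 ∧ g u = 0 := by
  have hf : ∀ᶠ u in codiscrete ℂ, sin (2 * u) ≠ 0 ∧ sin (u - φ / 2) ≠ 0 :=
    (eventually_regular φ 0).mono fun u hu => ⟨hu.two, hu.half⟩
  obtain ⟨u, hu, hc0, hu2⟩ := (hc.and_eventually (h.and hf)).exists
  have first (w : ℂ) (hw : ∀ᶠ v in codiscrete ℂ,
      f w * c v * sin (w + v) + g w * c v * sin (w - v) = f v * c w * sin (2 * v) ∧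
      c w * sin (w - φ / 2) * (g v * sin (w + v) - f v * sin (w - v))
        = c v * sin (v - φ / 2) * (f w * sin (w - v) + g w * sin (w + v))) :
      ∀ᶠ v in codiscrete ℂ, c v * ((f w + g w) * sin w * cos v + (f w - g w) * cos w * sin v)
        = f v * c w * sin (2 * v) := by
    filter_upwards [hw] with v hv
    rw [← hv.1, sin_add, sin_sub]; ring
  have zero : ∃ᶠ v in codiscrete ℂ, sin (u - φ / 2) * (cos u * ((f u + g u) * sin u)
      - sin u * ((f u - g u) * cos u)) - sin (v - φ / 2) *
        ((f u + g u) * sin u * cos v - (f u - g u) * cos u * sin v) = 0 := by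
    refine (hc.and_eventually (hc0.and h)).mono fun v ⟨hv, ⟨_, huv⟩, hv0⟩ => ?_
    -- The expressions for `f z` obtained from `u` and from `v` are compared; a combination of `cos
    -- z` and `sin z` with that many zeros has zero coefficients.
    have key : ∃ᶠ z in codiscrete ℂ,
        ((f u + g u) * sin u * c v - (f v + g v) * sin v * c u) * cos z
          + ((f u - g u) * cos u * c v - (f v - g v) * cos v * c u) * sin z = 0 := by
      refine (hc.and_eventually ((first u hc0).and (first v hv0))).mono fun z ⟨hz, h1, h2⟩ => ?_
      refine mul_left_cancel₀ hz ?_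
      linear_combination c v * h1 - c u * h2
    have e1 : (f u + g u) * sin u * c v - (f v + g v) * sin v * c u = 0 := by
      by_contra hne
      exact key ((eventually_add_cos_sin_ne_zero (.inl hne)).mono fun _ h => h)
    have e2 : (f u - g u) * cos u * c v - (f v - g v) * cos v * c u = 0 := by
      by_contra hne
      exact key ((eventually_add_cos_sin_ne_zero (.inr hne)).mono fun _ h => h)
    refine mul_left_cancel₀ hv ?_
    rw [sin_add u v, sin_sub u v] at huv
    linear_combination sin (u - φ / 2) * (cos u * e1 - sin u * e2) + huv
  have hE := eq_zero_of_frequently (by fun_prop) zero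
  have hh : 2 * sin (φ / 2) * cos (φ / 2) ≠ 0 := by
    rw [← sin_two_mul, mul_div_cancel₀ _ two_ne_zero]; exact hs
  -- At `φ / 2` the variable term vanishes, so the constant is zero. The points `0` and `π / 2` then
  -- isolate the two coefficients.
  have h0 := hE (φ / 2)
  rw [sub_self, sin_zero, zero_mul, sub_zero] at h0
  have hA : (f u + g u) * sin u = 0 := by
    have := hE 0
    rw [h0, zero_sub, zero_sub, sin_neg, cos_zero, sin_zero] at this
    have h' : sin (φ / 2) * ((f u + g u) * sin u) = 0 := by linear_combination this
    exact (mul_eq_zero.1 h').resolve_left (right_ne_zero_of_mul (left_ne_zero_of_mul hh))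
  have hB : (f u - g u) * cos u = 0 := by
    have := hE (Real.pi / 2)
    rw [h0, zero_sub, sin_pi_div_two_sub, cos_pi_div_two, sin_pi_div_two] at this
    have h' : cos (φ / 2) * ((f u - g u) * cos u) = 0 := by linear_combination this
    exact (mul_eq_zero.1 h').resolve_left (right_ne_zero_of_mul hh)
  filter_upwards [first u hc0, hc0, eventually_regular φ u] with v h1 h2 hr
  rw [hA, hB, zero_mul, zero_mul, add_zero, mul_zero, eq_comm] at h1
  have hfv : f v = 0 := by simpa [hu, hr.two] using h1
  refine ⟨hfv, ?_⟩
  have h3 := h2.2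
  rw [hfv, sin_add u v, sin_sub u v] at h3
  have h4 : c u * sin (u - φ / 2) * (g v * sin (u + v)) = 0 := by
    rw [sin_add]
    linear_combination h3 + c v * sin (v - φ / 2) * (cos v * hA - sin v * hB)
  simpa [hu, hu2.2, hr.add] using h4

theorem exists_solutionI (hs : sin (2 * φ) ≠ 0) (hc : cos (2 * φ) ≠ 0) (h : Solves φ α₁ α₂ α₃ K)
    {ν : ℂ} (hE : ∀ᶠ u in codiscrete ℂ, HasEnds ν (K u))
    (h6 : ∃ᶠ u in codiscrete ℂ, (K u).b₆ ≠ 0) :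
    ∃ (μ ν : ℂ) (b : ℂ → ℂ), ∀ᶠ u in codiscrete ℂ, K u = solutionI φ α₁ α₂ α₃ μ ν b u := by
  have hs1 : sin φ ≠ 0 := fun h0 => hs (by rw [sin_two_mul, h0, mul_zero, zero_mul])
  have hf : ∀ᶠ u in codiscrete ℂ, sin (2 * u) ≠ 0 ∧ sin (u - φ / 2) ≠ 0 :=
    (eventually_regular φ 0).mono fun u hu => ⟨hu.two, hu.half⟩
  obtain ⟨u, hu6, ⟨hu, huE⟩, -, hu2⟩ := (h6.and_eventually ((h.and hE).and hf)).exists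
  have huv := hu.and (hE.and (eventually_regular φ u))
  obtain ⟨v, hv6, hv, hvE, hr⟩ := (h6.and_eventually huv).exists
  obtain ⟨h1, h2, h3⟩ := (HasEnds.nested_eq hs hr hv huE hvE).1 hv6
  have h4 := HasEnds.b₄_ne_zero hs hr hu2 hv huE hvE hu6 hv6 h1 h2 h3
  -- In solution I one has `b₆ = μ b` and `b₄ = μ² b sin (u - φ/2)`, so this ratio `k` has to be
  -- `μ`; the function is then `b₆ / k`.
  obtain ⟨k, hk⟩ : ∃ k, (K u).b₄ = k * (K u).b₆ * sin (u - φ / 2) :=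
    ⟨(K u).b₄ / ((K u).b₆ * sin (u - φ / 2)), by
      rw [mul_assoc, div_mul_cancel₀ _ (mul_ne_zero hu6 hu2)]⟩
  have hk0 : k ≠ 0 := by
    rintro rfl
    exact h4 (by rw [hk, zero_mul, zero_mul])
  have hne := mul_ne_zero hu6 hu2
  have hN : ∀ᶠ v in codiscrete ℂ, HasEnds ν (K v) ∧
      (K v).b₄ = k * (K v).b₆ * sin (v - φ / 2) ∧
      K v = { solutionI φ α₁ α₂ α₃ k (k * ν) (fun z => (K z).b₆ / k) v with
        a₁ := (K v).a₁, a₂ := (K v).a₂ } := by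
    filter_upwards [huv] with v ⟨hv, hvE, hr⟩
    obtain ⟨k1, k2, k3, k4⟩ := (HasEnds.nested_eq hs hr hv huE hvE).2 h1 h2 h3
    rw [h1, hk] at k1
    rw [h2, h3, hk] at k2
    rw [h3, hk] at k3
    rw [hk] at k4
    have e1 : (K v).b₁ = ν * (k * (K v).b₆ * sin (v - φ / 2)) :=
      mul_left_cancel₀ hne (by linear_combination k1)
    have e2 : (K v).b₂ = ν * (ν * (k * (K v).b₆ * sin (v - φ / 2))) :=
      mul_left_cancel₀ hne (by linear_combination k2)
    have e3 : (K v).b₃ = ν * (k * (K v).b₆ * sin (v - φ / 2)) :=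
      mul_left_cancel₀ hne (by linear_combination k3)
    have e4 : (K v).b₄ = k * (K v).b₆ * sin (v - φ / 2) :=
      mul_left_cancel₀ hne (by linear_combination k4)
    refine ⟨hvE, e4, ?_⟩
    obtain ⟨v5, v7, v8⟩ := hvE
    ext <;> simp only [solutionI]
    · rw [e1]; field_simp
    · rw [e2]; field_simp
    · rw [e3]; field_simp
    · rw [e4]; field_simp
    · rw [v5]; field_simp
    · field_simp
    · rw [v7]; field_simp
    · rw [v8]; field_simp
  refine ⟨k, k * ν, fun z => (K z).b₆ / k, ?_⟩
  have key := difference_eq_zero (c := fun z => (K z).b₆)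
    (f := fun z => (K z).a₁ - (solutionI φ α₁ α₂ α₃ k (k * ν) (fun z => (K z).b₆ / k) z).a₁)
    (g := fun z => (K z).a₂ - (solutionI φ α₁ α₂ α₃ k (k * ν) (fun z => (K z).b₆ / k) z).a₂)
    h6 hs1 ?_
  · filter_upwards [key, hN] with v ⟨h1, h2⟩ ⟨_, _, h3⟩
    rw [h3, sub_eq_zero.1 h1, sub_eq_zero.1 h2]
  · filter_upwards [h, hN, hf] with u hu ⟨huE, hu4, hKu⟩ hu2
    filter_upwards [hu, hN, hf, eventually_regular φ u] with v hv ⟨hvE, hv4, hKv⟩ hv2 hr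
    exact HasEnds.difference hs hk0 hr hv (bybe_of_isSolution φ α₁ α₂ α₃ hs hc
      (.inl ⟨_, _, _, rfl⟩) hu2.1 hv2.1) huE hvE hu4 hv4 hKu hKv

theorem classified_of_b₆_ne_zero (hs : sin (2 * φ) ≠ 0) (hc : cos (2 * φ) ≠ 0)
    (h : Solves φ α₁ α₂ α₃ K) {u₀ : ℂ} (h0 : ∀ᶠ v in codiscrete ℂ, EndsRelation (K u₀) (K v))
    (h6 : (K u₀).b₆ ≠ 0) (hK : ∃ᶠ u in codiscrete ℂ, ¬ (K u).IsEven) :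
    (∃ (μ ν : ℂ) (b : ℂ → ℂ), ∀ᶠ u in codiscrete ℂ, K u = solutionI φ α₁ α₂ α₃ μ ν b u) ∨
    ∃ (μ ν : ℂ) (b : ℂ → ℂ), ∀ᶠ u in codiscrete ℂ, K u = solutionII φ α₁ α₂ α₃ μ ν b u := by
  obtain ⟨ν, ε, rfl | rfl, hf, hE⟩ := exists_shape_of_b₆_ne_zero h0 h6 hK
  · refine .inl (exists_solutionI hs hc h (ν := ν) ?_ hf)
    filter_upwards [hE] with u ⟨h5, h7, h8⟩
    exact ⟨h5, by rw [h7, one_mul], by rw [h8, one_mul]⟩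
  -- For the negative sign, the twist changes the signs of `b₇` and `b₈`, and the twisted solution
  -- belongs to family I.
  · have hf' : ∃ᶠ u in codiscrete ℂ, (K (u - Real.pi / 2)).twist.b₆ ≠ 0 := by
      intro hn
      refine hf ((eventually_codiscrete_add hn (Real.pi / 2)).mono fun u hu => ?_)
      simpa [BoundaryCoeffs.twist] using hu
    obtain ⟨μ, ν', b, hb⟩ := exists_solutionI hs hc h.twist (ν := ν) (by
      filter_upwards [eventually_codiscrete_add hE (-(Real.pi / 2))] with u ⟨h5, h7, h8⟩
      rw [← sub_eq_add_neg] at h5 h7 h8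
      simp only [HasEnds, BoundaryCoeffs.twist]
      exact ⟨h5, by rw [h7]; ring, by rw [h8]; ring⟩) hf'
    refine .inr ⟨μ, ν', fun z => b (z + Real.pi / 2), ?_⟩
    filter_upwards [eventually_codiscrete_add hb (Real.pi / 2)] with u hu
    rw [add_sub_cancel_right] at hu
    simp only [solutionII_eq, sub_add_cancel]
    rw [← hu, BoundaryCoeffs.twist_twist]

/-- Adding ghosts exchanges `b₅` with `b₆`, and `μ` with `ν` in the two families. So one may assume
`b₆ ≠ 0` at a suitable parameter. -/
theorem classified_of_not_isEven (hs : sin (2 * φ) ≠ 0) (hc : cos (2 * φ) ≠ 0)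
    (h : Solves φ α₁ α₂ α₃ K) (hK : ∃ᶠ u in codiscrete ℂ, ¬ (K u).IsEven) :
    Classified φ α₁ α₂ α₃ K := by
  have hK' : ∃ᶠ u in codiscrete ℂ, ¬ (K u).ghost.IsEven := hK.mono fun u hu h => hu h.of_ghost
  obtain ⟨u, hu, h1, h2⟩ := (hK.and_eventually
    ((h.eventually_endsRelation hs).and (h.ghost.eventually_endsRelation hs))).exists
  by_cases h6 : (K u).b₆ = 0
  · have h5 : (K u).b₅ ≠ 0 := by
      intro h5
      obtain ⟨v, hv, hv'⟩ := (hK.and_eventually h1).exists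
      exact hv (hv'.isEven h5 h6 hu)
    rcases classified_of_b₆_ne_zero hs hc h.ghost h2 h5 hK' with ⟨μ, ν, b, hb⟩ | ⟨μ, ν, b, hb⟩
    · refine ⟨_, .inl ⟨ν, μ, b, rfl⟩, hb.mono fun u hu => ?_⟩
      rw [show K u = (K u).ghost.ghost from rfl, hu]
      simp only [solutionI, BoundaryCoeffs.ghost, mul_comm μ ν, add_comm α₁ α₂,
        add_comm (μ ^ 2) (ν ^ 2)]
    · refine ⟨_, .inr (.inl ⟨ν, μ, b, rfl⟩), hb.mono fun u hu => ?_⟩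
      rw [show K u = (K u).ghost.ghost from rfl, hu]
      simp only [solutionII, BoundaryCoeffs.ghost, mul_comm μ ν, add_comm α₁ α₂,
        add_comm (μ ^ 2) (ν ^ 2)]
  · rcases classified_of_b₆_ne_zero hs hc h h1 h6 hK with ⟨μ, ν, b, hb⟩ | ⟨μ, ν, b, hb⟩
    · exact ⟨_, .inl ⟨μ, ν, b, rfl⟩, hb⟩
    · exact ⟨_, .inr (.inl ⟨μ, ν, b, rfl⟩), hb⟩

end Ends

/-! ## Boundary faces on which every string has both ends at nodes -/

section NoBoundaryStrings

open Complex Filter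

variable {φ α₁ α₂ α₃ : ℂ} {K : ℂ → BoundaryCoeffs} {u v : ℂ}

theorem Regular.arc_empty (hs : sin (2 * φ) ≠ 0) (hr : Regular φ u v) {f g F G : ℂ}
    (h : f * G * faceCoeff φ (u - v) 1 * faceCoeff φ (u + v) 3
        + g * G * faceCoeff φ (u - v) 3 * faceCoeff φ (u + v) 1
        - f * F * faceCoeff φ (u - v) 3 * faceCoeff φ (u + v) 1
        - g * F * faceCoeff φ (u - v) 1 * faceCoeff φ (u + v) 3 = 0) :
    (f * G - g * F) * sin (u + v) + (g * G - f * F) * sin (u - v) = 0 := by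
  have hne : sin (2 * φ) * sin (3 * φ - (u - v)) * sin (3 * φ - (u + v)) ≠ 0 :=
    mul_ne_zero (mul_ne_zero hs hr.three_sub) hr.three_add
  refine mul_left_cancel₀ hne ?_
  simp only [faceCoeff] at h
  linear_combination h

/-- The coefficients of `∅` in the products with a boundary arc below. -/
theorem arc_only_eq (φ σ τ : ℂ)
    (hu : σ * cos (u - φ) + τ * sin (u - φ) ≠ 0) (hv : σ * cos (v - φ) + τ * sin (v - φ) ≠ 0)
    {f g F G : ℂ} (hf : f = σ * cos u + τ * sin u) (hg : g = σ * cos u - τ * sin u)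
    (hF : F = σ * cos v + τ * sin v) (hG : G = σ * cos v - τ * sin v) :
    g * G * faceCoeff φ (u - v) 2 * faceCoeff φ (u + v) 0
      + f * G * faceCoeff φ (u - v) 4 * faceCoeff φ (u + v) 2
      + -2 * cos (4 * φ) * f * G * faceCoeff φ (u - v) 5 * faceCoeff φ (u + v) 2
      - g * F * faceCoeff φ (u - v) 0 * faceCoeff φ (u + v) 2
      - f * F * faceCoeff φ (u - v) 2 * faceCoeff φ (u + v) 4
      - -2 * cos (4 * φ) * f * F * faceCoeff φ (u - v) 2 * faceCoeff φ (u + v) 5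
      = P σ τ (-3 * φ) * (sin (2 * φ) * sin (u - v) * sin (u + v) * sin (2 * u) * sin (2 * v)) := by
  -- The relation known for faces with both nodes joined to the boundary contains the left side
  -- times two common factors. Its `kap` terms, evaluated in `h2`, become the right side.
  have h := (evenPair_sin φ σ τ 1 u v).arc_only
  rw [← hf, ← hg, ← hF, ← hG] at h
  have e : G * sin (φ - (u - v)) - F * sin (φ - (u + v))
      = sin (2 * v) * (σ * cos (u - φ) + τ * sin (u - φ)) := by
    rw [hF, hG, show φ - (u - v) = v - (u - φ) by ring, show φ - (u + v) = -(u - φ) - v by ring]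
    simp only [sin_sub _ v, sin_sub v, sin_neg, cos_neg, sin_two_mul]
    ring
  have h2 : faceCoeff φ (u - v) 5 * faceCoeff φ (u + v) 2 * G
      - faceCoeff φ (u - v) 2 * faceCoeff φ (u + v) 5 * F
      = -(sin (2 * φ) * sin (u - v) * sin (u + v))
        * (sin (2 * v) * (σ * cos (u - φ) + τ * sin (u - φ))) := by
    rw [← e]
    simp only [faceCoeff]
    ring
  refine mul_left_cancel₀ (mul_ne_zero hu hv) ?_
  linear_combination h - P σ τ (-3 * φ) * sin (2 * u) * (σ * cos (v - φ) + τ * sin (v - φ)) * h2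

/-- Double angles split `P(-3φ)` into two linear forms in `σ, τ`; the zeros of the one lead to
solution I and those of the other to solution II. -/
theorem P_neg_three_mul (σ τ φ : ℂ) : P σ τ (-3 * φ)
    = -2 * (σ * cos (3 * φ / 2) + τ * sin (3 * φ / 2))
      * (σ * sin (3 * φ / 2) - τ * cos (3 * φ / 2)) := by
  rw [P, show -3 * φ = -(2 * (3 * φ / 2)) by ring, cos_neg, sin_neg, sin_two_mul, cos_two_mul']
  ring

/-- At a fixed `u` the relation is linear in `(a₁ v, a₂ v)`. Expanding the sines shows that it
prescribes the ratio of `σ cos v + τ sin v` to `σ cos v - τ sin v` with the constants chosen below.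
-/
theorem exists_ratio {a₁ a₂ : ℂ → ℂ} {u : ℂ} (hu : sin (2 * u) ≠ 0)
    (ha : a₁ u ≠ 0 ∨ a₂ u ≠ 0)
    (h : ∀ᶠ v in codiscrete ℂ, (a₁ u * a₂ v - a₂ u * a₁ v) * sin (u + v)
      + (a₂ u * a₂ v - a₁ u * a₁ v) * sin (u - v) = 0) :
    ∃ (σ τ : ℂ) (b : ℂ → ℂ), (σ ≠ 0 ∨ τ ≠ 0) ∧ ∀ᶠ v in codiscrete ℂ,
      a₁ v = b v * (σ * cos v + τ * sin v) ∧ a₂ v = b v * (σ * cos v - τ * sin v) := by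
  rw [sin_two_mul] at hu
  have hsu := right_ne_zero_of_mul (left_ne_zero_of_mul hu)
  have hcu := right_ne_zero_of_mul hu
  have hne : (a₁ u + a₂ u) * sin u ≠ 0 ∨ (a₁ u - a₂ u) * cos u ≠ 0 := by
    by_contra! hn
    have e1 := (mul_eq_zero.1 hn.1).resolve_right hsu
    have e2 := (mul_eq_zero.1 hn.2).resolve_right hcu
    rcases ha with ha | ha
    · exact ha (by linear_combination (e1 + e2) / 2)
    · exact ha (by linear_combination (e1 - e2) / 2)
  refine ⟨(a₁ u + a₂ u) * sin u, (a₁ u - a₂ u) * cos u, fun v => a₁ v /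
    ((a₁ u + a₂ u) * sin u * cos v + (a₁ u - a₂ u) * cos u * sin v), hne, ?_⟩
  filter_upwards [h, eventually_add_cos_sin_ne_zero hne] with v hv hv0
  refine ⟨by rw [div_mul_cancel₀ _ hv0], ?_⟩
  rw [div_mul_eq_mul_div, eq_div_iff hv0]
  rw [sin_add, sin_sub] at hv
  linear_combination hv

theorem classified_of_no_ends (hs : sin (2 * φ) ≠ 0) (h : Solves φ α₁ α₂ α₃ K)
    (hK : ∀ᶠ u in codiscrete ℂ, K u = ⟨(K u).a₁, (K u).a₂, 0, 0, 0, 0, 0, 0, 0, 0⟩) :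
    Classified φ α₁ α₂ α₃ K := by
  by_cases ha : ∃ᶠ u in codiscrete ℂ, (K u).a₁ ≠ 0 ∨ (K u).a₂ ≠ 0
  swap
  · refine ⟨_, .inl ⟨0, 0, 0, rfl⟩, ?_⟩
    filter_upwards [hK, not_frequently.1 ha] with u hu hu'
    rw [not_or, not_not, not_not] at hu'
    rw [hu, hu'.1, hu'.2]
    ext <;> simp [solutionI]
  have hf : ∀ᶠ u in codiscrete ℂ, sin (2 * u) ≠ 0 :=
    (eventually_regular φ 0).mono fun u hu => hu.two
  obtain ⟨u, hau, ⟨hu, hKu⟩, hu2⟩ := (ha.and_eventually ((h.and hK).and hf)).exists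
  obtain ⟨σ, τ, b, hne, hb⟩ := exists_ratio (a₁ := fun u => (K u).a₁) (a₂ := fun u => (K u).a₂)
    hu2 hau (by
      filter_upwards [hu, hK, eventually_regular φ u] with v hv hKv hr
      have t := ((bybe_iff ..).1 hv).1.cL1R2_w
      rw [hKu, hKv] at t
      exact hr.arc_empty hs (by linear_combination t))
  have hb0 : ∃ᶠ u in codiscrete ℂ, b u ≠ 0 := by
    refine (ha.and_eventually hb).mono fun u ⟨h1, h2, h3⟩ h0 => ?_
    rw [h2, h3, h0] at h1
    simp at h1
  -- The component with an arc on the left and an empty boundary equals `P(-3φ)` times factors that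
  -- do not vanish at suitable parameters.
  have hP : P σ τ (-3 * φ) = 0 := by
    have hn : ∀ᶠ u in codiscrete ℂ, σ * cos (u - φ) + τ * sin (u - φ) ≠ 0 := by
      filter_upwards [eventually_codiscrete_add (eventually_add_cos_sin_ne_zero hne) (-φ)] with u hu
      rwa [← sub_eq_add_neg] at hu
    obtain ⟨u, hbu, ⟨hu, hKu⟩, ⟨hu2, hun⟩, hfu, hgu⟩ :=
      (hb0.and_eventually ((h.and hK).and ((hf.and hn).and hb))).exists
    obtain ⟨v, hbv, ⟨hv, hKv⟩, ⟨hr, hvn⟩, hfv, hgv⟩ :=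
      (hb0.and_eventually ((hu.and hK).and (((eventually_regular φ u).and hn).and hb))).exists
    have t := ((bybe_iff ..).1 hv).1.cL1L2_w
    rw [hKu, hKv] at t
    simp only at t hfu hgu hfv hgv
    rw [hfu, hgu, hfv, hgv] at t
    have e := arc_only_eq φ σ τ hun hvn rfl rfl rfl rfl
    have e' : b u * b v * (P σ τ (-3 * φ)
        * (sin (2 * φ) * sin (u - v) * sin (u + v) * sin (2 * u) * sin (2 * v))) = 0 := by
      rw [← e]
      linear_combination t
    simpa [hbu, hbv, hs, hr.sub, hr.add, hu2, hr.two] using e'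
  have hc : cos φ ≠ 0 := fun h0 => hs (by rw [sin_two_mul, h0, mul_zero])
  have hsc := sin_sq_add_cos_sq (3 * φ / 2)
  rw [P_neg_three_mul, mul_eq_zero, mul_eq_zero, or_iff_right (neg_ne_zero.2 two_ne_zero)] at hP
  rcases hP with hP | hP
  -- The vector `(σ, τ)` is orthogonal to `(cos (3φ/2), sin (3φ/2))`, hence equals `ρ (sin (3φ/2),
  -- -cos (3φ/2))`, and `σ cos v + τ sin v = -ρ sin (v - 3φ/2)`.
  · have e1 : σ = (σ * sin (3 * φ / 2) - τ * cos (3 * φ / 2)) * sin (3 * φ / 2) := by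
      linear_combination -σ * hsc + cos (3 * φ / 2) * hP
    have e2 : τ = -(σ * sin (3 * φ / 2) - τ * cos (3 * φ / 2)) * cos (3 * φ / 2) := by
      linear_combination -τ * hsc + sin (3 * φ / 2) * hP
    generalize σ * sin (3 * φ / 2) - τ * cos (3 * φ / 2) = ρ at e1 e2
    refine ⟨_, .inl ⟨0, 0, fun v => b v * ρ * sin (2 * v) * sin (2 * φ) / (2 * cos φ), rfl⟩, ?_⟩
    filter_upwards [hK, hb, hf] with v hv ⟨h1, h2⟩ hv2
    rw [hv]
    ext <;> simp only [solutionI]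
    · rw [h1, e1, e2, sin_sub _ (3 * φ / 2)]
      generalize sin (2 * v) = s1 at *
      generalize sin (2 * φ) = s2 at *
      field_simp
      ring
    · rw [h2, e1, e2, sin_add _ (3 * φ / 2)]
      generalize sin (2 * v) = s1 at *
      generalize sin (2 * φ) = s2 at *
      field_simp
      ring
    all_goals ring
  · have e1 : σ = (σ * cos (3 * φ / 2) + τ * sin (3 * φ / 2)) * cos (3 * φ / 2) := by
      linear_combination -σ * hsc + sin (3 * φ / 2) * hP
    have e2 : τ = (σ * cos (3 * φ / 2) + τ * sin (3 * φ / 2)) * sin (3 * φ / 2) := by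
      linear_combination -τ * hsc - cos (3 * φ / 2) * hP
    generalize σ * cos (3 * φ / 2) + τ * sin (3 * φ / 2) = ρ at e1 e2
    refine ⟨_, .inr (.inl ⟨0, 0, fun v => b v * ρ * sin (2 * v) * sin (2 * φ) / (2 * cos φ),
      rfl⟩), ?_⟩
    filter_upwards [hK, hb, hf] with v hv ⟨h1, h2⟩ hv2
    rw [hv]
    ext <;> simp only [solutionII]
    · rw [h1, e1, e2, cos_sub _ (3 * φ / 2)]
      generalize sin (2 * v) = s1 at *
      generalize sin (2 * φ) = s2 at *
      field_simp
      ring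
    · rw [h2, e1, e2, cos_add _ (3 * φ / 2)]
      generalize sin (2 * v) = s1 at *
      generalize sin (2 * φ) = s2 at *
      field_simp
      ring
    all_goals ring

end NoBoundaryStrings

/-! ## Boundary faces on which both nodes can be joined to the boundary -/

section EvenTrig

open Complex Filter

variable {φ : ℂ} {u v : ℂ}

/-- This and the next two identities separate the variables: at a fixed `u`, the coefficients of the
equation `nested_ends` depend on `v` only through `sin (2 * v)` and `cos (2 * v - φ)`. -/
theorem four_sub_four (φ u v : ℂ) :
    sin (2 * φ - (u - v)) * sin (3 * φ - (u - v)) - sin (2 * φ - (u + v)) * sin (3 * φ - (u + v))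
      = sin (5 * φ - 2 * u) * sin (2 * v) := by
  rw [show 3 * φ - (u - v) = φ + (2 * φ - (u - v)) by ring,
    show 3 * φ - (u + v) = φ + (2 * φ - (u + v)) by ring,
    show 5 * φ - 2 * u = φ + (2 * φ - (u - v)) + (2 * φ - (u + v)) by ring,
    show 2 * v = (2 * φ - (u - v)) - (2 * φ - (u + v)) by ring]
  generalize 2 * φ - (u - v) = x
  generalize 2 * φ - (u + v) = y
  have h1 := sin_sq_add_cos_sq x
  have h2 := sin_sq_add_cos_sq y
  simp only [sin_add, sin_sub, cos_add]
  grind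

theorem four_sub_zero (φ u v : ℂ) :
    sin (2 * φ - (u + v)) * sin (3 * φ - (u + v))
      - (sin (2 * φ) * sin (3 * φ) + sin (u - v) * sin (3 * φ - (u - v)))
      = cos (4 * φ) * cos φ - cos (2 * v - φ) * cos (2 * u - 4 * φ) := by
  have e (x y : ℂ) : 2 * (sin x * sin y) = cos (x - y) - cos (x + y) := by
    rw [cos_sub, cos_add]; ring
  have e' (x y : ℂ) : 2 * (cos x * cos y) = cos (x - y) + cos (x + y) := by
    rw [cos_sub, cos_add]; ring
  have h : 2 * (sin (2 * φ - (u + v)) * sin (3 * φ - (u + v))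
      - (sin (2 * φ) * sin (3 * φ) + sin (u - v) * sin (3 * φ - (u - v))))
      = 2 * (cos (4 * φ) * cos φ) - 2 * (cos (2 * v - φ) * cos (2 * u - 4 * φ)) := by
    rw [mul_sub, mul_add, e, e, e, e', e',
      show 2 * φ - (u + v) - (3 * φ - (u + v)) = -φ by ring,
      show 2 * φ - 3 * φ = -φ by ring,
      show u - v - (3 * φ - (u - v)) = -(2 * v - φ - (2 * u - 4 * φ)) by ring,
      show u - v + (3 * φ - (u - v)) = 4 * φ - φ by ring,
      show 2 * φ - (u + v) + (3 * φ - (u + v)) = -(2 * v - φ + (2 * u - 4 * φ)) by ring,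
      show 2 * φ + 3 * φ = 4 * φ + φ by ring, cos_neg, cos_neg, cos_neg]
    ring
  exact mul_left_cancel₀ two_ne_zero (h.trans (mul_sub _ _ _).symm)

theorem three_mul_five (φ u v : ℂ) :
    2 * (sin (u - v) * sin (φ - (u + v))) = cos (2 * u - φ) - cos (2 * v - φ) := by
  rw [show 2 * u - φ = u - v - (φ - (u + v)) by ring,
    show 2 * v - φ = -(u - v + (φ - (u + v))) by ring, cos_neg, cos_sub, cos_add]
  ring

/-- The equations for the coefficients of a boundary face without strings that end on the boundary
at one node only, at two spectral parameters. -/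
structure EvenEquations (φ kap lam u v f g D F G E : ℂ) : Prop where
  string_pair : (D * G - g * E) * sin (u + v) = (D * F + f * E + lam * D * E) * sin (u - v)
  arc_empty : (f * G - g * F) * sin (u + v) + (g * G - f * F) * sin (u - v) = 0
  nested_ends : D * G * (sin (5 * φ - 2 * u) * sin (2 * v))
    + g * E * (cos (4 * φ) * cos φ - cos (2 * v - φ) * cos (2 * u - 4 * φ))
    + (kap * D - 2 * cos (4 * φ) * f) * E * (sin (u - v) * sin (φ - (u + v))) = 0

theorem Regular.evenEquations (hs : sin (2 * φ) ≠ 0) (hr : Regular φ u v)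
    {kap lam f g D F G E : ℂ}
    (h₁ : D * G * faceCoeff φ (u - v) 1 * faceCoeff φ (u + v) 3
      - D * F * faceCoeff φ (u - v) 3 * faceCoeff φ (u + v) 1
      - E * f * faceCoeff φ (u - v) 3 * faceCoeff φ (u + v) 1
      - E * g * faceCoeff φ (u - v) 1 * faceCoeff φ (u + v) 3
      = lam * D * E * faceCoeff φ (u - v) 3 * faceCoeff φ (u + v) 1)
    (h₂ : f * G * faceCoeff φ (u - v) 1 * faceCoeff φ (u + v) 3
        + g * G * faceCoeff φ (u - v) 3 * faceCoeff φ (u + v) 1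
        - f * F * faceCoeff φ (u - v) 3 * faceCoeff φ (u + v) 1
        - g * F * faceCoeff φ (u - v) 1 * faceCoeff φ (u + v) 3 = 0)
    (h₃ : D * G * faceCoeff φ (u - v) 4 * faceCoeff φ (u + v) 2
      - D * F * faceCoeff φ (u - v) 2 * faceCoeff φ (u + v) 4
      - f * E * faceCoeff φ (u - v) 2 * faceCoeff φ (u + v) 4
      - g * E * faceCoeff φ (u - v) 0 * faceCoeff φ (u + v) 2
      - (-2 * cos (4 * φ)) * f * E * faceCoeff φ (u - v) 2 * faceCoeff φ (u + v) 5
      - kap * D * E * faceCoeff φ (u - v) 2 * faceCoeff φ (u + v) 5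
      = lam * D * E * faceCoeff φ (u - v) 2 * faceCoeff φ (u + v) 4) :
    EvenEquations φ kap lam u v f g D F G E := by
  have hne : sin (2 * φ) * sin (3 * φ - (u - v)) * sin (3 * φ - (u + v)) ≠ 0 :=
    mul_ne_zero (mul_ne_zero hs hr.three_sub) hr.three_add
  have h : (D * G - g * E) * sin (u + v) = (D * F + f * E + lam * D * E) * sin (u - v) := by
    refine mul_left_cancel₀ hne ?_
    simp only [faceCoeff] at h₁
    linear_combination h₁
  -- A multiple of the first equation eliminates `F` and `lam` from the third.
  refine ⟨h, hr.arc_empty hs h₂, mul_left_cancel₀ (mul_ne_zero hs hr.add) ?_⟩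
  rw [← four_sub_four, ← four_sub_zero]
  simp only [faceCoeff] at h₃
  linear_combination h₃ - sin (2 * φ) * sin (2 * φ - (u + v)) * sin (3 * φ - (u + v)) * h

/-- This and the next two identities treat the general form `f sin 2u = b (A cos φ + D cos 2u + H
sin 2u)`, `g sin 2u = b (A cos (2u - φ) + D)`. The three equations then become algebraic relations
between `A, D, H, kap, lam`. -/
theorem arc_empty_eq (φ A D H u v : ℂ) :
    ((A * cos φ + D * cos (2 * u) + H * sin (2 * u)) * (A * cos (2 * v - φ) + D)
      - (A * cos (2 * u - φ) + D) * (A * cos φ + D * cos (2 * v) + H * sin (2 * v))) * sin (u + v)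
    + ((A * cos (2 * u - φ) + D) * (A * cos (2 * v - φ) + D)
      - (A * cos φ + D * cos (2 * u) + H * sin (2 * u))
        * (A * cos φ + D * cos (2 * v) + H * sin (2 * v))) * sin (u - v)
      = (A ^ 2 - D ^ 2 - H ^ 2) * (sin (u - v) * sin (2 * u) * sin (2 * v)) := by
  have h1 := sin_sq_add_cos_sq u
  have h2 := sin_sq_add_cos_sq v
  have h3 := sin_sq_add_cos_sq φ
  simp only [sin_add, sin_sub, cos_sub, sin_two_mul, cos_two_mul']
  generalize sin u = a at *
  generalize cos u = b at *
  generalize sin v = c at *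
  generalize cos v = d at *
  generalize sin φ = e at *
  generalize cos φ = f at *
  grind

theorem string_pair_eq (φ A D u v : ℂ) :
    ((A * cos (2 * v - φ) + D) * sin (2 * u) - (A * cos (2 * u - φ) + D) * sin (2 * v))
        * sin (u + v)
      = (A * cos φ * (sin (2 * u) + sin (2 * v)) + D * sin (2 * (u + v))) * sin (u - v) := by
  have h1 := sin_sq_add_cos_sq u
  have h2 := sin_sq_add_cos_sq v
  rw [sin_two_mul (u + v)]
  simp only [sin_add, cos_add, sin_sub, cos_sub, sin_two_mul, cos_two_mul']
  generalize sin u = a at *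
  generalize cos u = b at *
  generalize sin v = c at *
  generalize cos v = d at *
  grind

theorem nested_ends_eq (φ kap A D H u v : ℂ) :
    2 * ((A * cos (2 * v - φ) + D) * sin (5 * φ - 2 * u) * sin (2 * u)
      + (A * cos (2 * u - φ) + D) * (cos (4 * φ) * cos φ - cos (2 * v - φ) * cos (2 * u - 4 * φ)))
    + (kap * sin (2 * u) - 2 * cos (4 * φ) * (A * cos φ + D * cos (2 * u) + H * sin (2 * u)))
      * (cos (2 * u - φ) - cos (2 * v - φ))
    = (kap - 2 * (H * cos (4 * φ) - D * sin (4 * φ))) * sin (2 * u)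
      * (cos (2 * u - φ) - cos (2 * v - φ)) := by
  rw [show 5 * φ - 2 * u = φ + 4 * φ - 2 * u by ring]
  have h1 := sin_sq_add_cos_sq (2 * u)
  simp only [sin_add, cos_add, sin_sub, cos_sub]
  generalize sin (2 * u) = a at *
  generalize cos (2 * u) = b at *
  generalize sin (2 * v) = c at *
  generalize cos (2 * v) = d at *
  generalize sin (4 * φ) = e at *
  generalize cos (4 * φ) = g at *
  have h2 := sin_sq_add_cos_sq φ
  generalize sin φ = e' at *
  generalize cos φ = g' at *
  grind

/-- The equations determine the coefficients up to three constants. -/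
theorem exists_even_form {f g b : ℂ → ℂ} {kap lam : ℂ} (hb : ∃ᶠ u in codiscrete ℂ, b u ≠ 0)
    (h : ∀ᶠ u in codiscrete ℂ, ∀ᶠ v in codiscrete ℂ,
      EvenEquations φ kap lam u v (f u) (g u) (b u) (f v) (g v) (b v)) :
    ∃ A D H : ℂ, A ^ 2 = D ^ 2 + H ^ 2 ∧ lam = -2 * H ∧
      kap = 2 * (H * cos (4 * φ) - D * sin (4 * φ)) ∧ ∀ᶠ v in codiscrete ℂ,
        f v * sin (2 * v) = b v * (A * cos φ + D * cos (2 * v) + H * sin (2 * v)) ∧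
        g v * sin (2 * v) = b v * (A * cos (2 * v - φ) + D) := by
  have hf : ∀ᶠ u in codiscrete ℂ, sin (2 * u) ≠ 0 ∧ sin (5 * φ - 2 * u) ≠ 0 :=
    ((eventually_regular φ 0).mono fun u hu => hu.two).and
      (eventually_sin_ne_zero (a := -2) (c := 5 * φ) (by norm_num) fun z => by ring)
  -- At a fixed `u` with `b u ≠ 0`, `nested_ends` is a linear equation for `g v`, whose coefficients
  -- depend on `v` as stated.
  have hg : ∃ A D : ℂ, ∀ᶠ v in codiscrete ℂ,
      g v * sin (2 * v) = b v * (A * cos (2 * v - φ) + D) := by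
    obtain ⟨u, hbu, hu, -, hu5⟩ := (hb.and_eventually (h.and hf)).exists
    refine ⟨(2 * g u * cos (2 * u - 4 * φ) + (kap * b u - 2 * cos (4 * φ) * f u))
        / (2 * (b u * sin (5 * φ - 2 * u))),
      -(2 * g u * (cos (4 * φ) * cos φ)
        + (kap * b u - 2 * cos (4 * φ) * f u) * cos (2 * u - φ))
        / (2 * (b u * sin (5 * φ - 2 * u))), ?_⟩
    filter_upwards [hu] with v hv
    have hne : 2 * (b u * sin (5 * φ - 2 * u)) ≠ 0 := mul_ne_zero two_ne_zero (mul_ne_zero hbu hu5)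
    rw [div_mul_eq_mul_div, ← add_div, mul_div_assoc', eq_div_iff hne]
    linear_combination 2 * hv.nested_ends
      - (kap * b u - 2 * cos (4 * φ) * f u) * b v * three_mul_five φ u v
  obtain ⟨A, D, hg⟩ := hg
  -- With `g` known at both parameters, `string_pair` expresses `f v`.
  have key {u v : ℂ} (hbu : b u ≠ 0) (hr : Regular φ u v)
      (e : EvenEquations φ kap lam u v (f u) (g u) (b u) (f v) (g v) (b v))
      (hu : g u * sin (2 * u) = b u * (A * cos (2 * u - φ) + D))
      (hv : g v * sin (2 * v) = b v * (A * cos (2 * v - φ) + D)) :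
      b u * (f v * sin (2 * v)) * sin (2 * u)
        = b v * (b u * (A * cos φ * (sin (2 * u) + sin (2 * v)) + D * sin (2 * (u + v)))
          - sin (2 * v) * (f u * sin (2 * u) + lam * b u * sin (2 * u))) := by
    refine mul_left_cancel₀ hr.sub ?_
    linear_combination -sin (2 * v) * sin (2 * u) * e.string_pair
      + b u * b v * string_pair_eq φ A D u v + b u * sin (2 * u) * sin (u + v) * hv
      - b v * sin (2 * v) * sin (u + v) * hu
  have hF : ∃ H : ℂ, ∀ᶠ v in codiscrete ℂ,
      f v * sin (2 * v) = b v * (A * cos φ + D * cos (2 * v) + H * sin (2 * v)) := by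
    obtain ⟨u, hbu, hu, ⟨hu2, -⟩, hgu⟩ := (hb.and_eventually (h.and (hf.and hg))).exists
    -- The coefficient of `sin (2 * v)` when `sin (2 * (u + v))` is expanded in `key`.
    refine ⟨(A * cos φ + D * cos (2 * u)) / sin (2 * u) - f u / b u - lam, ?_⟩
    filter_upwards [hu, hg, eventually_regular φ u] with v hv hgv hr
    have e := key hbu hr hv hgu hgv
    rw [mul_add 2, sin_add] at e
    refine mul_left_cancel₀ (mul_ne_zero hbu hu2) ?_
    have e1 : (A * cos φ + D * cos (2 * u)) / sin (2 * u) * sin (2 * u)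
      = A * cos φ + D * cos (2 * u) := div_mul_cancel₀ _ hu2
    have e2 : f u / b u * b u = f u := div_mul_cancel₀ _ hbu
    linear_combination e - b u * b v * sin (2 * v) * e1
      + b v * sin (2 * u) * sin (2 * v) * e2
  obtain ⟨H, hF⟩ := hF
  obtain ⟨u, hbu, hu, ⟨hu2, -⟩, hgu, hfu⟩ := (hb.and_eventually (h.and (hf.and (hg.and hF)))).exists
  obtain ⟨v, hbv, hv, hr, hgv, hfv⟩ := (hb.and_eventually
    (hu.and ((eventually_regular φ u).and (hg.and hF)))).exists
  have hsu : sin (2 * u) ≠ 0 := hu2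
  have hsv := hr.two
  -- Substituting the general form back into the equations at one good pair of parameters leaves the
  -- three relations, each times a nonzero factor.
  refine ⟨A, D, H, ?_, ?_, ?_, hF.and hg⟩
  · have hne : b u * b v * (sin (u - v) * sin (2 * u) * sin (2 * v)) ≠ 0 :=
      mul_ne_zero (mul_ne_zero hbu hbv) (mul_ne_zero (mul_ne_zero hr.sub hu2) hr.two)
    have e := arc_empty_eq φ A D H u v
    have e' : b u * b v * (sin (u - v) * sin (2 * u) * sin (2 * v)) * (A ^ 2 - D ^ 2 - H ^ 2)
        = 0 := by
      have t := hv.arc_empty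
      have t' : ((f u * sin (2 * u)) * (g v * sin (2 * v)) - (g u * sin (2 * u))
            * (f v * sin (2 * v))) * sin (u + v)
          + ((g u * sin (2 * u)) * (g v * sin (2 * v)) - (f u * sin (2 * u))
            * (f v * sin (2 * v))) * sin (u - v) = 0 := by
        linear_combination sin (2 * u) * sin (2 * v) * t
      rw [hgu, hfu, hgv, hfv] at t'
      linear_combination t' - b u * b v * e
    linear_combination (mul_eq_zero.1 e').resolve_left hne
  · have e := key hbu hr hv hgu hgv
    have hne : b u * b v * (sin (2 * u) * sin (2 * v)) ≠ 0 :=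
      mul_ne_zero (mul_ne_zero hbu hbv) (mul_ne_zero hu2 hr.two)
    refine mul_left_cancel₀ hne ?_
    rw [hfv, hfu, mul_add 2, sin_add] at e
    linear_combination e
  · have hne : b u * b v * (sin (2 * u) * (2 * (sin (u - v) * sin (φ - (u + v))))) ≠ 0 :=
      mul_ne_zero (mul_ne_zero hbu hbv)
        (mul_ne_zero hu2 (mul_ne_zero two_ne_zero (mul_ne_zero hr.sub hr.one_add)))
    refine mul_left_cancel₀ hne ?_
    have e := nested_ends_eq φ kap A D H u v
    have t := hv.nested_ends
    rw [three_mul_five]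
    linear_combination -b u * b v * e + 2 * sin (2 * u) * t
      - (kap * b u - 2 * cos (4 * φ) * f u) * b v * sin (2 * u) * three_mul_five φ u v
      - 2 * b u * sin (5 * φ - 2 * u) * sin (2 * u) * hgv
      - 2 * b v * (cos (4 * φ) * cos φ - cos (2 * v - φ) * cos (2 * u - 4 * φ)) * hgu
      + 2 * cos (4 * φ) * b v * (cos (2 * u - φ) - cos (2 * v - φ)) * hfu

/-- The cone `(A + B) (A - B) = C²` is parametrised by squares; if `σ = 0` then `C = 0`, and `τ` is
any square root of `A - B`. -/
theorem exists_sq_of_sq_eq {A B C : ℂ} (h : A ^ 2 = B ^ 2 + C ^ 2) :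
    ∃ σ τ : ℂ, σ ^ 2 = A + B ∧ τ ^ 2 = A - B ∧ σ * τ = C := by
  obtain ⟨σ, hσ⟩ := IsAlgClosed.exists_pow_nat_eq (A + B) two_pos
  by_cases h0 : σ = 0
  · obtain ⟨τ, hτ⟩ := IsAlgClosed.exists_pow_nat_eq (A - B) two_pos
    refine ⟨σ, τ, hσ, hτ, ?_⟩
    rw [h0] at hσ ⊢
    have hC : C ^ 2 = 0 := by linear_combination -h - (A - B) * hσ
    rw [zero_mul, (pow_eq_zero_iff two_ne_zero).1 hC]
  · refine ⟨σ, C / σ, hσ, ?_, mul_div_cancel₀ _ h0⟩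
    rw [div_pow, div_eq_iff (pow_ne_zero 2 h0), hσ]
    linear_combination -h

/-- The values of `P` at `φ` and `-3φ` are arbitrary. -/
theorem exists_P_eq (h4 : sin (4 * φ) ≠ 0) (X Y : ℂ) :
    ∃ σ τ : ℂ, P σ τ φ = X ∧ P σ τ (-3 * φ) = Y := by
  have e4 : sin φ * cos (3 * φ) + cos φ * sin (3 * φ) = sin (4 * φ) := by
    rw [← sin_add]; congr 1; ring
  -- The values of `P` are linear in `(σ² - τ²) / 2` and `σ τ`. The two fractions solve the
  -- resulting system, whose determinant is a nonzero multiple of `sin 4φ`, and `A` places them on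
  -- the cone.
  obtain ⟨A, hA⟩ := IsAlgClosed.exists_pow_nat_eq
    (((X * cos (3 * φ) - Y * cos φ) / (2 * sin (4 * φ))) ^ 2
      + ((X * sin (3 * φ) + Y * sin φ) / (2 * sin (4 * φ))) ^ 2) two_pos
  obtain ⟨σ, τ, h1, h2, h3⟩ := exists_sq_of_sq_eq hA
  have h12 : σ ^ 2 - τ ^ 2 = 2 * ((X * cos (3 * φ) - Y * cos φ) / (2 * sin (4 * φ))) := by
    rw [h1, h2]; ring
  refine ⟨σ, τ, ?_, ?_⟩
  · rw [P, h12, mul_assoc 2, h3]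
    generalize sin (4 * φ) = s at *
    field_simp
    linear_combination X * e4
  · rw [P, h12, mul_assoc 2, h3, neg_mul, cos_neg, sin_neg]
    generalize sin (4 * φ) = s at *
    field_simp
    linear_combination Y * e4

theorem eq_zero_of_P_eq_zero (h4 : sin (4 * φ) ≠ 0) {σ τ : ℂ} (h1 : P σ τ φ = 0)
    (h3 : P σ τ (-3 * φ) = 0) : σ = 0 ∧ τ = 0 := by
  have e4 : sin φ * cos (3 * φ) + cos φ * sin (3 * φ) = sin (4 * φ) := by
    rw [← sin_add]; congr 1; ring
  rw [P] at h1
  rw [P, neg_mul, cos_neg, sin_neg] at h3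
  have hC : σ * τ = 0 := by
    refine mul_left_cancel₀ h4 ?_
    linear_combination (sin (3 * φ) * h1 + sin φ * h3) / 2 - σ * τ * e4
  have hB : σ ^ 2 - τ ^ 2 = 0 := by
    refine mul_left_cancel₀ h4 ?_
    linear_combination cos (3 * φ) * h1 - cos φ * h3 - (σ ^ 2 - τ ^ 2) * e4
  rcases mul_eq_zero.1 hC with rfl | rfl
  · exact ⟨rfl, by simpa using hB⟩
  · exact ⟨by simpa using hB, rfl⟩

/-- The equations determine the coefficients up to two constants. -/
theorem exists_even_solution {f g b : ℂ → ℂ} {kap lam : ℂ}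
    (hb : ∃ᶠ u in codiscrete ℂ, b u ≠ 0)
    (h : ∀ᶠ u in codiscrete ℂ, ∀ᶠ v in codiscrete ℂ,
      EvenEquations φ kap lam u v (f u) (g u) (b u) (f v) (g v) (b v)) :
    ∃ σ τ : ℂ, lam = -P σ τ φ ∧ kap = P σ τ (-3 * φ) ∧ ∀ᶠ v in codiscrete ℂ,
      f v * sin (2 * v) = b v * ((σ * cos v + τ * sin v)
        * (σ * cos (v - φ) + τ * sin (v - φ))) ∧
      g v * sin (2 * v) = b v * ((σ * cos v - τ * sin v)
        * (σ * cos (v - φ) + τ * sin (v - φ))) := by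
  obtain ⟨A, D, H, hA, rfl, rfl, hf⟩ := exists_even_form hb h
  have hφ := sin_sq_add_cos_sq φ
  -- A rotation of `(D, H)` by `φ` preserves `D² + H²` and moves the cone into the position of the
  -- parametrisation.
  obtain ⟨σ, τ, h1, h2, h3⟩ := exists_sq_of_sq_eq (A := A) (B := D * cos φ + H * sin φ)
    (C := H * cos φ - D * sin φ) (by linear_combination hA - (D ^ 2 + H ^ 2) * hφ)
  have h12 : σ ^ 2 - τ ^ 2 = 2 * (D * cos φ + H * sin φ) := by rw [h1, h2]; ring
  refine ⟨σ, τ, ?_, ?_, ?_⟩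
  · rw [P, mul_assoc 2 σ, h3, h12]
    linear_combination 2 * H * hφ
  · rw [P, mul_assoc 2 σ, h3, h12, neg_mul, cos_neg, sin_neg,
      show 4 * φ = 3 * φ + φ by ring, cos_add, sin_add]
    ring
  · filter_upwards [hf] with v ⟨hf, hg⟩
    have hv := sin_sq_add_cos_sq v
    rw [hf, hg]
    simp only [cos_sub, sin_sub, sin_two_mul, cos_two_mul']
    constructor
    · linear_combination -b v * (cos v * (cos v * cos φ + sin v * sin φ) * h1
        + sin v * (sin v * cos φ - cos v * sin φ) * h2
        + (cos v * (sin v * cos φ - cos v * sin φ) + sin v * (cos v * cos φ + sin v * sin φ)) * h3)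
        - b v * A * cos φ * hv
        - b v * (D * (cos v ^ 2 - sin v ^ 2) + 2 * cos v * sin v * H) * hφ
    · linear_combination -b v * (cos v * (cos v * cos φ + sin v * sin φ) * h1
        - sin v * (sin v * cos φ - cos v * sin φ) * h2
        + (cos v * (sin v * cos φ - cos v * sin φ) - sin v * (cos v * cos φ + sin v * sin φ)) * h3)
        - b v * D * ((sin φ ^ 2 + cos φ ^ 2) * hv + hφ)

end EvenTrig

/-! ### Separation of the matrix of coefficients from the functions -/

section Even

open Complex Filter

variable {φ α₁ α₂ α₃ : ℂ} {K : ℂ → BoundaryCoeffs} {u v : ℂ}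

/-- The four choices of ghosts lead to equations of the same shape. The parts linear in the `nᵢ`
have common factors `X` and `Y`, and the quadratic parts are the entries of `N C N`. -/
theorem even_components {n₁ n₂ n₃ n₄ f g D F G E : ℂ} (h : BYBE φ α₁ α₂ α₃ K u v)
    (hu : K u = evenFace n₁ n₂ n₃ n₄ f g D) (hv : K v = evenFace n₁ n₂ n₃ n₄ F G E)
    {X Y : ℂ}
    (hX : X = D * G * faceCoeff φ (u - v) 1 * faceCoeff φ (u + v) 3
      - D * F * faceCoeff φ (u - v) 3 * faceCoeff φ (u + v) 1
      - E * f * faceCoeff φ (u - v) 3 * faceCoeff φ (u + v) 1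
      - E * g * faceCoeff φ (u - v) 1 * faceCoeff φ (u + v) 3)
    (hY : Y = D * G * faceCoeff φ (u - v) 4 * faceCoeff φ (u + v) 2
      - D * F * faceCoeff φ (u - v) 2 * faceCoeff φ (u + v) 4
      - f * E * faceCoeff φ (u - v) 2 * faceCoeff φ (u + v) 4
      - g * E * faceCoeff φ (u - v) 0 * faceCoeff φ (u + v) 2
      - (-2 * cos (4 * φ)) * f * E * faceCoeff φ (u - v) 2 * faceCoeff φ (u + v) 5
      - (α₁ * n₁ + α₃ * n₂ + α₂ * n₃ + α₃ * n₄) * D * E * faceCoeff φ (u - v) 2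
        * faceCoeff φ (u + v) 5) :
    ((α₂ * n₁ * n₁ + α₃ * n₂ * n₁ + α₃ * n₁ * n₄ + α₁ * n₂ * n₄)
        * (D * E * faceCoeff φ (u - v) 3 * faceCoeff φ (u + v) 1) = X * n₁ ∧
      (α₂ * n₁ * n₂ + α₃ * n₂ * n₂ + α₃ * n₁ * n₃ + α₁ * n₂ * n₃)
        * (D * E * faceCoeff φ (u - v) 3 * faceCoeff φ (u + v) 1) = X * n₂ ∧
      (α₃ * n₃ * n₂ + α₂ * n₄ * n₂ + α₁ * n₃ * n₃ + α₃ * n₄ * n₃)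
        * (D * E * faceCoeff φ (u - v) 3 * faceCoeff φ (u + v) 1) = X * n₃ ∧
      (α₃ * n₃ * n₁ + α₂ * n₄ * n₁ + α₁ * n₃ * n₄ + α₃ * n₄ * n₄)
        * (D * E * faceCoeff φ (u - v) 3 * faceCoeff φ (u + v) 1) = X * n₄) ∧
    ((α₂ * n₁ * n₁ + α₃ * n₂ * n₁ + α₃ * n₁ * n₄ + α₁ * n₂ * n₄)
        * (D * E * faceCoeff φ (u - v) 2 * faceCoeff φ (u + v) 4) = Y * n₁ ∧
      (α₂ * n₁ * n₂ + α₃ * n₂ * n₂ + α₃ * n₁ * n₃ + α₁ * n₂ * n₃)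
        * (D * E * faceCoeff φ (u - v) 2 * faceCoeff φ (u + v) 4) = Y * n₂ ∧
      (α₃ * n₃ * n₂ + α₂ * n₄ * n₂ + α₁ * n₃ * n₃ + α₃ * n₄ * n₃)
        * (D * E * faceCoeff φ (u - v) 2 * faceCoeff φ (u + v) 4) = Y * n₃ ∧
      (α₃ * n₃ * n₁ + α₂ * n₄ * n₁ + α₁ * n₃ * n₄ + α₃ * n₄ * n₄)
        * (D * E * faceCoeff φ (u - v) 2 * faceCoeff φ (u + v) 4) = Y * n₄) := by
  obtain ⟨q1, q2, q3, q4⟩ := (bybe_iff ..).1 h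
  have x1 := q1.wL1R2
  have x2 := q2.wL1gR2g
  have x3 := q2.wL1R2
  have x4 := q1.wL1gR2g
  have y1 := q1.wL1L2
  have y2 := q2.wL1gL2g
  have y3 := q2.wL1L2
  have y4 := q1.wL1gL2g
  rw [hu, hv] at x1 x2 x3 x4 y1 y2 y3 y4
  simp only [evenFace, BoundaryCoeffs.ghost] at x1 x2 x3 x4 y1 y2 y3 y4
  subst hX hY
  refine ⟨⟨?_, ?_, ?_, ?_⟩, ?_, ?_, ?_, ?_⟩
  · linear_combination -x1
  · linear_combination -x2
  · linear_combination -x3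
  · linear_combination -x4
  · linear_combination -y1
  · linear_combination -y2
  · linear_combination -y3
  · linear_combination -y4

/-- One pair of parameters with nonzero functions shows that `N C N` is proportional to `N`; the
quotient of the scalar factors is the strength. -/
theorem exists_idempotent {n₁ n₂ n₃ n₄ f g D F G E : ℂ} (hs : sin (2 * φ) ≠ 0)
    (hr : Regular φ u v) (h : BYBE φ α₁ α₂ α₃ K u v) (hu : K u = evenFace n₁ n₂ n₃ n₄ f g D)
    (hv : K v = evenFace n₁ n₂ n₃ n₄ F G E) (hD : D ≠ 0) (hE : E ≠ 0) :
    ∃ lam, Idempotent α₁ α₂ α₃ lam n₁ n₂ n₃ n₄ := by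
  have hne : D * E * faceCoeff φ (u - v) 3 * faceCoeff φ (u + v) 1 ≠ 0 :=
    mul_ne_zero (mul_ne_zero (mul_ne_zero hD hE) (mul_ne_zero hr.sub hr.three_sub))
      (mul_ne_zero hs hr.three_add)
  obtain ⟨⟨x1, x2, x3, x4⟩, -⟩ := even_components h hu hv rfl rfl
  have cancel {X Z n : ℂ} (e : Z * (D * E * faceCoeff φ (u - v) 3 * faceCoeff φ (u + v) 1) = X * n) :
      Z = X / (D * E * faceCoeff φ (u - v) 3 * faceCoeff φ (u + v) 1) * n := by
    rw [div_mul_eq_mul_div, ← e, mul_div_cancel_right₀ _ hne]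
  exact ⟨_, cancel x1, cancel x2, cancel x3, cancel x4⟩

/-- Some `nᵢ` is nonzero and can be cancelled once `N C N` is replaced by `λ N`. -/
theorem Idempotent.evenEquations {n₁ n₂ n₃ n₄ f g D F G E lam : ℂ} (hs : sin (2 * φ) ≠ 0)
    (hn : Idempotent α₁ α₂ α₃ lam n₁ n₂ n₃ n₄) (h0 : ¬ (n₁ = 0 ∧ n₂ = 0 ∧ n₃ = 0 ∧ n₄ = 0))
    (hr : Regular φ u v) (h : BYBE φ α₁ α₂ α₃ K u v) (hu : K u = evenFace n₁ n₂ n₃ n₄ f g D)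
    (hv : K v = evenFace n₁ n₂ n₃ n₄ F G E) :
    EvenEquations φ (α₁ * n₁ + α₃ * n₂ + α₂ * n₃ + α₃ * n₄) lam u v f g D F G E := by
  obtain ⟨⟨x1, x2, x3, x4⟩, y1, y2, y3, y4⟩ := even_components h hu hv rfl rfl
  rw [hn.eq₁] at x1 y1
  rw [hn.eq₂] at x2 y2
  rw [hn.eq₃] at x3 y3
  rw [hn.eq₄] at x4 y4
  have cancel {X T : ℂ} (e1 : lam * n₁ * T = X * n₁) (e2 : lam * n₂ * T = X * n₂)
      (e3 : lam * n₃ * T = X * n₃) (e4 : lam * n₄ * T = X * n₄) : X = lam * T := by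
    by_contra hX
    have hX := sub_ne_zero.2 hX
    refine h0 ⟨?_, ?_, ?_, ?_⟩ <;> refine (mul_eq_zero.1 ?_).resolve_left hX
    · linear_combination -e1
    · linear_combination -e2
    · linear_combination -e3
    · linear_combination -e4
  have t := ((bybe_iff ..).1 h).1.cL1R2_w
  rw [hu, hv] at t
  simp only [evenFace] at t
  refine hr.evenEquations hs ?_ (by linear_combination t) ?_
  · linear_combination cancel x1 x2 x3 x4
  · linear_combination cancel y1 y2 y3 y4

theorem Proportional.exists_eq {k l : BoundaryCoeffs} (h : Proportional k l)
    (hk : ¬ (k.b₁ = 0 ∧ k.b₂ = 0 ∧ k.b₃ = 0 ∧ k.b₄ = 0)) (hl : l.IsEven) :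
    ∃ b, l = evenFace k.b₁ k.b₂ k.b₃ k.b₄ l.a₁ l.a₂ b := by
  obtain ⟨h5, h6, h7, h8⟩ := hl
  suffices ∃ b, l.b₁ = k.b₁ * b ∧ l.b₂ = k.b₂ * b ∧ l.b₃ = k.b₃ * b ∧ l.b₄ = k.b₄ * b by
    obtain ⟨b, e1, e2, e3, e4⟩ := this
    exact ⟨b, by ext <;> simp only [evenFace] <;> assumption⟩
  obtain ⟨e12, e13, e14, e23, e24, e34⟩ := h
  simp only [not_and_or] at hk
  rcases hk with h0 | h0 | h0 | h0
  · refine ⟨l.b₁ / k.b₁, ?_, ?_, ?_, ?_⟩ <;> field_simp <;> grind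
  · refine ⟨l.b₂ / k.b₂, ?_, ?_, ?_, ?_⟩ <;> field_simp <;> grind
  · refine ⟨l.b₃ / k.b₃, ?_, ?_, ?_, ?_⟩ <;> field_simp <;> grind
  · refine ⟨l.b₄ / k.b₄, ?_, ?_, ?_, ?_⟩ <;> field_simp <;> grind

theorem exists_evenFace (hs : sin (2 * φ) ≠ 0) (h : Solves φ α₁ α₂ α₃ K)
    (hK : ∀ᶠ u in codiscrete ℂ, (K u).IsEven)
    (h0 : ∃ᶠ u in codiscrete ℂ,
      ¬ ((K u).b₁ = 0 ∧ (K u).b₂ = 0 ∧ (K u).b₃ = 0 ∧ (K u).b₄ = 0)) :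
    ∃ (n₁ n₂ n₃ n₄ σ τ : ℂ) (b : ℂ → ℂ), ¬ (n₁ = 0 ∧ n₂ = 0 ∧ n₃ = 0 ∧ n₄ = 0) ∧
      Idempotent α₁ α₂ α₃ (-P σ τ φ) n₁ n₂ n₃ n₄ ∧
      P σ τ (-3 * φ) = α₁ * n₁ + α₃ * n₂ + α₂ * n₃ + α₃ * n₄ ∧
      ∀ᶠ v in codiscrete ℂ, K v = (evenSolution φ σ τ 1 n₁ n₂ n₃ n₄ v).smul (b v / sin (2 * v)) := by
  obtain ⟨u, hu0, hu⟩ := (h0.and_eventually h).exists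
  have hb : ∀ᶠ v in codiscrete ℂ, ∃ b, K v =
      evenFace (K u).b₁ (K u).b₂ (K u).b₃ (K u).b₄ (K v).a₁ (K v).a₂ b := by
    filter_upwards [hu, hK, eventually_regular φ u] with v hv hKv hr
    exact (hr.proportional hv).exists_eq hu0 hKv
  obtain ⟨b, hb⟩ := hb.choice
  generalize (K u).b₁ = n₁ at *
  generalize (K u).b₂ = n₂ at *
  generalize (K u).b₃ = n₃ at *
  generalize (K u).b₄ = n₄ at *
  clear hu u
  have hb0 : ∃ᶠ v in codiscrete ℂ, b v ≠ 0 := by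
    refine (h0.and_eventually hb).mono fun v ⟨h1, h2⟩ h3 => h1 ?_
    rw [h2, h3]
    simp [evenFace]
  obtain ⟨lam, hlam⟩ : ∃ lam, Idempotent α₁ α₂ α₃ lam n₁ n₂ n₃ n₄ := by
    obtain ⟨u, hbu, hu, hKu⟩ := (hb0.and_eventually (h.and hb)).exists
    obtain ⟨v, hbv, hv, hKv, hr⟩ :=
      (hb0.and_eventually (hu.and (hb.and (eventually_regular φ u)))).exists
    exact exists_idempotent hs hr hv hKu hKv hbu hbv
  obtain ⟨σ, τ, h1, h2, h3⟩ := exists_even_solution (φ := φ) (f := fun u => (K u).a₁)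
    (g := fun u => (K u).a₂) hb0 (by
      filter_upwards [h, hb] with u hu hKu
      filter_upwards [hu, hb, eventually_regular φ u] with v hv hKv hr
      exact hlam.evenEquations hs hu0 hr hv hKu hKv)
  refine ⟨n₁, n₂, n₃, n₄, σ, τ, b, hu0, h1 ▸ hlam, h2.symm, ?_⟩
  filter_upwards [hb, h3, eventually_regular φ 0] with v hv ⟨hf, hg⟩ hr
  have hr2 := hr.two
  rw [hv]
  ext <;> simp only [evenFace, evenSolution, BoundaryCoeffs.smul]
  · rw [one_mul, div_mul_eq_mul_div, ← hf, mul_div_cancel_right₀ _ hr2]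
  · rw [one_mul, div_mul_eq_mul_div, ← hg, mul_div_cancel_right₀ _ hr2]
  all_goals (field_simp <;> ring)

end Even

/-! ### Identification with the families III, IV and V -/

section Identify

open Complex Filter

variable {φ α₁ α₂ α₃ σ τ n₁ n₂ n₃ n₄ : ℂ}

/-- An invertible matrix of coefficients is a multiple of the inverse of the matrix of weights. -/
theorem Idempotent.of_det_ne_zero {lam : ℂ} (h : Idempotent α₁ α₂ α₃ lam n₁ n₂ n₃ n₄)
    (hdet : n₁ * n₃ - n₂ * n₄ ≠ 0) (h1 : α₁ ≠ 0) (hA : A₂ α₁ α₂ α₃ ≠ 0) :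
    ∃ s, lam = s * A₂ α₁ α₂ α₃ ∧ n₁ = s * α₁ ∧ n₂ = -s * α₃ ∧ n₃ = s * α₂ ∧ n₄ = -s * α₃ := by
  obtain ⟨e1, e2, e3, e4⟩ := h
  have m11 : n₁ * α₂ + n₄ * α₃ - lam = 0 := by
    refine mul_left_cancel₀ hdet ?_
    linear_combination n₃ * e1 - n₂ * e4
  have m12 : n₁ * α₃ + n₄ * α₁ = 0 := by
    refine mul_left_cancel₀ hdet ?_
    linear_combination n₁ * e4 - n₄ * e1
  have m21 : n₂ * α₂ + n₃ * α₃ = 0 := by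
    refine mul_left_cancel₀ hdet ?_
    linear_combination n₃ * e2 - n₂ * e3
  have m22 : n₂ * α₃ + n₃ * α₁ - lam = 0 := by
    refine mul_left_cancel₀ hdet ?_
    linear_combination n₁ * e3 - n₄ * e2
  have e : n₁ / α₁ * α₁ = n₁ := div_mul_cancel₀ _ h1
  generalize n₁ / α₁ = s at e
  have e4 : n₄ = -s * α₃ := mul_right_cancel₀ h1 (by linear_combination m12 + α₃ * e)
  have e0 : lam = s * A₂ α₁ α₂ α₃ := by
    rw [A₂]
    linear_combination -m11 - α₂ * e + α₃ * e4
  have e3 : n₃ = s * α₂ := by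
    refine mul_right_cancel₀ hA ?_
    rw [A₂] at e0 ⊢
    linear_combination α₂ * m22 - α₃ * m21 + α₂ * e0
  have e2 : n₂ = -s * α₃ := by
    refine mul_right_cancel₀ hA ?_
    rw [A₂] at e0 ⊢
    linear_combination α₁ * m21 - α₃ * m22 - α₃ * e0
  exact ⟨s, e0, e.symm, e2, e3, e4⟩

/-- A nonzero singular matrix with rows `(n₁, n₂)` and `(n₄, n₃)` is the column `(x, -y)` times a
nonzero row `(μ, ν)`. -/
theorem exists_rank_one (h0 : ¬ (n₁ = 0 ∧ n₂ = 0 ∧ n₃ = 0 ∧ n₄ = 0))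
    (hdet : n₁ * n₃ - n₂ * n₄ = 0) : ∃ μ ν x y : ℂ,
      n₁ = μ * x ∧ n₂ = ν * x ∧ n₃ = -(ν * y) ∧ n₄ = -(μ * y) ∧ (μ ≠ 0 ∨ ν ≠ 0) := by
  by_cases h1 : n₁ = 0
  · by_cases h2 : n₂ = 0
    · refine ⟨n₄, n₃, 0, -1, by simpa, by simpa, by ring, by ring, ?_⟩
      by_contra! h
      exact h0 ⟨h1, h2, h.2, h.1⟩
    · refine ⟨n₁, n₂, 1, -n₃ / n₂, by ring, by ring, by field_simp, ?_, .inr h2⟩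
      field_simp
      linear_combination -hdet
  · refine ⟨n₁, n₂, 1, -n₄ / n₁, by ring, by ring, ?_, by field_simp, .inl h1⟩
    field_simp
    linear_combination hdet

/-- For a column times a row, `N C N` is `N` times the scalar row · `C` · column; any nonzero entry
of `N` identifies this scalar with `lam`. -/
theorem Idempotent.lam_eq {lam μ ν x y : ℂ}
    (h : Idempotent α₁ α₂ α₃ lam (μ * x) (ν * x) (-(ν * y)) (-(μ * y))) (hμν : μ ≠ 0 ∨ ν ≠ 0)
    (hxy : x ≠ 0 ∨ y ≠ 0) :
    lam = x * (α₂ * μ + α₃ * ν) - y * (α₃ * μ + α₁ * ν) := by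
  obtain ⟨e1, e2, e3, e4⟩ := h
  rcases hμν with hμ | hν <;> rcases hxy with hx | hy
  · refine mul_right_cancel₀ (mul_ne_zero hμ hx) ?_
    linear_combination -e1
  · refine mul_right_cancel₀ (mul_ne_zero hμ hy) ?_
    linear_combination e4
  · refine mul_right_cancel₀ (mul_ne_zero hν hx) ?_
    linear_combination -e2
  · refine mul_right_cancel₀ (mul_ne_zero hν hy) ?_
    linear_combination e3

/-- Solution V is the face of rank one whose row is `(μ, ν) = (α₁ P(-3φ) + α₂ P(φ), -α₃ m)`. The
values of `c₂` and `c₃` undo the factors that `P(-φ) = m / (2 cos 2φ)` brings in, and `hw` matches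
the scale of `a₁` and `a₂`. -/
theorem solutionV_eq {μ ν x y m c : ℂ} (hc : cos (2 * φ) ≠ 0) (hm : P σ τ φ + P σ τ (-3 * φ) = m)
    (hm0 : m ≠ 0) (hμ : α₁ * P σ τ (-3 * φ) + α₂ * P σ τ φ = μ) (hν : -α₃ * m = ν)
    (hw : (α₁ - α₂) * (x * μ + y * ν) = c * m) (b : ℂ → ℂ) {u : ℂ} (hu : sin (2 * u) ≠ 0) :
    solutionV φ α₁ α₂ α₃ (4 * cos (2 * φ) ^ 2 * x / m) (-(4 * cos (2 * φ) ^ 2 * y / m)) σ τ b u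
      = (evenSolution φ σ τ c (μ * x) (ν * x) (-(ν * y)) (-(μ * y)) u).smul (b u / sin (2 * u)) := by
  have hP : P σ τ (-φ) = m / (2 * cos (2 * φ)) := by
    rw [← hm, ← P_neg, mul_div_cancel_left₀ _ (mul_ne_zero two_ne_zero hc)]
  have hz : (4 * cos (2 * φ) ^ 2 * x / m * α₁ + -(4 * cos (2 * φ) ^ 2 * y / m) * α₃)
        * P σ τ (-3 * φ)
      + (4 * cos (2 * φ) ^ 2 * x / m * α₂ + -(4 * cos (2 * φ) ^ 2 * y / m) * α₃) * P σ τ φ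
      = 4 * cos (2 * φ) ^ 2 * ((x * μ + y * ν) / m) := by
    rw [← hμ, ← hν]
    clear hP hμ hν hw
    generalize P σ τ (-3 * φ) = p at *
    generalize P σ τ φ = q at *
    field_simp
    linear_combination -α₃ * y * hm
  have hc' : c = (α₁ - α₂) * ((x * μ + y * ν) / m) := by
    rw [mul_div_assoc', hw, mul_div_cancel_right₀ _ hm0]
  ext <;> simp only [solutionV, evenSolution, evenFace, BoundaryCoeffs.smul]
  · rw [hz, hc']
    generalize (x * μ + y * ν) / m = w
    field_simp
  · rw [hz, hc']
    generalize (x * μ + y * ν) / m = w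
    field_simp
  · rw [hP, hμ]; field_simp; norm_num
  · rw [hP, ← hν]; field_simp; norm_num
  · rw [hP, ← hν]; field_simp; norm_num
  · rw [hP, hμ]; field_simp; norm_num
  all_goals (field_simp; ring)

/-- If `N` is `s` times the adjugate of `C`, then `P(φ) = -s A₂` and `P(-3φ) = s A₁`, which implies
the constraint of family III. The function `b` is divided by `A₁`, the normalisation of that family.
-/
theorem classified_of_det_ne_zero {K : ℂ → BoundaryCoeffs} {b : ℂ → ℂ}
    (hg : Generic φ α₁ α₂ α₃) (hdet : n₁ * n₃ - n₂ * n₄ ≠ 0)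
    (hn : Idempotent α₁ α₂ α₃ (-P σ τ φ) n₁ n₂ n₃ n₄)
    (hk : P σ τ (-3 * φ) = α₁ * n₁ + α₃ * n₂ + α₂ * n₃ + α₃ * n₄)
    (hK : ∀ᶠ v in codiscrete ℂ,
      K v = (evenSolution φ σ τ 1 n₁ n₂ n₃ n₄ v).smul (b v / sin (2 * v))) :
    Classified φ α₁ α₂ α₃ K := by
  obtain ⟨s, h0, rfl, rfl, rfl, rfl⟩ := hn.of_det_ne_zero hdet hg.α₁_ne hg.A₂_ne
  have hA := hg.A₁_ne
  have hk' : P σ τ (-3 * φ) = s * A₁ α₁ α₂ α₃ := by rw [hk, A₁]; ring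
  refine ⟨_, .inr (.inr (.inl ⟨σ, τ, fun v => b v / A₁ α₁ α₂ α₃, ?_, rfl⟩)), ?_⟩
  · rw [hk']
    linear_combination -A₁ α₁ α₂ α₃ * h0
  · filter_upwards [hK, eventually_regular φ 0] with v hv hr
    have hr2 := hr.two
    rw [hv]
    clear hK hk hv hn h0 hdet
    ext <;> simp only [solutionIII, evenSolution, evenFace, BoundaryCoeffs.smul, hk']
    all_goals
      clear hk'
      generalize A₁ α₁ α₂ α₃ = A at *
      field_simp <;> ring

/-- The formulas for `P(φ)` and `P(-3φ)` are linear in `(x, y)` with determinant `± (α₁ - α₂) M`;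
Cramer's rule yields the `x` and `y` of solution IV up to the factor `(α₁ - α₂) M`. -/
theorem classified_of_rank_one {K : ℂ → BoundaryCoeffs} {b : ℂ → ℂ} {μ ν x y : ℂ}
    (hg : Generic φ α₁ α₂ α₃) (hM : μ * ν * (α₁ + α₂) + (μ ^ 2 + ν ^ 2) * α₃ ≠ 0)
    (hn : -P σ τ φ = x * (α₂ * μ + α₃ * ν) - y * (α₃ * μ + α₁ * ν))
    (hk : P σ τ (-3 * φ) = x * (α₁ * μ + α₃ * ν) - y * (α₃ * μ + α₂ * ν))
    (hK : ∀ᶠ v in codiscrete ℂ,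
      K v = (evenSolution φ σ τ 1 (μ * x) (ν * x) (-(ν * y)) (-(μ * y)) v).smul
        (b v / sin (2 * v))) :
    Classified φ α₁ α₂ α₃ K := by
  have hα := sub_ne_zero.2 hg.ne
  have ex : (ν * α₂ + μ * α₃) * P σ τ φ + (ν * α₁ + μ * α₃) * P σ τ (-3 * φ)
      = (α₁ - α₂) * (μ * ν * (α₁ + α₂) + (μ ^ 2 + ν ^ 2) * α₃) * x := by
    linear_combination -(ν * α₂ + μ * α₃) * hn + (ν * α₁ + μ * α₃) * hk
  have ey : (μ * α₁ + ν * α₃) * P σ τ φ + (μ * α₂ + ν * α₃) * P σ τ (-3 * φ)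
      = (α₁ - α₂) * (μ * ν * (α₁ + α₂) + (μ ^ 2 + ν ^ 2) * α₃) * y := by
    linear_combination -(μ * α₁ + ν * α₃) * hn + (μ * α₂ + ν * α₃) * hk
  refine ⟨_, .inr (.inr (.inr (.inl ⟨μ, ν, σ, τ, fun v => b v /
    ((α₁ - α₂) * (μ * ν * (α₁ + α₂) + (μ ^ 2 + ν ^ 2) * α₃)), rfl⟩))), ?_⟩
  filter_upwards [hK, eventually_regular φ 0] with v hv hr
  have hr2 := hr.two
  rw [hv]
  clear hK hn hk hv
  ext <;> simp only [solutionIV, evenSolution, evenFace, BoundaryCoeffs.smul, ex, ey]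
  all_goals
    clear ex ey
    generalize μ * ν * (α₁ + α₂) + (μ ^ 2 + ν ^ 2) * α₃ = M at *
    generalize α₁ - α₂ = α at *
    field_simp <;> ring

/-- With `M = 0` the linear system for `(x, y)` is singular. Its compatibility condition `ev` says
that `(μ, ν)` is parallel to `(α₁ P(-3φ) + α₂ P(φ), -α₃ (P(φ) + P(-3φ)))`, and the constraint of
family V is `M = 0` on that vector. -/
theorem classified_of_singular {K : ℂ → BoundaryCoeffs} {b : ℂ → ℂ} {μ ν x y : ℂ}
    (hs : sin (2 * φ) ≠ 0) (hc : cos (2 * φ) ≠ 0)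
    (hg : Generic φ α₁ α₂ α₃) (hM : μ * ν * (α₁ + α₂) + (μ ^ 2 + ν ^ 2) * α₃ = 0)
    (hμν : μ ≠ 0 ∨ ν ≠ 0)
    (hn : -P σ τ φ = x * (α₂ * μ + α₃ * ν) - y * (α₃ * μ + α₁ * ν))
    (hk : P σ τ (-3 * φ) = x * (α₁ * μ + α₃ * ν) - y * (α₃ * μ + α₂ * ν))
    (hK : ∀ᶠ v in codiscrete ℂ,
      K v = (evenSolution φ σ τ 1 (μ * x) (ν * x) (-(ν * y)) (-(μ * y)) v).smul
        (b v / sin (2 * v))) :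
    Classified φ α₁ α₂ α₃ K := by
  have hα := sub_ne_zero.2 hg.ne
  have hα₃ := hg.α₃_ne
  have hν : ν ≠ 0 := by
    rintro rfl
    have h0 : μ ^ 2 * α₃ = 0 := by linear_combination hM
    simp [hα₃] at h0
    simp [h0] at hμν
  have em : P σ τ φ + P σ τ (-3 * φ) = (α₁ - α₂) * (x * μ + y * ν) := by
    linear_combination hk - hn
  have ev : α₃ * (P σ τ φ + P σ τ (-3 * φ)) * μ
      + ν * (α₁ * P σ τ (-3 * φ) + α₂ * P σ τ φ) = 0 := by
    linear_combination (α₃ * μ + α₁ * ν) * hk - (α₃ * μ + α₂ * ν) * hn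
      + (α₁ - α₂) * x * hM
  have constraint {p p' : ℂ} {t : ℂ} (ht : t ≠ 0) (h1 : t * (α₁ * p' + α₂ * p) = μ)
      (h2 : t * (-α₃ * (p + p')) = ν) :
      A₁ α₁ α₂ α₃ * p * p' + A₂ α₁ α₂ α₃ * (p ^ 2 + p' ^ 2) = 0 := by
    rw [← h1, ← h2] at hM
    refine mul_left_cancel₀ (mul_ne_zero (pow_ne_zero 2 ht) hα₃) ?_
    rw [A₁, A₂]
    linear_combination -hM
  by_cases hm : P σ τ φ + P σ τ (-3 * φ) = 0
  -- If the sum of the two values vanishes, `ev` makes both of them vanish. Hence `σ = τ = 0`, and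
  -- `a₁ = a₂ = 0`.
  · have h0 : P σ τ φ = 0 := by
      refine mul_left_cancel₀ (mul_ne_zero hν hα) ?_
      linear_combination -ev + (α₃ * μ + ν * α₁) * hm
    have h3 : P σ τ (-3 * φ) = 0 := by linear_combination hm - h0
    have h4 : sin (4 * φ) ≠ 0 := by
      rw [show 4 * φ = 2 * (2 * φ) by ring, sin_two_mul]
      exact mul_ne_zero (mul_ne_zero two_ne_zero hs) hc
    obtain ⟨rfl, rfl⟩ := eq_zero_of_P_eq_zero h4 h0 h3
    have hxy : x * μ + y * ν = 0 := by
      refine mul_left_cancel₀ hα ?_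
      linear_combination -em + hm
    -- New `σ, τ` are chosen so that the row of solution V is exactly `(μ, ν)`; as `x μ + y ν = 0`,
    -- the factor `z` in `a₁` and `a₂` vanishes.
    obtain ⟨σ, τ, e1, e3⟩ := exists_P_eq h4 (-(α₃ * μ + α₁ * ν) / (α₃ * (α₁ - α₂)))
      ((α₃ * μ + α₂ * ν) / (α₃ * (α₁ - α₂)))
    have eμ : α₁ * P σ τ (-3 * φ) + α₂ * P σ τ φ = μ := by
      rw [e1, e3]; field_simp; ring
    have em' : P σ τ φ + P σ τ (-3 * φ) = -ν / α₃ := by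
      rw [e1, e3]; field_simp; ring
    have eν : -α₃ * (-ν / α₃) = ν := by field_simp
    refine ⟨_, .inr (.inr (.inr (.inr ⟨4 * cos (2 * φ) ^ 2 * x / (-ν / α₃),
      -(4 * cos (2 * φ) ^ 2 * y / (-ν / α₃)), σ, τ, b,
      constraint one_ne_zero (by rw [eμ, one_mul]) (by rw [em', eν, one_mul]), rfl⟩))), ?_⟩
    filter_upwards [hK, eventually_regular φ 0] with v hv hr
    rw [hv, solutionV_eq (c := 0) hc em' (div_ne_zero (neg_ne_zero.2 hν) hα₃) eμ eν
      (by rw [hxy]; ring) b hr.two]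
    ext <;> simp [evenSolution, evenFace, BoundaryCoeffs.smul]
  · obtain ⟨m, em'⟩ : ∃ m, P σ τ φ + P σ τ (-3 * φ) = m := ⟨_, rfl⟩
    rw [em'] at hm em ev
    -- The factor between `(μ, ν)` and the row of solution V, read off from the second entry; it is
    -- absorbed into the column.
    obtain ⟨t, et⟩ : ∃ t, t = -ν / (α₃ * m) := ⟨_, rfl⟩
    have ht : t ≠ 0 := by
      rw [et]; exact div_ne_zero (neg_ne_zero.2 hν) (mul_ne_zero hα₃ hm)
    have eν : t * (-α₃ * m) = ν := by rw [et]; field_simp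
    obtain ⟨μ', eμ'⟩ : ∃ μ', α₁ * P σ τ (-3 * φ) + α₂ * P σ τ φ = μ' := ⟨_, rfl⟩
    have eμ : t * μ' = μ := by
      refine mul_left_cancel₀ (mul_ne_zero hα₃ hm) ?_
      rw [eμ'] at ev
      linear_combination -ev - μ' * eν
    refine ⟨_, .inr (.inr (.inr (.inr ⟨4 * cos (2 * φ) ^ 2 * (t * x) / m,
      -(4 * cos (2 * φ) ^ 2 * (t * y) / m), σ, τ, b,
      constraint ht (by rw [eμ', eμ]) (by rw [em', eν]), rfl⟩))), ?_⟩
    filter_upwards [hK, eventually_regular φ 0] with v hv hr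
    rw [hv, solutionV_eq (c := 1) hc em' hm eμ' rfl
      (by rw [← eμ, ← eν] at em; linear_combination -em) b hr.two, ← eμ, ← eν]
    congr 2 <;> ring

theorem classified_of_evenSolution {K : ℂ → BoundaryCoeffs} {b : ℂ → ℂ}
    (hs : sin (2 * φ) ≠ 0) (hc : cos (2 * φ) ≠ 0) (hg : Generic φ α₁ α₂ α₃)
    (h0 : ¬ (n₁ = 0 ∧ n₂ = 0 ∧ n₃ = 0 ∧ n₄ = 0))
    (hn : Idempotent α₁ α₂ α₃ (-P σ τ φ) n₁ n₂ n₃ n₄)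
    (hk : P σ τ (-3 * φ) = α₁ * n₁ + α₃ * n₂ + α₂ * n₃ + α₃ * n₄)
    (hK : ∀ᶠ v in codiscrete ℂ,
      K v = (evenSolution φ σ τ 1 n₁ n₂ n₃ n₄ v).smul (b v / sin (2 * v))) :
    Classified φ α₁ α₂ α₃ K := by
  by_cases hdet : n₁ * n₃ - n₂ * n₄ = 0
  swap
  · exact classified_of_det_ne_zero hg hdet hn hk hK
  obtain ⟨μ, ν, x, y, rfl, rfl, rfl, rfl, hμν⟩ := exists_rank_one h0 hdet
  have hxy : x ≠ 0 ∨ y ≠ 0 := by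
    by_contra! h
    simp [h.1, h.2] at h0
  have hn' := hn.lam_eq hμν hxy
  have hk' : P σ τ (-3 * φ) = x * (α₁ * μ + α₃ * ν) - y * (α₃ * μ + α₂ * ν) := by
    rw [hk]; ring
  by_cases hM : μ * ν * (α₁ + α₂) + (μ ^ 2 + ν ^ 2) * α₃ = 0
  · exact classified_of_singular hs hc hg hM hμν hn' hk' hK
  · exact classified_of_rank_one hg hM hn' hk' hK

end Identify

end DiluteGhost

theorem theorem2 (φ α₁ α₂ α₃ : ℂ)
    (hs : Complex.sin (2 * φ) ≠ 0) (hc : Complex.cos (2 * φ) ≠ 0) :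
    (∀ K : ℂ → DiluteGhost.BoundaryCoeffs, DiluteGhost.IsSolution φ α₁ α₂ α₃ K →
      ∀ u v : ℂ, Complex.sin (2 * u) ≠ 0 → Complex.sin (2 * v) ≠ 0 →
        DiluteGhost.BYBE φ α₁ α₂ α₃ K u v) ∧
    (DiluteGhost.Generic φ α₁ α₂ α₃ →
      ∀ K : ℂ → DiluteGhost.BoundaryCoeffs,
        (∀ᶠ u in Filter.codiscrete ℂ, ∀ᶠ v in Filter.codiscrete ℂ,
          DiluteGhost.BYBE φ α₁ α₂ α₃ K u v) →
        ∃ L : ℂ → DiluteGhost.BoundaryCoeffs, DiluteGhost.IsSolution φ α₁ α₂ α₃ L ∧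
          ∀ᶠ u in Filter.codiscrete ℂ, K u = L u) := by
  refine ⟨fun K hK u v hu hv => DiluteGhost.bybe_of_isSolution φ α₁ α₂ α₃ hs hc hK hu hv,
    fun hg K h => ?_⟩
  -- The three cases: some of `b₅, …, b₈` is nonzero at parameters with an accumulation point; off a
  -- discrete set those four vanish, while some of `b₁, …, b₄` persists; off a discrete set all
  -- eight vanish.
  by_cases h1 : ∃ᶠ u in Filter.codiscrete ℂ, ¬ (K u).IsEven
  · exact DiluteGhost.classified_of_not_isEven hs hc h h1
  have hK : ∀ᶠ u in Filter.codiscrete ℂ, (K u).IsEven :=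
    (Filter.not_frequently.1 h1).mono fun _ h => not_not.1 h
  by_cases h2 : ∃ᶠ u in Filter.codiscrete ℂ,
      ¬ ((K u).b₁ = 0 ∧ (K u).b₂ = 0 ∧ (K u).b₃ = 0 ∧ (K u).b₄ = 0)
  · obtain ⟨n₁, n₂, n₃, n₄, σ, τ, b, h0, hn, hk, hb⟩ := DiluteGhost.exists_evenFace hs h hK h2
    exact DiluteGhost.classified_of_evenSolution hs hc hg h0 hn hk hb
  · refine DiluteGhost.classified_of_no_ends hs h ?_
    filter_upwards [hK, Filter.not_frequently.1 h2] with u ⟨h5, h6, h7, h8⟩ h'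
    obtain ⟨e1, e2, e3, e4⟩ := not_not.1 h'
    ext <;> simp only [*]
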